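/- **Setting.** Fix a prime $p$. Let $A\neq 0$ be a $p$-torsion-free perfectoid ring: $A$ is $\pi$-adically complete and separated for some $\pi\in A$ with $\pi^p\mid p$, the Frobenius of $A/pA$ is surjective, and the kernel of Fontaine's map $\theta:W(A^\flat)\to A$ is principal. Let $\zeta_p,\zeta_{p^2},\dots\in A$ be a compatible system of primitive $p$-power roots of unity, i.e. $\zeta_{p^r}$ is a root of the $p^r$-th cyclotomic polynomial and $\zeta_{p^{r+1}}^p=\zeta_{p^r}$. Put $\varepsilon=(1,\zeta_p,\zeta_{p^2},\dots)\in A^\flat$, let $\varphi$ be the Frobenius of $W(A^\flat)$, and put $$\mu=[\varepsilon]-1,\qquad \xi=\sum_{i=0}^{p-1}[\varepsilon^{1/p}]^i,\qquad \tilde\xi_r=\varphi(\xi)\varphi^2(\xi)\cdots\varphi^r(\xi).$$ Let $\theta_r:W(A^\flat)\to W_r(A)$ be the ring homomorphism with ghost components $\theta,\theta\varphi,\dots,\theta\varphi^{r-1}$ obtained by functoriality from $W(A^\flat)\to W(W(A^\flat))$, and $\tilde\theta_r=\theta_r\varphi^{-r}$; it induces an isomorphism $W(A^\flat)/\tilde\xi_r\cong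 W_r(A)$, and $\tilde\theta_r(\mu)=[\zeta_{p^r}]-1$. For $K\in D(W(A^\flat))$ write $K/\tilde\xi_r=K\otimes^{\mathbb L}_{W(A^\flat)}W(A^\flat)/\tilde\xi_r$. For a complex $K$ of $f$-torsion-free modules, $L\eta_fK$ is the complex $\eta_fK$ with terms $\{x\in f^iK^i: dx\in f^{i+1}K^{i+1}\}\subseteq K^i[1/f]$. Let $D$ be a commutative algebra object of the symmetric monoidal category $D(W(A^\flat))$ with $H^n(D)=0$ for $n<0$, together with a $\varphi$-semilinear automorphism $\varphi_D$ of algebra objects, such that * (𝒲1) $H^0(D)$ is $\mu$-torsion-free; * (𝒲2) the groups $H^n((L\eta_\mu D)/\tilde\xi_r)$ are $p$-torsion-free for all $r\ge0$ and $n\in\mathbb Z$; * (𝒲3) the base change map $(L\eta_\mu D)/\tilde\xi_r\to L\eta_{[\zeta_{p^r}]-1}(D/\tilde\xi_r)$ is a quasi-isomorphism for all $r\ge1$. Put $\mathcal W_r^n(D)=H^n((L\eta_\mu D)/\tilde\xi_r)$ for $n\ge0$. By (𝒲1) there is, in degrees $n\ge 0$, a canonical map $\iota:\mathcal W_r^n(D)\to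 H^n(D/\tilde\xi_r)$, induced by $f^iK^i\subseteq K^i$ for $f=\mu$, $i\ge0$. On the groups $H^n(D/\tilde\xi_r)$ let $R':H^n(D/\tilde\xi_{r+1})\to H^n(D/\tilde\xi_r)$ be induced by $\varphi_D^{-1}\otimes\varphi^{-1}$, let $F:H^n(D/\tilde\xi_{r+1})\to H^n(D/\tilde\xi_r)$ be induced by the canonical projection, and $V:H^n(D/\tilde\xi_r)\to H^n(D/\tilde\xi_{r+1})$ by multiplication by $\varphi^{r+1}(\xi)$. Let $B$ be an $A$-algebra with $W_r(A)$-algebra homomorphisms $\lambda_r:W_r(B)\to H^0(D/\tilde\xi_r)$, $r\ge1$, such that $\lambda_rR=R'\lambda_{r+1}$, $\lambda_rF=F\lambda_{r+1}$ and $\lambda_{r+1}V=V\lambda_r$. **Witt complexes.** A Witt complex for $A\to B$ consists of graded-commutative differential graded $W_r(A)$-algebras $\mathcal W_r^\bullet=\bigoplus_{n\ge0}\mathcal W_r^n$ (with $x^2=0$ for $x$ of odd degree), $r\ge1$; morphisms $R:\mathcal W_{r+1}^\bullet\to\mathcal W_r^\bullet$ of differential graded rings, and $F:\mathcal W_{r+1}^\bullet\to\mathcal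 W_r^\bullet$ of graded rings, semilinear over $R,F:W_{r+1}(A)\to W_r(A)$; additive graded maps $V:\mathcal W_r^\bullet\to\mathcal W_{r+1}^\bullet$ with $V(F(a)x)=aV(x)$ for $a\in W_{r+1}(A)$ and $V(F(x)y)=xV(y)$; and $W_r(A)$-algebra homomorphisms $\lambda_r:W_r(B)\to\mathcal W_r^0$ commuting with $R,F,V$; such that $RF=FR$, $RV=VR$, $FV=p$, $FdV=d$, and $Fd\lambda_{r+1}([b])=\lambda_r([b])^{p-1}d\lambda_r([b])$ for $b\in B$. The initial Witt complex for $A\to B$ is the relative de Rham–Witt complex $W_r\Omega^\bullet_{B/A}$. **Theorem.** (1) There is exactly one structure of Witt complex for $A\to B$ on the groups $\mathcal W_r^n(D)$ such that: $W_r(A)$ acts through $\tilde\theta_r$; the differential is the Bockstein $\mathrm{Bock}_{\tilde\xi_r}$ of $L\eta_\mu D$; $\iota$ is multiplicative and unital and commutes with $F$ and $V$; $\iota R=\tilde\theta_r(\xi)^nR'\iota$ in degree $n$; and, for each $b\in W_r(B)$, the structure map $\lambda_r^{0}:W_r(B)\to\mathcal W_r^0(D)$ satisfies $([\zeta_{p^r}]-1)\cdot\big(\iota(\lambda_r^{0}(b))-\lambda_r(b)\big)=0$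 in $H^0(D/\tilde\xi_r)$ (so $\iota\circ\lambda_r^{0}=\lambda_r$ whenever $H^0(D/\tilde\xi_r)$ is $([\zeta_{p^r}]-1)$-torsion-free). (2) Consequently there is a unique morphism of Witt complexes $\lambda_r^\bullet:W_r\Omega_{B/A}^\bullet\to\mathcal W_r^\bullet(D)$. (3) These are functorial: if $(D',\varphi_{D'})$, $B'$, $\lambda'_r$ are further data as above, $f:D\to D'$ is a morphism of algebra objects commuting with $\varphi_D,\varphi_{D'}$, and $g:B\to B'$ is a morphism of $A$-algebras with $H^0(f/\tilde\xi_r)\circ\lambda_r=\lambda'_r\circ W_r(g)$ for all $r$, then the maps $\mathcal W_r^n(D)\to\mathcal W_r^n(D')$ induced by $f$ form a morphism of Witt complexes over $g$, and the square they form with $\lambda_r^\bullet$, $\lambda_r'^\bullet$ and $W_r\Omega^\bullet_{B/A}\to W_r\Omega^\bullet_{B'/A}$ commutes. -/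

import Mathlib

universe u v

open CategoryTheory

noncomputable section

namespace AInf

/-! ### Truncated Witt vectors and their operators -/

section Witt

variable (p : ℕ) [Fact p.Prime]

/-- The ring `W_r(B)` of `p`-typical Witt vectors of length `r`. -/
abbrev W (r : ℕ) (B : Type u) : Type u := TruncatedWittVector p r B

variable {p}

variable {B : Type u} [CommRing B] {B' : Type v} [CommRing B']

theorem mem_ker_truncate_iff (r : ℕ) (x : WittVector p B) :
    WittVector.truncate r x = 0 ↔ ∃ y, x = WittVector.verschiebung^[r] y := by
  rw [← RingHom.mem_ker, WittVector.mem_ker_truncate]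
  constructor
  · intro h
    exact ⟨_, WittVector.eq_iterate_verschiebung h⟩
  · rintro ⟨y, rfl⟩ i hi
    exact WittVector.iterate_verschiebung_coeff_eq_zero y hi

/-- The functoriality `W_r(B) → W_r(B')` in a ring homomorphism `B → B'`. -/
def W.map (r : ℕ) (g : B →+* B') : W p r B →+* W p r B' :=
  RingHom.liftOfSurjective (WittVector.truncate r) (WittVector.truncate_surjective p r B)
    ⟨(WittVector.truncate r).comp (WittVector.map g), by
      intro x hx
      rw [WittVector.mem_ker_truncate] at hx
      rw [RingHom.mem_ker, RingHom.comp_apply, ← RingHom.mem_ker, WittVector.mem_ker_truncate]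
      intro i hi
      rw [WittVector.map_coeff, hx i hi, map_zero]⟩

theorem W.map_truncate (r : ℕ) (g : B →+* B') (x : WittVector p B) :
    W.map r g (WittVector.truncate r x) = WittVector.truncate r (WittVector.map g x) :=
  RingHom.liftOfSurjective_comp_apply ..

/-- The restriction map `R : W_{r+1}(B) → W_r(B)`. -/
def W.R (r : ℕ) : W p (r + 1) B →+* W p r B := TruncatedWittVector.truncate (Nat.le_succ r)

theorem W.R_truncate (r : ℕ) (x : WittVector p B) :
    W.R r (WittVector.truncate (r + 1) x) = WittVector.truncate r x :=
  TruncatedWittVector.truncate_wittVector_truncate _ _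

/-- The Witt vector Frobenius `F : W_{r+1}(B) → W_r(B)`, induced by `F : W(B) → W(B)`. -/
def W.F (r : ℕ) : W p (r + 1) B →+* W p r B :=
  RingHom.liftOfSurjective (WittVector.truncate (r + 1))
    (WittVector.truncate_surjective p (r + 1) B)
    ⟨(WittVector.truncate r).comp WittVector.frobenius, by
      intro x hx
      rw [RingHom.mem_ker, mem_ker_truncate_iff] at hx
      obtain ⟨y, rfl⟩ := hx
      rw [RingHom.mem_ker, RingHom.comp_apply, Function.iterate_succ', Function.comp_apply,
        WittVector.frobenius_verschiebung, map_mul, (mem_ker_truncate_iff r _).2 ⟨y, rfl⟩,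
        zero_mul]⟩

theorem W.F_truncate (r : ℕ) (x : WittVector p B) :
    W.F r (WittVector.truncate (r + 1) x) = WittVector.truncate r (WittVector.frobenius x) :=
  RingHom.liftOfSurjective_comp_apply ..

/-- The Verschiebung `V : W_r(B) → W_{r+1}(B)`, `(b₀, b₁, …) ↦ (0, b₀, b₁, …)`. -/
def W.V (r : ℕ) : W p r B →+ W p (r + 1) B where
  toFun x := WittVector.truncate (r + 1) (WittVector.verschiebung x.out)
  map_zero' := by
    rw [mem_ker_truncate_iff]
    obtain ⟨y, hy⟩ := (mem_ker_truncate_iff r (0 : W p r B).out).1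
      (TruncatedWittVector.truncateFun_out _)
    exact ⟨y, by rw [Function.iterate_succ', Function.comp_apply, ← hy]⟩
  map_add' x y := by
    rw [← sub_eq_zero, ← map_add, ← map_sub, ← map_add, ← map_sub, mem_ker_truncate_iff]
    obtain ⟨z, hz⟩ := (mem_ker_truncate_iff r ((x + y).out - (x.out + y.out))).1 (by
      rw [map_sub, map_add, sub_eq_zero]
      have h (t : W p r B) : WittVector.truncate r t.out = t :=
        TruncatedWittVector.truncateFun_out t
      rw [h, h, h])
    exact ⟨z, by rw [Function.iterate_succ', Function.comp_apply, ← hz]⟩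

theorem W.V_truncate (r : ℕ) (x : WittVector p B) :
    W.V r (WittVector.truncate r x) = WittVector.truncate (r + 1) (WittVector.verschiebung x) := by
  change WittVector.truncate (r + 1) (WittVector.verschiebung _) = _
  rw [← sub_eq_zero, ← map_sub, ← map_sub, mem_ker_truncate_iff]
  obtain ⟨z, hz⟩ := (mem_ker_truncate_iff r ((WittVector.truncate r x).out - x)).1 (by
    rw [map_sub, sub_eq_zero]; exact TruncatedWittVector.truncateFun_out _)
  exact ⟨z, by rw [Function.iterate_succ', Function.comp_apply, ← hz]⟩

/-- The Teichmüller representative `[b] ∈ W_r(B)`. -/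
def W.teich (r : ℕ) (b : B) : W p r B := WittVector.truncate r (WittVector.teichmuller p b)

theorem W.R_map (r : ℕ) (g : B →+* B') (x : W p (r + 1) B) :
    W.R r (W.map (r + 1) g x) = W.map r g (W.R r x) := by
  obtain ⟨x, rfl⟩ := WittVector.truncate_surjective p (r + 1) B x
  rw [map_truncate, R_truncate, R_truncate, map_truncate]

theorem W.F_map {C : Type u} [CommRing C] (r : ℕ) (g : B →+* C) (x : W p (r + 1) B) :
    W.F r (W.map (r + 1) g x) = W.map r g (W.F r x) := by
  obtain ⟨x, rfl⟩ := WittVector.truncate_surjective p (r + 1) B x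
  rw [map_truncate, F_truncate, F_truncate, map_truncate]
  congr 1
  exact ((WittVector.frobenius_isPoly p).map g x).symm

theorem W.V_map (r : ℕ) (g : B →+* B') (x : W p r B) :
    W.V r (W.map r g x) = W.map (r + 1) g (W.V r x) := by
  obtain ⟨x, rfl⟩ := WittVector.truncate_surjective p r B x
  rw [map_truncate, V_truncate, V_truncate, map_truncate, WittVector.map_verschiebung]

theorem W.map_teich (r : ℕ) (g : B →+* B') (b : B) :
    W.map r g (W.teich r b) = (W.teich r (g b) : W p r B') := by
  rw [teich, map_truncate, WittVector.map_teichmuller]; rfl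

theorem W.map_map {B'' : Type*} [CommRing B''] (r : ℕ) (g : B →+* B') (g' : B' →+* B'')
    (x : W p r B) : W.map r g' (W.map r g x) = W.map r (g'.comp g) x := by
  obtain ⟨x, rfl⟩ := WittVector.truncate_surjective p r B x
  rw [map_truncate, map_truncate, map_truncate]
  rfl

end Witt
section Theta

variable {p : ℕ} [Fact p.Prime]

/-! ### The maps `θ_r` and `θ̃_r` -/

section Dwork

variable {k : Type u} [CommRing k] [CharP k p] [PerfectRing k p]

theorem dvd_frobenius_sub_pow (x : WittVector p k) :
    (p : WittVector p k) ∣ WittVector.frobenius x - x ^ p := by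
  rw [← Ideal.mem_span_singleton, WittVector.mem_span_p_iff_coeff_zero_eq_zero]
  have h := map_sub (WittVector.constantCoeff (p := p) (R := k)) (WittVector.frobenius x) (x ^ p)
  rw [map_pow] at h
  change (WittVector.frobenius x - x ^ p).coeff 0 = (WittVector.frobenius x).coeff 0 -
    (x.coeff 0) ^ p at h
  rw [h, WittVector.coeff_frobenius_charP, sub_self]

theorem mul_p_injective {x y : WittVector p k} (n : ℕ)
    (h : (p : WittVector p k) ^ n * x = (p : WittVector p k) ^ n * y) : x = y := by
  induction n with
  | zero => simpa using h
  | succ n ih =>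
    apply ih
    rw [← sub_eq_zero]
    apply WittVector.eq_zero_of_p_mul_eq_zero
    rw [sub_mul, sub_eq_zero]
    calc _ = (p : WittVector p k) ^ (n + 1) * x := by ring
      _ = (p : WittVector p k) ^ (n + 1) * y := h
      _ = _ := by ring

theorem ghost_unique (n : ℕ) {a b : ℕ → WittVector p k}
    (h : ∀ m < n, ∑ i ∈ Finset.range (m + 1), (p : WittVector p k) ^ i * a i ^ p ^ (m - i) =
      ∑ i ∈ Finset.range (m + 1), (p : WittVector p k) ^ i * b i ^ p ^ (m - i)) :
    ∀ m < n, a m = b m := by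
  intro m
  induction m using Nat.strong_induction_on with
  | _ m ih =>
    intro hm
    have hn := h m hm
    rw [Finset.sum_range_succ, Finset.sum_range_succ,
      Finset.sum_congr rfl (fun i hi => by
        rw [ih i (Finset.mem_range.1 hi) ((Finset.mem_range.1 hi).trans hm)])] at hn
    have := add_left_cancel hn
    simp only [Nat.sub_self, pow_zero, pow_one] at this
    exact mul_p_injective m this

/-- Over `W(k)`, with `k` perfect, Witt vectors are determined by their ghost components. -/
theorem ghost_ext {x y : WittVector p (WittVector p k)}
    (h : ∀ n, WittVector.ghostComponent n x = WittVector.ghostComponent n y) : x = y := by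
  ext1 n
  refine ghost_unique (n + 1) (a := x.coeff) (b := y.coeff) (fun m _ => ?_) n (Nat.lt_succ_self n)
  simpa only [WittVector.ghostComponent_apply, aeval_wittPolynomial] using h m

/-- For `k` perfect and `x ∈ W(k)`, the sequence `x, φ(x), φ²(x), …` is the sequence of ghost
components of an element of `W(W(k))`. -/
theorem exists_ghost_eq_frobenius (x : WittVector p k) :
    ∃ w : WittVector p (WittVector p k), ∀ n,
      WittVector.ghostComponent n w = WittVector.frobenius^[n] x := by
  have key : ∀ n, ∃ a : ℕ → WittVector p k, ∀ m < n,
      ∑ i ∈ Finset.range (m + 1), (p : WittVector p k) ^ i * a i ^ p ^ (m - i) =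
        WittVector.frobenius^[m] x := by
    intro n
    induction n with
    | zero => exact ⟨0, by simp⟩
    | succ n ih =>
      obtain ⟨a, ha⟩ := ih
      obtain ⟨c, hc⟩ : ((p : WittVector p k) ^ n) ∣ WittVector.frobenius^[n] x -
          ∑ i ∈ Finset.range n, (p : WittVector p k) ^ i * a i ^ p ^ (n - i) := by
        cases n with
        | zero => simp
        | succ n =>
          rw [Function.iterate_succ', Function.comp_apply, ← ha n (Nat.lt_succ_self n), map_sum,
            ← Finset.sum_sub_distrib]
          refine Finset.dvd_sum fun i hi => ?_
          have hi' : i ≤ n := Nat.lt_succ_iff.1 (Finset.mem_range.1 hi)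
          rw [map_mul, map_pow, map_natCast, map_pow, ← mul_sub]
          have h1 : n + 1 = i + (n - i + 1) := by omega
          have h2 : n + 1 - i = (n - i) + 1 := by omega
          rw [h2]
          conv_lhs => rw [h1]
          rw [pow_add, pow_succ' p, pow_mul]
          exact mul_dvd_mul_left _ (dvd_sub_pow_of_dvd_sub (dvd_frobenius_sub_pow _) _)
      refine ⟨fun i => if i = n then c else a i, fun m hm => ?_⟩
      rcases Nat.lt_succ_iff_lt_or_eq.1 hm with hm | rfl
      · rw [← ha m hm]
        refine Finset.sum_congr rfl fun i hi => ?_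
        have : i ≠ n := by have := Finset.mem_range.1 hi; omega
        simp [this]
      · rw [sub_eq_iff_eq_add'] at hc
        rw [Finset.sum_range_succ, hc]
        congr 1
        · refine Finset.sum_congr rfl fun i hi => ?_
          have : i ≠ m := by have := Finset.mem_range.1 hi; omega
          simp [this]
        · simp
  choose a ha using key
  refine ⟨WittVector.mk p fun i => a (i + 1) i, fun n => ?_⟩
  rw [WittVector.ghostComponent_apply, aeval_wittPolynomial, ← ha (n + 1) n (Nat.lt_succ_self n)]
  refine Finset.sum_congr rfl fun i hi => ?_
  have hi' := Finset.mem_range.1 hi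
  rw [WittVector.coeff_mk, ghost_unique (i + 1) (a := a (i + 1)) (b := a (n + 1))
    (fun m hm => by rw [ha (i + 1) m hm, ha (n + 1) m (by omega)]) i (Nat.lt_succ_self i)]

/-- For `k` perfect, the ring homomorphism `s : W(k) → W(W(k))` attached to the Frobenius lift `φ`
of the `p`-torsion-free ring `W(k)`: the ghost components of `s(x)` are `x, φ(x), φ²(x), …`. -/
def frobeniusSection : WittVector p k →+* WittVector p (WittVector p k) where
  toFun x := (exists_ghost_eq_frobenius x).choose
  map_one' := ghost_ext fun n => by
    rw [(exists_ghost_eq_frobenius _).choose_spec, map_one, ← RingHom.coe_pow, map_one]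
  map_mul' x y := ghost_ext fun n => by
    rw [(exists_ghost_eq_frobenius _).choose_spec, map_mul,
      (exists_ghost_eq_frobenius _).choose_spec, (exists_ghost_eq_frobenius _).choose_spec,
      ← RingHom.coe_pow, map_mul]
  map_zero' := ghost_ext fun n => by
    rw [(exists_ghost_eq_frobenius _).choose_spec, map_zero, ← RingHom.coe_pow, map_zero]
  map_add' x y := ghost_ext fun n => by
    rw [(exists_ghost_eq_frobenius _).choose_spec, map_add,
      (exists_ghost_eq_frobenius _).choose_spec, (exists_ghost_eq_frobenius _).choose_spec,
      ← RingHom.coe_pow, map_add]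

theorem ghostComponent_frobeniusSection (n : ℕ) (x : WittVector p k) :
    WittVector.ghostComponent n (frobeniusSection x) = WittVector.frobenius^[n] x :=
  (exists_ghost_eq_frobenius x).choose_spec n

end Dwork

variable (p) (A : Type u) [CommRing A] [Fact (¬ IsUnit (p : A))]

/-- The ring `W(A^♭)`. -/
abbrev Ainf : Type u := WittVector p (PreTilt A p)

/-- The Witt vector Frobenius `φ` of `W(A^♭)`, an automorphism. -/
abbrev phi : Ainf p A ≃+* Ainf p A := WittVector.frobeniusEquiv p (PreTilt A p)

variable [IsAdicComplete (Ideal.span {(p : A)}) A]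

/-- `θ_r : W(A^♭) → W_r(A)`, the composite
`W(A^♭) --s--> W(W(A^♭)) --W(θ)--> W(A) → W_r(A)` with `θ` Fontaine's map; its ghost
components are `θ, θφ, …, θφ^{r-1}`, and `θ_r([x]) = [x^{(0)}]`. -/
def theta (r : ℕ) : Ainf p A →+* W p r A :=
  (WittVector.truncate r).comp ((WittVector.map (WittVector.fontaineTheta A p)).comp frobeniusSection)

/-- `θ̃_r := θ_r ∘ φ^{-r} : W(A^♭) → W_r(A)`. -/
def thetaTilde (r : ℕ) : Ainf p A →+* W p r A :=
  (theta p A r).comp (((phi p A).symm : Ainf p A →+* Ainf p A) ^ r)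

/-- The explicit description of `θ_r` on Teichmüller elements. -/
theorem theta_teichmuller (r : ℕ) (x : PreTilt A p) :
    theta p A r (WittVector.teichmuller p x) = W.teich r x.untilt := by
  have h : frobeniusSection (WittVector.teichmuller p x) =
      WittVector.teichmuller p (WittVector.teichmuller p x) := ghost_ext fun n => by
    rw [ghostComponent_frobeniusSection, WittVector.ghostComponent_teichmuller, ← map_pow]
    induction n with
    | zero => simp
    | succ n ih =>
      rw [Function.iterate_succ', Function.comp_apply, ih, WittVector.frobenius_eq_map_frobenius,
        WittVector.map_teichmuller, frobenius_def, ← pow_mul, pow_succ]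
  rw [theta, RingHom.comp_apply, RingHom.comp_apply, h, WittVector.map_teichmuller,
    WittVector.fontaineTheta_teichmuller]
  rfl

/-! ### Perfectoid rings and the elements attached to a system of `p`-power roots of unity -/

/-- Perfectoid rings: `A` is `π`-adically complete (and separated) for some `π` such that `π ^ p`
divides `p`, the Frobenius of `A / p` is surjective, and the kernel of `θ : W(A^♭) → A` is
principal. The `p`-adic completeness, which is needed to write down `θ`, follows from the `π`-adic
one, so that the corresponding instance argument is no additional condition. -/
structure IsPerfectoid : Prop where
  exists_pi : ∃ π : A, π ^ p ∣ (p : A) ∧ IsAdicComplete (Ideal.span {π}) A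
  frobenius_surjective : Function.Surjective (frobenius (ModP A p) p)
  ker_theta_principal : (RingHom.ker (WittVector.fontaineTheta A p)).IsPrincipal

end Theta

section Elements

/-- A compatible system of primitive `p`-power roots of unity `ζ_{p^r}` in `A` (for `r = 0` the
condition says `ζ_1 = 1`). -/
structure RootSystem (p : ℕ) (A : Type u) [CommRing A] where
  ζ : ℕ → A
  isRoot : ∀ r, (Polynomial.cyclotomic (p ^ r) A).IsRoot (ζ r)
  pow_eq : ∀ r, ζ (r + 1) ^ p = ζ r

variable {p : ℕ} [Fact p.Prime] {A : Type u} [CommRing A] [Fact (¬ IsUnit (p : A))]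

/-- `ε = (1, ζ_p, ζ_{p²}, …) ∈ A^♭`. -/
def RootSystem.eps (Z : RootSystem p A) : PreTilt A p :=
  (⟨fun n => Ideal.Quotient.mk _ (Z.ζ n), fun n => by rw [← map_pow, Z.pow_eq]⟩ :
    Perfection (ModP A p) p)

/-- `μ = [ε] - 1 ∈ W(A^♭)`. -/
def RootSystem.mu (Z : RootSystem p A) : Ainf p A := WittVector.teichmuller p Z.eps - 1

/-- `ξ = 1 + [ε^{1/p}] + ⋯ + [ε^{1/p}]^{p-1} ∈ W(A^♭)`. -/
def RootSystem.xi (Z : RootSystem p A) : Ainf p A :=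
  ∑ i ∈ Finset.range p,
    WittVector.teichmuller p ((frobeniusEquiv (PreTilt A p) p).symm Z.eps) ^ i

/-- `φ^{i}(ξ)`. -/
def RootSystem.phiXi (Z : RootSystem p A) (i : ℕ) : Ainf p A := (phi p A)^[i] Z.xi

/-- `ξ̃_r = φ(ξ) ⋯ φ^r(ξ)`. -/
def RootSystem.xiTilde (Z : RootSystem p A) (r : ℕ) : Ainf p A :=
  ∏ i ∈ Finset.range r, Z.phiXi (i + 1)

theorem RootSystem.xiTilde_succ (Z : RootSystem p A) (r : ℕ) :
    Z.xiTilde (r + 1) = Z.xiTilde r * Z.phiXi (r + 1) := Finset.prod_range_succ _ _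

theorem RootSystem.phi_symm_xiTilde_succ (Z : RootSystem p A) (r : ℕ) :
    (phi p A).symm (Z.xiTilde (r + 1)) = Z.xiTilde r * Z.xi := by
  have h (i : ℕ) : (phi p A).symm (Z.phiXi (i + 1)) = Z.phiXi i := by
    rw [phiXi, Function.iterate_succ', Function.comp_apply, RingEquiv.symm_apply_apply]; rfl
  rw [xiTilde, map_prod, Finset.prod_congr rfl (fun i _ => h i), Finset.prod_range_succ']
  rfl

end Elements

/-! ### Complexes of modules, the décalage functor, reduction and cohomology -/

section Complexes

/-- Cochain complexes of `R`-modules, indexed by `ℤ`. -/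
structure Cx (R : Type u) [CommRing R] where
  X : ℤ → Type u
  [grp : ∀ i, AddCommGroup (X i)]
  [mod : ∀ i, Module R (X i)]
  d : ∀ i j, i + 1 = j → X i →ₗ[R] X j
  d_d : ∀ i j k (h : i + 1 = j) (h' : j + 1 = k) (x : X i), d j k h' (d i j h x) = 0

attribute [instance] Cx.grp Cx.mod

variable {R : Type u} [CommRing R]

/-- The complex of modules underlying a cochain complex in the category of modules. -/
def Cx.of (C : CochainComplex (ModuleCat.{u} R) ℤ) : Cx R where
  X i := C.X i
  d i j _ := (C.d i j).hom
  d_d i j k _ _ x := by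
    rw [← LinearMap.comp_apply, ← ModuleCat.hom_comp, C.d_comp_d]; rfl

/-- Cocycles. -/
def Cx.cocycles (K : Cx R) (n : ℤ) : Submodule R (K.X n) := LinearMap.ker (K.d n (n + 1) rfl)

/-- Coboundaries. -/
def Cx.coboundaries (K : Cx R) (n : ℤ) : Submodule R (K.X n) :=
  LinearMap.range (K.d (n - 1) n (by omega))

theorem Cx.mem_cocycles {K : Cx R} {n m : ℤ} (h : n + 1 = m) {x : K.X n} :
    x ∈ K.cocycles n ↔ K.d n m h x = 0 := by
  subst h; exact LinearMap.mem_ker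

theorem Cx.mem_coboundaries {K : Cx R} {n m : ℤ} (h : m + 1 = n) {x : K.X n} :
    x ∈ K.coboundaries n ↔ ∃ y, K.d m n h y = x := by
  obtain rfl : m = n - 1 := by omega
  exact LinearMap.mem_range

/-- `H^n(K)`: cocycles modulo coboundaries. -/
abbrev Hn (K : Cx R) (n : ℤ) : Type u :=
  K.cocycles n ⧸ (K.coboundaries n).submoduleOf (K.cocycles n)

/-- The class of a cocycle. -/
def Hn.mk {K : Cx R} {n : ℤ} (x : K.cocycles n) : Hn K n := Submodule.Quotient.mk x

theorem Hn.mk_surjective {K : Cx R} {n : ℤ} : Function.Surjective (Hn.mk (K := K) (n := n)) :=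
  Submodule.mkQ_surjective _

theorem Hn.mk_eq_iff {K : Cx R} {n m : ℤ} (h : m + 1 = n) (x y : K.cocycles n) :
    Hn.mk x = Hn.mk y ↔ ∃ z, K.d m n h z = x.1 - y.1 := by
  rw [← Cx.mem_coboundaries]
  exact Submodule.Quotient.eq _

theorem Hn.mk_eq_zero {K : Cx R} {n m : ℤ} (h : m + 1 = n) (x : K.cocycles n) :
    Hn.mk x = 0 ↔ ∃ z, K.d m n h z = x.1 := by
  rw [← Cx.mem_coboundaries]
  exact Submodule.Quotient.mk_eq_zero _

/-- `K ⊗ R/a = K/aK`. This is the derived tensor product `K ⊗^L R/a` whenever `a` is a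
non-zero-divisor of `R` and `K` consists of `a`-torsion-free modules. -/
def modBy (a : R) (K : Cx R) : Cx R where
  X i := K.X i ⧸ LinearMap.range (LinearMap.lsmul R (K.X i) a)
  d i j h := Submodule.mapQ _ _ (K.d i j h) (by
    rintro _ ⟨x, rfl⟩
    exact ⟨K.d i j h x, (map_smul (K.d i j h) a x).symm⟩)
  d_d i j k h h' x := by
    obtain ⟨x, rfl⟩ := Submodule.mkQ_surjective _ x
    exact congrArg Submodule.Quotient.mk (K.d_d i j k h h' x)

/-- The class in `K/aK` of an element of `K`. -/
def modBy.mk (a : R) (K : Cx R) (i : ℤ) : K.X i →ₗ[R] (modBy a K).X i := Submodule.mkQ _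

theorem modBy.mk_surjective (a : R) (K : Cx R) (i : ℤ) : Function.Surjective (modBy.mk a K i) :=
  Submodule.mkQ_surjective _

theorem modBy.mk_eq_zero {a : R} {K : Cx R} {i : ℤ} {x : K.X i} :
    modBy.mk a K i x = 0 ↔ ∃ y, a • y = x :=
  Submodule.Quotient.mk_eq_zero _

theorem modBy.d_mk {a : R} {K : Cx R} (i j : ℤ) (h : i + 1 = j) (x : K.X i) :
    (modBy a K).d i j h (modBy.mk a K i x) = modBy.mk a K j (K.d i j h x) := rfl

/-- The map `K^i/aK^i → Q` induced by a map `K^i → Q` that kills `aK^i`. -/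
def modBy.lift (a : R) (K : Cx R) (i : ℤ) {σ : R →+* R} {Q : Type u} [AddCommGroup Q] [Module R Q]
    (f : K.X i →ₛₗ[σ] Q) (h : ∀ x, f (a • x) = 0) : (modBy a K).X i →ₛₗ[σ] Q :=
  Submodule.liftQ _ f (by rintro _ ⟨x, rfl⟩; exact h x)

theorem modBy.lift_mk (a : R) (K : Cx R) (i : ℤ) {σ : R →+* R} {Q : Type u} [AddCommGroup Q]
    [Module R Q] (f : K.X i →ₛₗ[σ] Q) (h : ∀ x, f (a • x) = 0) (x : K.X i) :
    modBy.lift a K i f h (modBy.mk a K i x) = f x := rfl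

/-- The degree `i` term of `η_f K`. For `f`-torsion-free `K`, the map `(y, z) ↦ f ^ i y` identifies
it with `{x ∈ f ^ i K^i : d x ∈ f ^ {i+1} K^{i+1}} ⊆ K^i[1/f]`: the element `x = f ^ i y` satisfies
`d x = f ^ i d y ∈ f ^ {i+1} K^{i+1}` if and only if `d y = f z` for some, unique, `z`; then
`d x = f ^ {i+1} z`. (The condition `d z = 0` is automatic in the torsion-free case.) -/
def etaTerm (f : R) (K : Cx R) (i : ℤ) : Submodule R (K.X i × K.X (i + 1)) where
  carrier := {w | K.d i (i + 1) rfl w.1 = f • w.2 ∧ K.d (i + 1) (i + 1 + 1) rfl w.2 = 0}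
  add_mem' := by
    rintro a b ⟨ha, ha'⟩ ⟨hb, hb'⟩
    refine ⟨?_, ?_⟩
    · rw [Prod.fst_add, Prod.snd_add, map_add, ha, hb, smul_add]
    · rw [Prod.snd_add, map_add, ha', hb', add_zero]
  zero_mem' := by simp
  smul_mem' := by
    rintro c a ⟨ha, ha'⟩
    refine ⟨?_, ?_⟩
    · rw [Prod.smul_fst, Prod.smul_snd, map_smul, ha, smul_comm]
    · rw [Prod.smul_snd, map_smul, ha', smul_zero]

/-- The differential of `η_f K`: as `d (f ^ i y) = f ^ {i+1} z`, it is `(y, z) ↦ (z, 0)`. -/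
def etaD (f : R) (K : Cx R) (i : ℤ) : ∀ j, i + 1 = j → etaTerm f K i →ₗ[R] etaTerm f K j
  | _, rfl =>
    { toFun := fun w => ⟨(w.1.2, 0), by
        refine ⟨?_, map_zero _⟩
        rw [w.2.2, smul_zero]⟩
      map_add' := fun _ _ => Subtype.ext (Prod.ext rfl (add_zero _).symm)
      map_smul' := fun _ _ => Subtype.ext (Prod.ext rfl (smul_zero _).symm) }

/-- The décalage `η_f K`; it computes `Lη_f` on every `K` consisting of `f`-torsion-free modules. -/
def eta (f : R) (K : Cx R) : Cx R where
  X i := etaTerm f K i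
  d i j h := etaD f K i j h
  d_d := by rintro i _ _ rfl rfl w; rfl

/-! Semilinear maps of complexes. -/

/-- A `σ`-semilinear map of complexes. -/
structure SemiMap (σ : R →+* R) (K L : Cx R) where
  toFun : ∀ i, K.X i →ₛₗ[σ] L.X i
  comm : ∀ i j h x, L.d i j h (toFun i x) = toFun j (K.d i j h x)

variable {σ : R →+* R} {K L M : Cx R}

/-- The map on cohomology induced by a map that preserves cocycles and coboundaries. -/
def Hn.lift (n m : ℤ) (f : K.X n →ₛₗ[σ] L.X m)
    (h₁ : ∀ x ∈ K.cocycles n, f x ∈ L.cocycles m)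
    (h₂ : ∀ x ∈ K.coboundaries n, f x ∈ L.coboundaries m) : Hn K n →ₛₗ[σ] Hn L m :=
  Submodule.mapQ _ _
    (LinearMap.codRestrict (L.cocycles m) (f.comp (Submodule.subtype _)) (fun x => h₁ _ x.2))
    (by rintro ⟨x, hx⟩ hx'; exact h₂ x hx')

/-- The map induced on cohomology. -/
def SemiMap.H (f : SemiMap σ K L) (n : ℤ) : Hn K n →ₛₗ[σ] Hn L n :=
  Hn.lift n n (f.toFun n)
    (fun x hx => by rw [Cx.mem_cocycles rfl, f.comm, (Cx.mem_cocycles rfl).1 hx, map_zero])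
    (fun x hx => by
      obtain ⟨y, rfl⟩ := (Cx.mem_coboundaries (sub_add_cancel n 1)).1 hx
      rw [← f.comm]
      exact (Cx.mem_coboundaries (sub_add_cancel n 1)).2 ⟨_, rfl⟩)

/-- The map `K/aK → L/bL` induced by `f : K → L` with `f(aK) ⊆ bL`. -/
def SemiMap.modBy (f : SemiMap σ K L) (a b : R) (h : ∀ i x, ∃ y, b • y = f.toFun i (a • x)) :
    SemiMap σ (modBy a K) (modBy b L) where
  toFun i := modBy.lift a K i ((modBy.mk b L i).comp (f.toFun i))
    (fun x => modBy.mk_eq_zero.2 (h i x))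
  comm i j hij x := by
    obtain ⟨x, rfl⟩ := modBy.mk_surjective a K i x
    exact congrArg (modBy.mk b L j) (f.comm i j hij x)

/-- Multiplication by a scalar. -/
def SemiMap.scalar (c : R) (K : Cx R) : SemiMap (RingHom.id R) K K where
  toFun i := LinearMap.lsmul R (K.X i) c
  comm i j h x := map_smul (K.d i j h) c x

/-- The functoriality of `η_f`. -/
def SemiMap.eta (g : SemiMap (RingHom.id R) K L) (f : R) :
    SemiMap (RingHom.id R) (eta f K) (eta f L) where
  toFun i := LinearMap.restrict (LinearMap.prodMap (g.toFun i) (g.toFun (i + 1)))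
    (p := etaTerm f K i) (q := etaTerm f L i) (by
      rintro ⟨y, z⟩ ⟨h, h'⟩
      refine ⟨?_, ?_⟩
      · exact (g.comm _ _ _ _).trans ((congrArg (g.toFun (i + 1)) h).trans (map_smul _ _ _))
      · exact (g.comm _ _ _ _).trans ((congrArg (g.toFun (i + 1 + 1)) h').trans (map_zero _)))
  comm := by
    rintro i _ rfl x
    exact Subtype.ext (Prod.ext rfl (map_zero (g.toFun _)).symm)

/-- The base change map `η_f(K)/a → η_f(K/a)`, i.e. `(y, z) ↦ (y mod a, z mod a)`. -/
def baseChange (f a : R) (K : Cx R) :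
    SemiMap (RingHom.id R) (modBy a (eta f K)) (eta f (modBy a K)) where
  toFun i := modBy.lift a (eta f K) i (Q := etaTerm f (modBy a K) i)
    (LinearMap.restrict (LinearMap.prodMap (modBy.mk a K i) (modBy.mk a K (i + 1)))
      (p := etaTerm f K i) (q := etaTerm f (modBy a K) i) (by
        rintro ⟨y, z⟩ ⟨h, h'⟩
        exact ⟨congrArg (modBy.mk a K (i + 1)) h, congrArg (modBy.mk a K (i + 1 + 1)) h'⟩))
    (fun w => Subtype.ext (Prod.ext (modBy.mk_eq_zero.2 ⟨w.1.1, rfl⟩)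
      (modBy.mk_eq_zero.2 ⟨w.1.2, rfl⟩)))
  comm := by
    rintro i _ rfl x
    obtain ⟨x, rfl⟩ := modBy.mk_surjective a (eta f K) i x
    exact Subtype.ext (Prod.ext rfl (map_zero (modBy.mk a K _)))

/-- The canonical map `H^n(η_f K / a) → H^n(K / a)` for `n ≥ 0`, induced in degree `n` by
`η_f K ∋ f ^ n y ↦ f ^ n y ∈ K`, i.e. by `(y, z) ↦ f ^ n y`. It exists if `H^0(K)` is
`f`-torsion-free (this makes it kill the coboundaries coming from degree `-1`). -/
def canMap (f a : R) (K : Cx R) (hK : ∀ c : Hn K 0, f • c = 0 → c = 0) (n : ℕ) :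
    Hn (modBy a (eta f K)) n →ₗ[R] Hn (modBy a K) n :=
  Hn.lift n n
    (modBy.lift a (eta f K) n
      ((modBy.mk a K n).comp
        (f ^ n • (LinearMap.fst R _ _).comp (Submodule.subtype (etaTerm f K n))))
      (fun w => modBy.mk_eq_zero.2 ⟨f ^ n • w.1.1, smul_comm _ _ _⟩))
    (by
      intro x hx
      obtain ⟨w, rfl⟩ := modBy.mk_surjective a (eta f K) n x
      obtain ⟨v, hv⟩ := modBy.mk_eq_zero.1 ((Cx.mem_cocycles rfl).1 hx)
      have hv1 : a • v.1.1 = w.1.2 :=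
        congrArg (fun t : etaTerm f K (n + 1) => t.1.1) hv
      refine (Cx.mem_cocycles rfl).2 (modBy.mk_eq_zero.2 ⟨f ^ (n + 1) • v.1.1, ?_⟩)
      have h1 : K.d n (n + 1) rfl w.1.1 = f • w.1.2 := w.2.1
      change _ = K.d n (n + 1) rfl (f ^ n • w.1.1)
      rw [map_smul, h1, smul_comm, hv1, pow_succ, mul_smul])
    (by
      intro x hx
      obtain ⟨m, hm⟩ : ∃ m : ℤ, m + 1 = n := ⟨n - 1, by omega⟩
      obtain ⟨v, rfl⟩ := (Cx.mem_coboundaries hm).1 hx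
      obtain ⟨w, rfl⟩ := modBy.mk_surjective a (eta f K) m v
      rw [Cx.mem_coboundaries hm]
      suffices h : ∃ y, K.d m n hm y = f ^ n • (etaD f K m n hm w).1.1 by
        obtain ⟨y, hy⟩ := h
        exact ⟨modBy.mk a K m y, congrArg (modBy.mk a K n) hy⟩
      cases n with
      | zero =>
        obtain rfl : m = -1 := by omega
        have h1 : K.d (-1) 0 rfl w.1.1 = f • w.1.2 := w.2.1
        have h2 : K.d 0 1 rfl w.1.2 = 0 := w.2.2
        have h3 := hK (Hn.mk ⟨w.1.2, (Cx.mem_cocycles rfl).2 h2⟩)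
          ((Hn.mk_eq_zero (by norm_num : (-1 : ℤ) + 1 = 0)
            (f • (⟨w.1.2, (Cx.mem_cocycles rfl).2 h2⟩ : K.cocycles 0))).2 ⟨_, h1⟩)
        obtain ⟨y, hy⟩ := (Hn.mk_eq_zero (by norm_num : (-1 : ℤ) + 1 = 0) _).1 h3
        exact ⟨y, hy.trans (by rw [pow_zero, one_smul]; rfl)⟩
      | succ k =>
        obtain rfl : m = k := by push_cast at hm; omega
        have h1 : K.d k (k + 1) rfl w.1.1 = f • w.1.2 := w.2.1
        refine ⟨f ^ k • w.1.1, ?_⟩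
        rw [map_smul, pow_succ, mul_smul]
        exact congrArg (f ^ k • ·) h1)

end Complexes
/-! ### Products, homotopies, and commutative algebras with Frobenius in `D(W(A^♭))` -/

section Algebras

variable {R : Type u} [CommRing R]

/-- The sign `(-1) ^ n`. -/
abbrev sgn (n : ℤ) : ℤ := (Int.negOnePow n : ℤ)

/-- A family of semi-bilinear maps `K^i × L^j → M^k` of degree `e`, i.e. `k = i + j + e`. -/
abbrev BiFam (σ : R →+* R) (K L M : Cx R) (e : ℤ) :=
  ∀ i j k : ℤ, i + j + e = k → K.X i →ₛₗ[σ] L.X j →ₛₗ[σ] M.X k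

/-- A map of complexes `K ⊗ L → M`, written as a bilinear pairing that satisfies the Leibniz rule.
-/
structure Pairing (K L M : Cx R) where
  toFun : BiFam (RingHom.id R) K L M 0
  leibniz : ∀ i j k i' j' k' (hk : i + j + 0 = k) (hk' : k + 1 = k') (hi : i + 1 = i')
    (hj : j + 1 = j') (x : K.X i) (y : L.X j),
    M.d k k' hk' (toFun i j k hk x y) =
      toFun i' j k' (by omega) (K.d i i' hi x) y +
        sgn i • toFun i j' k' (by omega) x (L.d j j' hj y)

variable {σ : R →+* R} {K L M : Cx R}

/-- The pairing on reductions modulo `a`. -/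
def Pairing.modBy (m : Pairing K L M) (a : R) :
    Pairing (modBy a K) (modBy a L) (modBy a M) where
  toFun i j k h := modBy.lift a K i
    { toFun := fun x => modBy.lift a L j ((modBy.mk a M k).comp (m.toFun i j k h x)) (fun y =>
        modBy.mk_eq_zero.2 ⟨m.toFun i j k h x y, (map_smul (m.toFun i j k h x) a y).symm⟩)
      map_add' := fun x x' => by
        ext y
        obtain ⟨y, rfl⟩ := modBy.mk_surjective a L j y
        simp only [LinearMap.add_apply, modBy.lift_mk, LinearMap.comp_apply, map_add]
      map_smul' := fun c x => by
        ext y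
        obtain ⟨y, rfl⟩ := modBy.mk_surjective a L j y
        simp only [LinearMap.smul_apply, modBy.lift_mk, LinearMap.comp_apply, map_smul,
          RingHom.id_apply] }
    (fun x => by
      ext y
      obtain ⟨y, rfl⟩ := modBy.mk_surjective a L j y
      exact modBy.mk_eq_zero.2 ⟨m.toFun i j k h x y, by rw [map_smul, LinearMap.smul_apply]⟩)
  leibniz i j k i' j' k' hk hk' hi hj x y := by
    obtain ⟨x, rfl⟩ := modBy.mk_surjective a K i x
    obtain ⟨y, rfl⟩ := modBy.mk_surjective a L j y
    have h := congrArg (modBy.mk a M k') (m.leibniz i j k i' j' k' hk hk' hi hj x y)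
    rw [map_add, map_zsmul] at h
    exact h

/-- The product of two cocycles. -/
def Pairing.cocycle (m : Pairing K L M) {i j k : ℤ} (h : i + j = k) (x : K.cocycles i)
    (y : L.cocycles j) : M.cocycles k :=
  ⟨m.toFun i j k (by omega) x.1 y.1, by
    rw [Cx.mem_cocycles rfl, m.leibniz i j k (i + 1) (j + 1) (k + 1) _ rfl rfl rfl,
      (Cx.mem_cocycles rfl).1 x.2, (Cx.mem_cocycles rfl).1 y.2]
    simp⟩

theorem Pairing.cocycle_congr (m : Pairing K L M) {i j k : ℤ} (h : i + j = k)
    {x x' : K.cocycles i} {y y' : L.cocycles j} (hx : Hn.mk x = Hn.mk x')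
    (hy : Hn.mk y = Hn.mk y') : Hn.mk (m.cocycle h x y) = Hn.mk (m.cocycle h x' y') := by
  obtain ⟨z, hz⟩ := (Hn.mk_eq_iff (sub_add_cancel i 1) _ _).1 hx
  obtain ⟨w, hw⟩ := (Hn.mk_eq_iff (sub_add_cancel j 1) _ _).1 hy
  refine (Hn.mk_eq_iff (sub_add_cancel k 1) _ _).2 ⟨m.toFun (i - 1) j (k - 1) (by omega) z y.1 +
    sgn i • m.toFun i (j - 1) (k - 1) (by omega) x'.1 w, ?_⟩
  rw [map_add, map_zsmul, m.leibniz (i - 1) j (k - 1) i (j + 1) k _ _ (by omega) rfl,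
    m.leibniz i (j - 1) (k - 1) (i + 1) j k _ _ rfl (by omega),
    (Cx.mem_cocycles rfl).1 x'.2, (Cx.mem_cocycles rfl).1 y.2, hz, hw]
  have hs : sgn i * sgn i = 1 := by
    rw [← Units.val_mul, Int.units_mul_self, Units.val_one]
  simp only [map_zero, smul_zero, add_zero, LinearMap.zero_apply, zero_add, map_sub,
    LinearMap.sub_apply, smul_smul, hs, one_smul, Pairing.cocycle]
  abel

/-- The product induced on cohomology. -/
def Pairing.H (m : Pairing K L M) (i j k : ℤ) (h : i + j = k) (c : Hn K i) (c' : Hn L j) :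
    Hn M k :=
  Quotient.map₂ (m.cocycle h) (fun _ _ hx _ _ hy =>
    Quotient.exact (m.cocycle_congr h (Quotient.sound hx) (Quotient.sound hy))) c c'

theorem Pairing.H_mk (m : Pairing K L M) (i j k : ℤ) (h : i + j = k) (x : K.cocycles i)
    (y : L.cocycles j) : m.H i j k h (Hn.mk x) (Hn.mk y) = Hn.mk (m.cocycle h x y) := rfl

/-- Homotopy of `σ`-semilinear maps of complexes. -/
def Homotopic (σ : R →+* R) (f g : ∀ i, K.X i → L.X i) : Prop :=
  ∃ h : ∀ i j, j + 1 = i → K.X i →ₛₗ[σ] L.X j, ∀ i j k (hj : j + 1 = i) (hk : i + 1 = k) (x : K.X i),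
    f i x - g i x = L.d j i hj (h i j hj x) + h k i hk (K.d i k hk x)

/-- Homotopy of (semilinear) maps of complexes `K ⊗ L → M`, written as families of pairings. -/
def BiHomotopic (σ : R →+* R) (f g : ∀ i j k, i + j + 0 = k → K.X i → L.X j → M.X k) : Prop :=
  ∃ h : BiFam σ K L M (-1), ∀ i j k i' j' k' (hk : i + j + 0 = k) (hk' : k' + 1 = k)
    (hi : i + 1 = i') (hj : j + 1 = j') (x : K.X i) (y : L.X j),
    f i j k hk x y - g i j k hk x y =
      M.d k' k hk' (h i j k' (by omega) x y) + h i' j k (by omega) (K.d i i' hi x) y +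
        sgn i • h i j' k (by omega) x (L.d j j' hj y)

/-- Homotopy of maps of complexes `K ⊗ K ⊗ K → K`, written as families of trilinear maps. -/
def TriHomotopic (f g : ∀ i j k l, i + j + k = l → K.X i → K.X j → K.X k → K.X l) : Prop :=
  ∃ h : ∀ i j k l, i + j + k - 1 = l → K.X i →ₗ[R] K.X j →ₗ[R] K.X k →ₗ[R] K.X l,
    ∀ i j k l i' j' k' l' (hl : i + j + k = l) (hl' : l' + 1 = l) (hi : i + 1 = i')
      (hj : j + 1 = j') (hk : k + 1 = k') (x : K.X i) (y : K.X j) (z : K.X k),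
      f i j k l hl x y z - g i j k l hl x y z =
        K.d l' l hl' (h i j k l' (by omega) x y z) +
          h i' j k l (by omega) (K.d i i' hi x) y z +
          sgn i • h i j' k l (by omega) x (K.d j j' hj y) z +
          sgn (i + j) • h i j k' l (by omega) x y (K.d k k' hk z)

variable (R) in
/-- A commutative algebra object of the derived category `D(R)`, with its symmetric monoidal
structure `⊗^L`. The category `D(R)` is modelled by the homotopy category of K-projective complexes
of projective modules, on which `⊗^L` is the tensor product of complexes: the algebra is a complex
`C` with a product `C ⊗ C → C` and a unit `R → C` that satisfy the axioms up to homotopy. -/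
structure DAlg where
  C : CochainComplex (ModuleCat.{u} R) ℤ
  projective : ∀ i, Module.Projective R (C.X i)
  kProjective : C.IsKProjective
  mul : Pairing (Cx.of C) (Cx.of C) (Cx.of C)
  one : (Cx.of C).cocycles 0
  one_mul : Homotopic (RingHom.id R) (K := Cx.of C) (L := Cx.of C)
    (fun i x => mul.toFun 0 i i (by omega) one.1 x) (fun _ x => x)
  mul_comm : BiHomotopic (RingHom.id R) (K := Cx.of C) (L := Cx.of C) (M := Cx.of C)
    (fun i j k h x y => mul.toFun i j k h x y)
    (fun i j k h x y => sgn (i * j) • mul.toFun j i k (by omega) y x)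
  mul_assoc : TriHomotopic (K := Cx.of C)
    (fun i j k l h x y z => mul.toFun (i + j) k l (by omega)
      (mul.toFun i j (i + j) (by omega) x y) z)
    (fun i j k l h x y z => mul.toFun i (j + k) l (by omega) x
      (mul.toFun j k (j + k) (by omega) y z))

/-- The underlying complex of modules. -/
abbrev DAlg.cx (D : DAlg R) : Cx R := Cx.of D.C

/-- The condition that a semilinear map of complexes represents a morphism of algebra objects. -/
structure SemiMap.IsAlgMap {D D' : DAlg R} (f : SemiMap σ D.cx D'.cx) : Prop where
  mul : BiHomotopic σ (K := D.cx) (L := D.cx) (M := D'.cx)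
    (fun i j k h x y => f.toFun k (D.mul.toFun i j k h x y))
    (fun i j k h x y => D'.mul.toFun i j k h (f.toFun i x) (f.toFun j y))
  one : f.toFun 0 D.one.1 - D'.one.1 ∈ D'.cx.coboundaries 0

/-- The class of `1` in `H^0(D/a)`. -/
def DAlg.oneMod (D : DAlg R) (a : R) : Hn (AInf.modBy a D.cx) 0 :=
  Hn.mk ⟨modBy.mk a D.cx 0 D.one.1, (Cx.mem_cocycles rfl).2 (by
    rw [modBy.d_mk, (Cx.mem_cocycles rfl).1 D.one.2, map_zero])⟩

/-- The product `H^i(D/a) × H^j(D/a) → H^k(D/a)`, `k = i + j`. -/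
def DAlg.mulMod (D : DAlg R) (a : R) (i j k : ℤ) (h : i + j = k) :
    Hn (AInf.modBy a D.cx) i → Hn (AInf.modBy a D.cx) j → Hn (AInf.modBy a D.cx) k :=
  (D.mul.modBy a).H i j k h

/-- `δ : H^n(K/a) → H^m(K/a)`, `m = n + 1`, is the Bockstein `Bock_a`, i.e. the boundary map
attached to `0 → K/a → K/a² → K/a → 0`: the class of `x ∈ K^n` with `d x = a z` goes to the class
of `z`. -/
def IsBockstein (a : R) (K : Cx R) (n m : ℤ) (h : n + 1 = m)
    (δ : Hn (modBy a K) n → Hn (modBy a K) m) : Prop :=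
  ∀ (x : K.X n) (z : K.X m) (c : (modBy a K).cocycles n) (c' : (modBy a K).cocycles m),
    c.1 = modBy.mk a K n x → c'.1 = modBy.mk a K m z → K.d n m h x = a • z →
      δ (Hn.mk c) = Hn.mk c'

end Algebras

section Frobenius

variable (p : ℕ) [Fact p.Prime] (A : Type u) [CommRing A] [Fact (¬ IsUnit (p : A))]

/-- A commutative algebra object `D` of `D(W(A^♭))` with a `φ`-semilinear automorphism `φ_D` of
algebra objects. -/
structure FrobAlg extends DAlg (Ainf p A) where
  frob : SemiMap (phi p A : Ainf p A →+* Ainf p A) toDAlg.cx toDAlg.cx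
  frobInv : SemiMap ((phi p A).symm : Ainf p A →+* Ainf p A) toDAlg.cx toDAlg.cx
  frob_frobInv : Homotopic (RingHom.id _) (K := toDAlg.cx) (L := toDAlg.cx)
    (fun i x => frob.toFun i (frobInv.toFun i x)) (fun _ x => x)
  frobInv_frob : Homotopic (RingHom.id _) (K := toDAlg.cx) (L := toDAlg.cx)
    (fun i x => frobInv.toFun i (frob.toFun i x)) (fun _ x => x)
  frob_isAlgMap : SemiMap.IsAlgMap (D := toDAlg) (D' := toDAlg) frob

variable {p A}

/-- Morphisms of commutative algebra objects with Frobenius. -/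
structure FrobAlg.Hom (D D' : FrobAlg p A) where
  map : SemiMap (RingHom.id (Ainf p A)) D.cx D'.cx
  isAlgMap : SemiMap.IsAlgMap (D := D.toDAlg) (D' := D'.toDAlg) map
  frob_comm : Homotopic (phi p A : Ainf p A →+* Ainf p A) (K := D.cx) (L := D'.cx)
    (fun i x => map.toFun i (D.frob.toFun i x)) (fun i x => D'.frob.toFun i (map.toFun i x))

variable (Z : RootSystem p A)

/-- `D` is coconnective and satisfies the three hypotheses: `H^0(D)` is `μ`-torsion-free, the groups
`H^n(Lη_μ D ⊗^L W(A^♭)/ξ̃_r)` are `p`-torsion-free, and the base change maps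
`Lη_μ D ⊗^L W(A^♭)/ξ̃_r → Lη_μ (D ⊗^L W(A^♭)/ξ̃_r)` are quasi-isomorphisms. -/
structure FrobAlg.Admissible (D : FrobAlg p A) : Prop where
  coconnective : ∀ n < 0, Subsingleton (Hn D.cx n)
  w1 : ∀ c : Hn D.cx 0, Z.mu • c = 0 → c = 0
  w2 : ∀ (r : ℕ) (n : ℤ) (c : Hn (modBy (Z.xiTilde r) (eta Z.mu D.cx)) n), p • c = 0 → c = 0
  w3 : ∀ r : ℕ, 1 ≤ r → ∀ n : ℤ,
    Function.Bijective ((baseChange Z.mu (Z.xiTilde r) D.cx).H n)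

/-- `W_r^n(D)_pre = H^n(D ⊗^L W(A^♭)/ξ̃_r)`. -/
abbrev FrobAlg.Pre (D : FrobAlg p A) (r : ℕ) (n : ℤ) : Type u := Hn (modBy (Z.xiTilde r) D.cx) n

/-- `W_r^n(D) = H^n(Lη_μ D ⊗^L W(A^♭)/ξ̃_r)`. -/
abbrev FrobAlg.Witt (D : FrobAlg p A) (r : ℕ) (n : ℕ) : Type u :=
  Hn (modBy (Z.xiTilde r) (eta Z.mu D.cx)) n

/-- `R'`, induced by `φ_D^{-1} ⊗ φ^{-1} : D/ξ̃_{r+1} → D/ξ̃_r`. -/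
def FrobAlg.preR (D : FrobAlg p A) (r : ℕ) (n : ℤ) :
    D.Pre Z (r + 1) n →ₛₗ[((phi p A).symm : Ainf p A →+* Ainf p A)] D.Pre Z r n :=
  (D.frobInv.modBy (Z.xiTilde (r + 1)) (Z.xiTilde r) (fun i x => ⟨Z.xi • D.frobInv.toFun i x, by
    rw [LinearMap.map_smulₛₗ, smul_smul, ← Z.phi_symm_xiTilde_succ]; rfl⟩)).H n

/-- `F`, induced by the canonical projection `D/ξ̃_{r+1} → D/ξ̃_r`. -/
def FrobAlg.preF (D : FrobAlg p A) (r : ℕ) (n : ℤ) : D.Pre Z (r + 1) n →ₗ[Ainf p A] D.Pre Z r n :=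
  ((SemiMap.scalar 1 D.cx).modBy (Z.xiTilde (r + 1)) (Z.xiTilde r) (fun i x =>
    ⟨Z.phiXi (r + 1) • x, by
      rw [smul_smul, ← Z.xiTilde_succ]; exact (one_smul _ _).symm⟩)).H n

/-- `V`, induced by multiplication by `φ^{r+1}(ξ)`, as a map `D/ξ̃_r → D/ξ̃_{r+1}`. -/
def FrobAlg.preV (D : FrobAlg p A) (r : ℕ) (n : ℤ) : D.Pre Z r n →ₗ[Ainf p A] D.Pre Z (r + 1) n :=
  ((SemiMap.scalar (Z.phiXi (r + 1)) D.cx).modBy (Z.xiTilde r) (Z.xiTilde (r + 1)) (fun i x =>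
    ⟨x, by
      rw [Z.xiTilde_succ, mul_comm, mul_smul]; rfl⟩)).H n

variable [IsAdicComplete (Ideal.span {(p : A)}) A]

/-- Homomorphisms of `W_r(A)`-algebras `λ_r : W_r(B) → H^0(D/ξ̃_r)` that are compatible with `R`,
`F`, `V` on the left and `φ_D^{-1}`, the projection, multiplication by `φ^{r+1}(ξ)` on the right.
Here `W(A^♭)/ξ̃_r` is identified with `W_r(A)` through `θ̃_r`. (For `r = 0` both sides vanish.) -/
structure StructureMaps (D : FrobAlg p A) (B : Type u) [CommRing B] [Algebra A B] where
  lam : ∀ r, W p r B →+ D.Pre Z r 0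
  lam_mul : ∀ r x y, lam r (x * y) = D.mulMod (Z.xiTilde r) 0 0 0 rfl (lam r x) (lam r y)
  lam_algebraMap : ∀ r (w : Ainf p A),
    lam r (W.map r (algebraMap A B) (thetaTilde p A r w)) = w • D.oneMod (Z.xiTilde r)
  lam_R : ∀ r x, lam r (W.R r x) = D.preR Z r 0 (lam (r + 1) x)
  lam_F : ∀ r x, lam r (W.F r x) = D.preF Z r 0 (lam (r + 1) x)
  lam_V : ∀ r x, lam (r + 1) (W.V r x) = D.preV Z r 0 (lam r x)

end Frobenius

/-! ### Witt complexes and the relative de Rham–Witt complex -/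

section WittComplexes

/-- The structure of a Witt complex (`F`-`V`-procomplex) for `A → B` on the groups `X r n = W_r^n`.
The index `r = 0` is harmless: as `W_0(A)` is the zero ring, the groups `X 0 n` are trivial. -/
structure WittStr (p : ℕ) [Fact p.Prime] (A B : Type u) [CommRing A] [CommRing B] [Algebra A B]
    (X : ℕ → ℕ → Type u) [∀ r n, AddCommGroup (X r n)] where
  -- the data
  smul : ∀ r n, W p r A →+* AddMonoid.End (X r n)
  one : ∀ r, X r 0
  mul : ∀ r i j k, i + j = k → X r i →+ X r j →+ X r k
  d : ∀ r n, X r n →+ X r (n + 1)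
  R : ∀ r n, X (r + 1) n →+ X r n
  F : ∀ r n, X (r + 1) n →+ X r n
  V : ∀ r n, X r n →+ X (r + 1) n
  lam : ∀ r, W p r B →+ X r 0
  -- commutative differential graded `W_r(A)`-algebras
  one_mul : ∀ r n x, mul r 0 n n (zero_add n) (one r) x = x
  mul_comm : ∀ r i j k (h : i + j = k) x y,
    mul r i j k h x y = (-1 : ℤ) ^ (i * j) • mul r j i k (by omega) y x
  mul_self : ∀ r i k (h : i + i = k) x, Odd i → mul r i i k h x x = 0
  mul_assoc : ∀ r i j k ij jk l (h : i + j = ij) (h' : j + k = jk) (hl : ij + k = l) x y z,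
    mul r ij k l hl (mul r i j ij h x y) z = mul r i jk l (by omega) x (mul r j k jk h' y z)
  smul_mul : ∀ r i j k h a x y, mul r i j k h (smul r i a x) y = smul r k a (mul r i j k h x y)
  d_d : ∀ r n x, d r (n + 1) (d r n x) = 0
  leibniz : ∀ r i j k (h : i + j = k) x y,
    d r k (mul r i j k h x y) = mul r (i + 1) j (k + 1) (by omega) (d r i x) y +
      (-1 : ℤ) ^ i • mul r i (j + 1) (k + 1) (by omega) x (d r j y)
  d_smul : ∀ r n a x, d r n (smul r n a x) = smul r (n + 1) a (d r n x)
  -- `R` is a morphism of differential graded algebras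
  R_one : ∀ r, R r 0 (one (r + 1)) = one r
  R_mul : ∀ r i j k h x y,
    R r k (mul (r + 1) i j k h x y) = mul r i j k h (R r i x) (R r j y)
  R_smul : ∀ r n a x, R r n (smul (r + 1) n a x) = smul r n (W.R r a) (R r n x)
  R_d : ∀ r n x, R r (n + 1) (d (r + 1) n x) = d r n (R r n x)
  -- `F` is a morphism of graded algebras
  F_one : ∀ r, F r 0 (one (r + 1)) = one r
  F_mul : ∀ r i j k h x y,
    F r k (mul (r + 1) i j k h x y) = mul r i j k h (F r i x) (F r j y)
  F_smul : ∀ r n a x, F r n (smul (r + 1) n a x) = smul r n (W.F r a) (F r n x)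
  -- `V` is a morphism of graded modules
  V_smul : ∀ r n a x, V r n (smul r n (W.F r a) x) = smul (r + 1) n a (V r n x)
  V_mul : ∀ r i j k h x y,
    V r k (mul r i j k h (F r i x) y) = mul (r + 1) i j k h x (V r j y)
  -- the identities between the operators
  R_F : ∀ r n x, R r n (F (r + 1) n x) = F r n (R (r + 1) n x)
  R_V : ∀ r n x, R (r + 1) n (V (r + 1) n x) = V r n (R r n x)
  F_V : ∀ r n x, F r n (V r n x) = p • x
  F_d_V : ∀ r n x, F r (n + 1) (d (r + 1) n (V r n x)) = d r n x
  -- the structure maps are morphisms of `W_r(A)`-algebras that commute with `R`, `F`, `V`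
  lam_mul : ∀ r b b', lam r (b * b') = mul r 0 0 0 rfl (lam r b) (lam r b')
  lam_algebraMap : ∀ r a, lam r (W.map r (algebraMap A B) a) = smul r 0 a (one r)
  lam_R : ∀ r b, lam r (W.R r b) = R r 0 (lam (r + 1) b)
  lam_F : ∀ r b, lam r (W.F r b) = F r 0 (lam (r + 1) b)
  lam_V : ∀ r b, lam (r + 1) (W.V r b) = V r 0 (lam r b)
  -- the Teichmüller identity
  teich : ∀ r (b : B), F r 1 (d (r + 1) 0 (lam (r + 1) (W.teich (r + 1) b))) =
    mul r 0 1 1 rfl (lam r (W.teich r b ^ (p - 1))) (d r 0 (lam r (W.teich r b)))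

variable {p : ℕ} [Fact p.Prime] {A B B' : Type u} [CommRing A] [CommRing B] [Algebra A B]
  [CommRing B'] [Algebra A B']

/-- Morphisms of Witt complexes over a morphism `g : B → B'` of `A`-algebras. -/
structure WittStr.Hom (g : B →ₐ[A] B') {X Y : ℕ → ℕ → Type u} [∀ r n, AddCommGroup (X r n)]
    [∀ r n, AddCommGroup (Y r n)] (S : WittStr p A B X) (T : WittStr p A B' Y) where
  toFun : ∀ r n, X r n →+ Y r n
  map_smul : ∀ r n a x, toFun r n (S.smul r n a x) = T.smul r n a (toFun r n x)
  map_one : ∀ r, toFun r 0 (S.one r) = T.one r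
  map_mul : ∀ r i j k h x y,
    toFun r k (S.mul r i j k h x y) = T.mul r i j k h (toFun r i x) (toFun r j y)
  map_d : ∀ r n x, toFun r (n + 1) (S.d r n x) = T.d r n (toFun r n x)
  map_R : ∀ r n x, toFun r n (S.R r n x) = T.R r n (toFun (r + 1) n x)
  map_F : ∀ r n x, toFun r n (S.F r n x) = T.F r n (toFun (r + 1) n x)
  map_V : ∀ r n x, toFun (r + 1) n (S.V r n x) = T.V r n (toFun r n x)
  map_lam : ∀ r b, toFun r 0 (S.lam r b) = T.lam r (W.map r (g : B →+* B') b)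

theorem WittStr.lam_one {X : ℕ → ℕ → Type u} [∀ r n, AddCommGroup (X r n)]
    (S : WittStr p A B X) (r : ℕ) : S.lam r 1 = S.one r := by
  have := S.lam_algebraMap r 1
  rw [(W.map r (algebraMap A B)).map_one, (S.smul r 0).map_one] at this
  exact this

theorem WittStr.lam_natCast_mul {X : ℕ → ℕ → Type u} [∀ r n, AddCommGroup (X r n)]
    (S : WittStr p A B X) (r n m : ℕ) (x : X r n) :
    S.mul r 0 n n (zero_add n) (S.lam r (m : W p r B)) x = m • x := by
  induction m with
  | zero => simp
  | succ m ih =>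
    rw [Nat.cast_succ, map_add, map_add, AddMonoidHom.add_apply, ih, S.lam_one, S.one_mul,
      succ_nsmul]

namespace deRhamWitt

variable (p A B)

/-- Formal expressions for the elements of a Witt complex for `A → B`. -/
inductive Term : ℕ → ℕ → Type u
  | zero (r n : ℕ) : Term r n
  | neg {r n : ℕ} (x : Term r n) : Term r n
  | add {r n : ℕ} (x y : Term r n) : Term r n
  | lam {r : ℕ} (b : W p r B) : Term r 0
  | mul {r i j k : ℕ} (h : i + j = k) (x : Term r i) (y : Term r j) : Term r k
  | d {r n : ℕ} (x : Term r n) : Term r (n + 1)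
  | R {r n : ℕ} (x : Term (r + 1) n) : Term r n
  | F {r n : ℕ} (x : Term (r + 1) n) : Term r n
  | V {r n : ℕ} (x : Term r n) : Term (r + 1) n

variable {p B}

/-- Multiplication by an element of `W_r(A)`. -/
def Term.smul {r n : ℕ} (a : W p r A) (x : Term p B r n) : Term p B r n :=
  .mul (zero_add n) (.lam (W.map r (algebraMap A B) a)) x

/-- The sign `(-1) ^ e`. -/
def Term.sign {r n : ℕ} (e : ℕ) (x : Term p B r n) : Term p B r n :=
  if Even e then x else .neg x

variable (p B)

/-- The congruence generated by the axioms of a Witt complex. -/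
inductive Rel : ∀ r n : ℕ, Term p B r n → Term p B r n → Prop
  -- congruence
  | refl {r n} (x : Term p B r n) : Rel r n x x
  | symm {r n x y} : Rel r n x y → Rel r n y x
  | trans {r n x y z} : Rel r n x y → Rel r n y z → Rel r n x z
  | congr_neg {r n x y} : Rel r n x y → Rel r n (.neg x) (.neg y)
  | congr_add {r n x x' y y'} : Rel r n x x' → Rel r n y y' → Rel r n (.add x y) (.add x' y')
  | congr_mul {r i j k} (h : i + j = k) {x x' y y'} : Rel r i x x' → Rel r j y y' →
      Rel r k (.mul h x y) (.mul h x' y')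
  | congr_d {r n x y} : Rel r n x y → Rel r (n + 1) (.d x) (.d y)
  | congr_R {r n x y} : Rel (r + 1) n x y → Rel r n (.R x) (.R y)
  | congr_F {r n x y} : Rel (r + 1) n x y → Rel r n (.F x) (.F y)
  | congr_V {r n x y} : Rel r n x y → Rel (r + 1) n (.V x) (.V y)
  -- abelian groups
  | add_assoc {r n} (x y z) : Rel r n (.add (.add x y) z) (.add x (.add y z))
  | add_comm {r n} (x y) : Rel r n (.add x y) (.add y x)
  | zero_add {r n} (x) : Rel r n (.add (.zero r n) x) x
  | neg_add {r n} (x) : Rel r n (.add (.neg x) x) (.zero r n)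
  -- additivity
  | lam_add {r} (b b') : Rel r 0 (.lam (b + b')) (.add (.lam b) (.lam b'))
  | mul_add {r i j k} (h : i + j = k) (x y z) :
      Rel r k (.mul h x (.add y z)) (.add (.mul h x y) (.mul h x z))
  | add_mul {r i j k} (h : i + j = k) (x y z) :
      Rel r k (.mul h (.add x y) z) (.add (.mul h x z) (.mul h y z))
  | d_add {r n} (x y) : Rel r (n + 1) (.d (.add x y)) (.add (.d x) (.d y))
  | R_add {r n} (x y) : Rel r n (.R (.add x y)) (.add (.R x) (.R y))
  | F_add {r n} (x y) : Rel r n (.F (.add x y)) (.add (.F x) (.F y))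
  | V_add {r n} (x y) : Rel (r + 1) n (.V (.add x y)) (.add (.V x) (.V y))
  -- differential graded algebras
  | one_mul {r n} (x) : Rel r n (.mul (Nat.zero_add n) (.lam 1) x) x
  | mul_comm {r i j k} (h : i + j = k) (h' : j + i = k) (x y) :
      Rel r k (.mul h x y) (.sign (i * j) (.mul h' y x))
  | mul_self {r i k} (h : i + i = k) (x) (hi : Odd i) : Rel r k (.mul h x x) (.zero r k)
  | mul_assoc {r i j k ij jk l} (h : i + j = ij) (h' : j + k = jk) (hl : ij + k = l)
      (hl' : i + jk = l) (x y z) :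
      Rel r l (.mul hl (.mul h x y) z) (.mul hl' x (.mul h' y z))
  | d_d {r n} (x) : Rel r (n + 1 + 1) (.d (.d x)) (.zero r (n + 1 + 1))
  | leibniz {r i j k} (h : i + j = k) (h₁ : i + 1 + j = k + 1) (h₂ : i + (j + 1) = k + 1) (x y) :
      Rel r (k + 1) (.d (.mul h x y)) (.add (.mul h₁ (.d x) y) (.sign i (.mul h₂ x (.d y))))
  | d_smul {r n} (a : W p r A) (x) : Rel r (n + 1) (.d (.smul A a x)) (.smul A a (.d x))
  -- `R`, `F`, `V`
  | R_mul {r i j k} (h : i + j = k) (x y) : Rel r k (.R (.mul h x y)) (.mul h (.R x) (.R y))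
  | R_d {r n} (x) : Rel r (n + 1) (.R (.d x)) (.d (.R x))
  | F_mul {r i j k} (h : i + j = k) (x y) : Rel r k (.F (.mul h x y)) (.mul h (.F x) (.F y))
  | V_mul {r i j k} (h : i + j = k) (x y) :
      Rel (r + 1) k (.V (.mul h (.F x) y)) (.mul h x (.V y))
  | R_F {r n} (x) : Rel r n (.R (.F x)) (.F (.R x))
  | R_V {r n} (x) : Rel (r + 1) n (.R (.V x)) (.V (.R x))
  | F_V {r n} (x) : Rel r n (.F (.V x)) (.mul (Nat.zero_add n) (.lam (p : W p r B)) x)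
  | F_d_V {r n} (x) : Rel r (n + 1) (.F (.d (.V x))) (.d x)
  -- structure maps
  | lam_mul {r} (b b') : Rel r 0 (.lam (b * b')) (.mul rfl (.lam b) (.lam b'))
  | lam_R {r} (b) : Rel r 0 (.lam (W.R r b)) (.R (.lam b))
  | lam_F {r} (b) : Rel r 0 (.lam (W.F r b)) (.F (.lam b))
  | lam_V {r} (b) : Rel (r + 1) 0 (.lam (W.V r b)) (.V (.lam b))
  | teich {r} (b : B) : Rel r 1 (.F (.d (.lam (W.teich (r + 1) b))))
      (.mul (Nat.zero_add 1) (.lam (W.teich r b ^ (p - 1))) (.d (.lam (W.teich r b))))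

/-- The setoid of the congruence. -/
def setoid (r n : ℕ) : Setoid (Term p B r n) where
  r := Rel p A B r n
  iseqv := ⟨.refl, .symm, .trans⟩

/-- `W_rΩ^n_{B/A}`. -/
def Omega (r n : ℕ) : Type u := Quotient (setoid p A B r n)

instance (r n : ℕ) : Zero (Omega p A B r n) := ⟨Quotient.mk _ (.zero r n)⟩

instance (r n : ℕ) : Neg (Omega p A B r n) := ⟨Quotient.map .neg fun _ _ h => .congr_neg h⟩

instance (r n : ℕ) : Add (Omega p A B r n) :=
  ⟨Quotient.map₂ .add fun _ _ h _ _ h' => .congr_add h h'⟩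

instance (r n : ℕ) : AddCommGroup (Omega p A B r n) where
  add_assoc := by rintro ⟨x⟩ ⟨y⟩ ⟨z⟩; exact Quotient.sound (.add_assoc x y z)
  add_comm := by rintro ⟨x⟩ ⟨y⟩; exact Quotient.sound (.add_comm x y)
  zero_add := by rintro ⟨x⟩; exact Quotient.sound (.zero_add x)
  add_zero := by
    rintro ⟨x⟩; exact Quotient.sound (.trans (.add_comm _ _) (.zero_add x))
  neg_add_cancel := by rintro ⟨x⟩; exact Quotient.sound (.neg_add x)
  nsmul := nsmulRec
  zsmul := zsmulRec

variable {p A B}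

/-- The class of an expression. -/
def Omega.mk {r n : ℕ} (x : Term p B r n) : Omega p A B r n := Quotient.mk _ x

theorem Omega.sound {r n : ℕ} {x y : Term p B r n} (h : Rel p A B r n x y) :
    (mk x : Omega p A B r n) = mk y := Quotient.sound h

theorem Omega.mk_sign {r n : ℕ} (e : ℕ) (x : Term p B r n) :
    (mk (.sign e x) : Omega p A B r n) = (-1 : ℤ) ^ e • mk x := by
  rw [Term.sign]
  split_ifs with h
  · rw [h.neg_one_pow, one_smul]
  · rw [(Nat.not_even_iff_odd.1 h).neg_one_pow, neg_smul, one_smul]; rfl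

/-- The product. -/
def Omega.mul {r i j k : ℕ} (h : i + j = k) :
    Omega p A B r i →+ Omega p A B r j →+ Omega p A B r k :=
  AddMonoidHom.mk' (fun x => AddMonoidHom.mk'
      (Quotient.map₂ (.mul h) (fun _ _ h₁ _ _ h₂ => .congr_mul h h₁ h₂) x)
      (by obtain ⟨x⟩ := x; rintro ⟨y⟩ ⟨z⟩; exact sound (.mul_add h x y z)))
    (by rintro ⟨x⟩ ⟨y⟩; ext ⟨z⟩; exact sound (.add_mul h x y z))

variable (p A B)

theorem Omega.lam_nat_mul {r n : ℕ} (m : ℕ) (x : Omega p A B r n) :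
    Omega.mul (Nat.zero_add n) (mk (.lam (m : W p r B))) x = m • x := by
  have h0 (b b' : W p r B) : (mk (.lam (b + b')) : Omega p A B r 0) =
    mk (.lam b) + mk (.lam b') := sound (.lam_add b b')
  induction m with
  | zero =>
    have : (mk (.lam 0) : Omega p A B r 0) = 0 := by simpa using h0 0 0
    rw [Nat.cast_zero, this, map_zero, zero_smul]; rfl
  | succ m ih =>
    rw [Nat.cast_succ, h0, map_add, AddMonoidHom.add_apply, ih, succ_nsmul]
    obtain ⟨x⟩ := x
    exact congrArg (m • Omega.mk x + ·) (sound (.one_mul x))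

/-- The Witt complex structure of the relative de Rham–Witt complex. -/
def str : WittStr p A B (Omega p A B) where
  smul r n :=
    { toFun := fun a => Omega.mul (Nat.zero_add n) (.mk (.lam (W.map r (algebraMap A B) a)))
      map_one' := by
        ext ⟨x⟩
        rw [map_one]
        exact Omega.sound (.one_mul x)
      map_mul' := fun a b => by
        ext ⟨x⟩
        rw [map_mul]
        exact Omega.sound (.trans (.congr_mul _ (.lam_mul _ _) (.refl _)) (.mul_assoc _ _ _ _ _ _ _))
      map_zero' := by
        ext x
        rw [map_zero]
        have := Omega.lam_nat_mul p A B 0 x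
        rw [Nat.cast_zero, zero_smul] at this
        exact this
      map_add' := fun a b => by
        ext ⟨x⟩
        rw [map_add]
        exact Omega.sound (.trans (.congr_mul _ (.lam_add _ _) (.refl _)) (.add_mul _ _ _ _)) }
  one r := .mk (.lam 1)
  mul r i j k h := Omega.mul h
  d r n := AddMonoidHom.mk' (Quotient.map .d fun _ _ h => .congr_d h)
    (by rintro ⟨x⟩ ⟨y⟩; exact Omega.sound (.d_add x y))
  R r n := AddMonoidHom.mk' (Quotient.map .R fun _ _ h => .congr_R h)
    (by rintro ⟨x⟩ ⟨y⟩; exact Omega.sound (.R_add x y))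
  F r n := AddMonoidHom.mk' (Quotient.map .F fun _ _ h => .congr_F h)
    (by rintro ⟨x⟩ ⟨y⟩; exact Omega.sound (.F_add x y))
  V r n := AddMonoidHom.mk' (Quotient.map .V fun _ _ h => .congr_V h)
    (by rintro ⟨x⟩ ⟨y⟩; exact Omega.sound (.V_add x y))
  lam r := AddMonoidHom.mk' (fun b => .mk (.lam b)) (fun b b' => Omega.sound (.lam_add b b'))
  one_mul := by rintro r n ⟨x⟩; exact Omega.sound (.one_mul x)
  mul_comm := by
    rintro r i j k h ⟨x⟩ ⟨y⟩
    exact (Omega.sound (.mul_comm h (by omega) x y)).trans (Omega.mk_sign _ _)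
  mul_self := by rintro r i k h ⟨x⟩ hi; exact Omega.sound (.mul_self h x hi)
  mul_assoc := by
    rintro r i j k ij jk l h h' hl ⟨x⟩ ⟨y⟩ ⟨z⟩; exact Omega.sound (.mul_assoc h h' hl _ x y z)
  smul_mul := by
    rintro r i j k h a ⟨x⟩ ⟨y⟩; exact Omega.sound (.mul_assoc _ _ _ _ _ _ _)
  d_d := by rintro r n ⟨x⟩; exact Omega.sound (.d_d x)
  leibniz := by
    rintro r i j k h ⟨x⟩ ⟨y⟩
    refine (Omega.sound (.leibniz h (by omega) (by omega) x y)).trans ?_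
    exact congrArg (Omega.mk (.mul _ (.d x) y) + ·) (Omega.mk_sign _ _)
  d_smul := by rintro r n a ⟨x⟩; exact Omega.sound (.d_smul a x)
  R_one r := Omega.sound (.symm (by simpa using Rel.lam_R (A := A) (r := r) (1 : W p (r + 1) B)))
  R_mul := by rintro r i j k h ⟨x⟩ ⟨y⟩; exact Omega.sound (.R_mul h x y)
  R_smul := by
    rintro r n a ⟨x⟩
    refine Omega.sound (.trans (.R_mul _ _ _) (.congr_mul _ (.symm ?_) (.refl _)))
    have := Rel.lam_R (A := A) (r := r) (W.map (r + 1) (algebraMap A B) a)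
    rwa [W.R_map] at this
  R_d := by rintro r n ⟨x⟩; exact Omega.sound (.R_d x)
  F_one r := Omega.sound (.symm (by simpa using Rel.lam_F (A := A) (r := r) (1 : W p (r + 1) B)))
  F_mul := by rintro r i j k h ⟨x⟩ ⟨y⟩; exact Omega.sound (.F_mul h x y)
  F_smul := by
    rintro r n a ⟨x⟩
    refine Omega.sound (.trans (.F_mul _ _ _) (.congr_mul _ (.symm ?_) (.refl _)))
    have := Rel.lam_F (A := A) (r := r) (W.map (r + 1) (algebraMap A B) a)
    rwa [W.F_map] at this
  V_smul := by
    rintro r n a ⟨x⟩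
    refine Omega.sound (.trans (.congr_V (.congr_mul _ ?_ (.refl _))) (.V_mul _ _ _))
    have := Rel.lam_F (A := A) (r := r) (W.map (r + 1) (algebraMap A B) a)
    rwa [W.F_map] at this
  V_mul := by rintro r i j k h ⟨x⟩ ⟨y⟩; exact Omega.sound (.V_mul h x y)
  R_F := by rintro r n ⟨x⟩; exact Omega.sound (.R_F x)
  R_V := by rintro r n ⟨x⟩; exact Omega.sound (.R_V x)
  F_V := by
    rintro r n ⟨x⟩
    exact (Omega.sound (.F_V x)).trans (Omega.lam_nat_mul p A B p (.mk x))
  F_d_V := by rintro r n ⟨x⟩; exact Omega.sound (.F_d_V x)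
  lam_mul r b b' := Omega.sound (.lam_mul b b')
  lam_algebraMap r a := by
    refine Omega.sound (.symm (.trans (.symm (.lam_mul _ _)) ?_))
    rw [mul_one]
    exact .refl _
  lam_R r b := Omega.sound (.lam_R b)
  lam_F r b := Omega.sound (.lam_F b)
  lam_V r b := Omega.sound (.lam_V b)
  teich r b := Omega.sound (.teich b)

section Lift

variable {p A B}
variable {Y : ℕ → ℕ → Type u} [∀ r n, AddCommGroup (Y r n)] (g : B →ₐ[A] B')
  (T : WittStr p A B' Y)

/-- The value of an expression in a Witt complex for `A → B'`. -/
def eval : ∀ {r n : ℕ}, Term p B r n → Y r n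
  | _, _, .zero _ _ => 0
  | _, _, .neg x => -eval x
  | _, _, .add x y => eval x + eval y
  | _, _, .lam b => T.lam _ (W.map _ (g : B →+* B') b)
  | _, _, .mul h x y => T.mul _ _ _ _ h (eval x) (eval y)
  | _, _, .d x => T.d _ _ (eval x)
  | _, _, .R x => T.R _ _ (eval x)
  | _, _, .F x => T.F _ _ (eval x)
  | _, _, .V x => T.V _ _ (eval x)

theorem eval_sign {r n : ℕ} (e : ℕ) (x : Term p B r n) :
    eval g T (.sign e x) = (-1 : ℤ) ^ e • eval g T x := by
  rw [Term.sign]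
  split_ifs with h
  · rw [h.neg_one_pow, one_smul]
  · rw [(Nat.not_even_iff_odd.1 h).neg_one_pow, neg_smul, one_smul, eval]

theorem eval_smul {r n : ℕ} (a : W p r A) (x : Term p B r n) :
    eval g T (.smul A a x) = T.smul r n a (eval g T x) := by
  rw [Term.smul, eval, eval, W.map_map, AlgHom.comp_algebraMap, T.lam_algebraMap, T.smul_mul,
    T.one_mul]

theorem eval_rel {r n : ℕ} {x y : Term p B r n} (h : Rel p A B r n x y) :
    eval g T x = eval g T y := by
  induction h with
  | refl x => rfl
  | symm _ h => exact h.symm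
  | trans _ _ h h' => exact h.trans h'
  | d_smul a x => rw [eval, eval_smul, eval_smul, eval, T.d_smul]
  | mul_comm h h' x y => rw [eval_sign]; exact T.mul_comm _ _ _ _ h _ _
  | leibniz h h₁ h₂ x y =>
    simp only [eval, eval_sign]
    exact T.leibniz _ _ _ _ h _ _
  | mul_assoc h h' hl hl' x y z => exact T.mul_assoc _ _ _ _ _ _ _ h h' hl _ _ _
  | mul_self h x hi => exact T.mul_self _ _ _ h _ hi
  | F_V x =>
    simp only [eval, T.F_V, map_natCast]
    exact (T.lam_natCast_mul _ _ _ _).symm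
  | lam_R b => exact (congrArg _ (W.R_map _ _ _).symm).trans (T.lam_R _ _)
  | lam_F b => exact (congrArg _ (W.F_map _ _ _).symm).trans (T.lam_F _ _)
  | lam_V b => exact (congrArg _ (W.V_map _ _ _).symm).trans (T.lam_V _ _)
  | teich b =>
    simp only [eval, map_pow, W.map_teich]
    exact T.teich _ _
  | _ =>
    simp_all [eval, add_assoc, add_comm, T.one_mul, T.lam_one, T.d_d, T.R_mul, T.R_d, T.F_mul,
      T.V_mul, T.R_F, T.R_V, T.F_d_V, T.lam_mul]

/-- The universal property of the relative de Rham–Witt complex: existence. -/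
def lift : WittStr.Hom g (str p A B) T where
  toFun r n := AddMonoidHom.mk' (Quotient.lift (eval g T) fun _ _ h => eval_rel g T h)
    (by rintro ⟨x⟩ ⟨y⟩; rfl)
  map_smul := by rintro r n a ⟨x⟩; exact eval_smul g T a x
  map_one r := by
    refine Eq.trans ?_ (T.lam_one r)
    exact congrArg (T.lam r) (map_one _)
  map_mul := by rintro r i j k h ⟨x⟩ ⟨y⟩; rfl
  map_d := by rintro r n ⟨x⟩; rfl
  map_R := by rintro r n ⟨x⟩; rfl
  map_F := by rintro r n ⟨x⟩; rfl
  map_V := by rintro r n ⟨x⟩; rfl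
  map_lam r b := rfl

/-- The universal property of the relative de Rham–Witt complex: uniqueness. -/
theorem hom_unique (u : WittStr.Hom g (str p A B) T) : u = lift g T := by
  have key : ∀ {r n : ℕ} (x : Term p B r n), u.toFun r n (.mk x) = eval g T x := by
    intro r n x
    induction x with
    | zero r n => exact map_zero _
    | neg x h => exact (map_neg (u.toFun _ _) (.mk x)).trans (congrArg _ h)
    | add x y h h' =>
      exact (map_add (u.toFun _ _) (.mk x) (.mk y)).trans (congrArg₂ _ h h')
    | lam b => exact u.map_lam _ b
    | mul h x y h₁ h₂ =>
      exact (u.map_mul _ _ _ _ h (.mk x) (.mk y)).trans (by rw [h₁, h₂]; rfl)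
    | d x h => exact (u.map_d _ _ (.mk x)).trans (by rw [h]; rfl)
    | R x h => exact (u.map_R _ _ (.mk x)).trans (by rw [h]; rfl)
    | F x h => exact (u.map_F _ _ (.mk x)).trans (by rw [h]; rfl)
    | V x h => exact (u.map_V _ _ (.mk x)).trans (by rw [h]; rfl)
  cases u
  congr
  ext r n ⟨x⟩
  exact key x

end Lift

variable {p A B}

/-- Functoriality of the relative de Rham–Witt complex in `B`. -/
def map (g : B →ₐ[A] B') : WittStr.Hom g (str p A B) (str p A B') := lift g (str p A B')

end deRhamWitt

end WittComplexes

/-! ### The Witt complex attached to an algebra with Frobenius -/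

section Canonical

variable {p : ℕ} [Fact p.Prime] {A : Type u} [CommRing A] [Fact (¬ IsUnit (p : A))]
  (Z : RootSystem p A) {D D' : FrobAlg p A}

/-- The map `H^n(Lη_μ D ⊗^L W(A^♭)/ξ̃_r) → H^n(D ⊗^L W(A^♭)/ξ̃_r)` induced by `Lη_μ D → D`. -/
def FrobAlg.incl (hD : D.Admissible Z) (r n : ℕ) : D.Witt Z r n →ₗ[Ainf p A] D.Pre Z r n :=
  canMap Z.mu (Z.xiTilde r) D.cx hD.w1 n

/-- The map `W_r^n(D) → W_r^n(D')` induced by a morphism `D → D'`. -/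
def FrobAlg.Hom.witt (f : FrobAlg.Hom D D') (r n : ℕ) : D.Witt Z r n →ₗ[Ainf p A] D'.Witt Z r n :=
  ((f.map.eta Z.mu).modBy (Z.xiTilde r) (Z.xiTilde r) (fun i x =>
    ⟨(f.map.eta Z.mu).toFun i x, (map_smul _ _ _).symm⟩)).H n

/-- The map `H^n(D/ξ̃_r) → H^n(D'/ξ̃_r)` induced by a morphism `D → D'`. -/
def FrobAlg.Hom.pre (f : FrobAlg.Hom D D') (r : ℕ) (n : ℤ) :
    D.Pre Z r n →ₗ[Ainf p A] D'.Pre Z r n :=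
  (f.map.modBy (Z.xiTilde r) (Z.xiTilde r) (fun i x =>
    ⟨f.map.toFun i x, (map_smul _ _ _).symm⟩)).H n

variable [IsAdicComplete (Ideal.span {(p : A)}) A] {B : Type u} [CommRing B] [Algebra A B]

/-- `S` is the Witt complex structure attached to `D` and `λ`: on the groups
`W_r^n(D) = H^n(Lη_μ D ⊗^L W(A^♭)/ξ̃_r)`, the `W_r(A)`-module structure is the one through `θ̃_r`, the
differential is the Bockstein of `ξ̃_r`, and the product, `R = θ̃_r(ξ)^n R'`, `F`, `V` are those of
`W_r^n(D)_pre`. The structure maps are the `λ_r`, up to `[ζ_{p^r}] - 1`-torsion in `H^0(D/ξ̃_r)`. -/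
structure IsCanonical (hD : D.Admissible Z) (L : StructureMaps Z D B)
    (S : WittStr p A B (D.Witt Z)) : Prop where
  smul : ∀ r n w x, S.smul r n (thetaTilde p A r w) x = w • x
  one : ∀ r, FrobAlg.incl Z hD r 0 (S.one r) = D.oneMod (Z.xiTilde r)
  mul : ∀ r i j k (h : i + j = k) x y, FrobAlg.incl Z hD r k (S.mul r i j k h x y) =
    D.mulMod (Z.xiTilde r) i j k (by omega) (FrobAlg.incl Z hD r i x) (FrobAlg.incl Z hD r j y)
  d : ∀ r n : ℕ, IsBockstein (Z.xiTilde r) (eta Z.mu D.cx) n ((n + 1 : ℕ) : ℤ)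
    (Nat.cast_succ n).symm (S.d r n)
  R : ∀ r n x, FrobAlg.incl Z hD r n (S.R r n x) =
    Z.xi ^ n • D.preR Z r n (FrobAlg.incl Z hD (r + 1) n x)
  F : ∀ r n x, FrobAlg.incl Z hD r n (S.F r n x) = D.preF Z r n (FrobAlg.incl Z hD (r + 1) n x)
  V : ∀ r n x, FrobAlg.incl Z hD (r + 1) n (S.V r n x) = D.preV Z r n (FrobAlg.incl Z hD r n x)
  lam : ∀ r b, Z.mu • (FrobAlg.incl Z hD r 0 (S.lam r b) - L.lam r b) = 0

end Canonical

end AInf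

end

/-! The groups `W_r^n(D)` embed into `H^n(D/ξ̃_r)` through `ι`, and the whole structure is
transported along this embedding. As `A` is `p`-torsion-free, `μ` and all `ξ̃_r` are
non-zero-divisors of `W(A^♭)` (`RootSystem.mu_regular`, `RootSystem.xiTilde_regular`), hence act
injectively on the projective terms of `D`. Two congruences are decisive: `ξ̃_r ≡ p^r` modulo `μ`,
and `φ^{r+1}(ξ) ≡ p` modulo `μ ξ̃_r`. Since `ξ̃_r` kills `W_r^n(D)`, the first shows that
`μ`-torsion is `p^r`-torsion, which (𝒲2) excludes. The kernel of `ι` in degree `n` is killed by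
`μ^n`, so `ι` is injective (`incl_injective`). Its image consists of the classes of `μ^n y` with `dy
∈ μ ξ̃_r D^{n+1}` (`canMap_rep`, `canMap_mem`).

An operation on `H^*(D/ξ̃_r)` that preserves this image therefore restricts in exactly one way, and
most axioms become computations with cocycles of `D/ξ̃_r`. The relation `ξ φ^{-1}(μ) = μ` shows that
`ξ^n R'` preserves the image in degree `n`; the same power of `ξ` compensates for `d R' = ξ R' d`.
The second congruence gives `FV = p` and `dF = pFd`, while `FdV = d` holds because `V` multiplies by
`φ^{r+1}(ξ) = ξ̃_{r+1}/ξ̃_r`. The action of `W_r(A)` is defined because `θ̃_r` is surjective with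
kernel contained in `(ξ̃_r)`, by induction on `r` from `ker θ = (ξ)` and `θ_{r+1}(ξ) = V(1)`.

The values of `λ_r` need not lie in the image of `ι`. By (𝒲3) in degree `0` each of them differs
from an element of the image by `μ`-torsion (`exists_canMap_sub`), and that element is unique
because `W_r^0(D)` is `μ`-torsion-free. Hence identities for the structure maps may be checked after
multiplication by `μ`.

Two axioms need torsion-freeness once more. For odd `x` one has `2x² = 0`, and `2` is either `p` or
a unit. The Teichmüller identity holds after multiplication by `p`, because `dF = pFd` and `F[b] =
[b]^p`. Uniqueness and functoriality follow from the injectivity and naturality of `ι`, and the maps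
from the de Rham–Witt complex are compared by its universal property. -/

set_option linter.unusedSectionVars false

noncomputable section

namespace AInf

/-! ### Witt vectors of `p`-torsion-free rings -/

section TorsionFree

variable {p : ℕ} [Fact p.Prime] {A : Type u} [CommRing A]

/-- Witt vectors over a `p`-torsion-free ring are determined by their ghost components. -/
theorem ghost_ext_of_torsionFree (hpA : ∀ a : A, (p : A) * a = 0 → a = 0) {x y : WittVector p A}
    (h : ∀ n, WittVector.ghostComponent n x = WittVector.ghostComponent n y) : x = y := by
  have hpow : ∀ (n : ℕ) (a : A), (p : A) ^ n * a = 0 → a = 0 := by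
    intro n
    induction n with
    | zero => intro a ha; simpa using ha
    | succ n ih => intro a ha; rw [pow_succ, mul_assoc] at ha; exact hpA _ (ih _ ha)
  ext n
  induction n using Nat.strong_induction_on with
  | _ n ih =>
    have hn := h n
    rw [WittVector.ghostComponent_apply, WittVector.ghostComponent_apply, aeval_wittPolynomial,
      aeval_wittPolynomial, Finset.sum_range_succ, Finset.sum_range_succ,
      Finset.sum_congr rfl (fun i hi => by rw [ih i (Finset.mem_range.1 hi)])] at hn
    have := add_left_cancel hn
    rw [Nat.sub_self, pow_zero, pow_one, pow_one, ← sub_eq_zero, ← mul_sub] at this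
    exact sub_eq_zero.1 (hpow n _ this)

/-- `∑_{i<p} [ζ]^i = V(1)` in `W(A)` for a primitive `p`-th root of unity `ζ`. -/
theorem sum_teichmuller_pow_eq_verschiebung (hpA : ∀ a : A, (p : A) * a = 0 → a = 0) (z : A)
    (hz : ∑ i ∈ Finset.range p, z ^ i = 0) (hzp : z ^ p = 1) :
    ∑ i ∈ Finset.range p, WittVector.teichmuller p z ^ i = WittVector.verschiebung 1 := by
  refine ghost_ext_of_torsionFree hpA fun n => ?_
  simp only [map_sum, map_pow, WittVector.ghostComponent_teichmuller]
  -- The zeroth ghost component is `∑ z^i = 0`. In the others `z` enters through a power of `z^p =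
  -- 1`, so they equal `p`. These are the ghost components of `V(1)`.
  cases n with
  | zero =>
    rw [WittVector.ghostComponent_zero_verschiebung]
    simpa using hz
  | succ n =>
    rw [WittVector.ghostComponent_verschiebung, map_one, pow_succ', pow_mul, hzp]
    simp

theorem W.V_eq_zero {r : ℕ} {B : Type u} [CommRing B] {x : W p r B} (h : W.V r x = 0) : x = 0 := by
  obtain ⟨x, rfl⟩ := WittVector.truncate_surjective p r B x
  rw [W.V_truncate, ← RingHom.mem_ker, WittVector.mem_ker_truncate] at h
  rw [← RingHom.mem_ker, WittVector.mem_ker_truncate]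
  intro i hi
  simpa using h (i + 1) (by omega)

theorem W.V_F_mul {r : ℕ} {B : Type u} [CommRing B] (x : W p (r + 1) B) (y : W p r B) :
    W.V r (W.F r x * y) = x * W.V r y := by
  obtain ⟨x, rfl⟩ := WittVector.truncate_surjective p (r + 1) B x
  obtain ⟨y, rfl⟩ := WittVector.truncate_surjective p r B y
  rw [W.F_truncate, ← map_mul, W.V_truncate, W.V_truncate, ← map_mul, mul_comm,
    WittVector.verschiebung_mul_frobenius, mul_comm]

end TorsionFree

/-! ### Roots of unity in the tilt -/

section Tilt

variable {p : ℕ} [Fact p.Prime] {A : Type u} [CommRing A] (Z : RootSystem p A)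

theorem RootSystem.zeta_zero : Z.ζ 0 = 1 := by
  have h := Z.isRoot 0
  rw [pow_zero, Polynomial.cyclotomic_one, Polynomial.IsRoot, Polynomial.eval_sub,
    Polynomial.eval_X, Polynomial.eval_one] at h
  exact sub_eq_zero.1 h

theorem RootSystem.zeta_one_pow : Z.ζ 1 ^ p = 1 := by
  rw [← Z.zeta_zero, ← Z.pow_eq 0]

theorem RootSystem.sum_zeta_one : ∑ i ∈ Finset.range p, Z.ζ 1 ^ i = 0 := by
  have h := Z.isRoot 1
  rw [pow_one, Polynomial.cyclotomic_prime, Polynomial.IsRoot, Polynomial.eval_finsetSum] at h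
  simpa using h

theorem RootSystem.zeta_pow (k n : ℕ) : Z.ζ (n + k) ^ p ^ n = Z.ζ k := by
  induction n with
  | zero => simp
  | succ n ih =>
    rw [pow_succ', pow_mul, show n + 1 + k = n + k + 1 by omega, Z.pow_eq, ih]

variable [Fact (¬ IsUnit (p : A))]

theorem RootSystem.coeff_eps (n : ℕ) :
    PreTilt.coeff n Z.eps = Ideal.Quotient.mk (Ideal.span {(p : A)}) (Z.ζ n) := rfl

/-- Each coefficient of `t` is the `p`-th power of the next one, so all are units. Inverses are
unique, hence again form a compatible system. -/
theorem isUnit_of_coeff_zero {t : PreTilt A p} (h : IsUnit (PreTilt.coeff 0 t)) : IsUnit t := by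
  have h' (n : ℕ) : IsUnit (PreTilt.coeff n t) := by
    induction n with
    | zero => exact h
    | succ n ih =>
      rw [← PreTilt.coeff_pow_p] at ih
      exact (isUnit_pow_iff (Nat.Prime.ne_zero Fact.out)).1 ih
  choose c hc using fun n => (h' n).exists_right_inv
  have hinv (n : ℕ) : c (n + 1) ^ p = c n := by
    calc c (n + 1) ^ p = c (n + 1) ^ p * (PreTilt.coeff n t * c n) := by rw [hc, mul_one]
      _ = (PreTilt.coeff (n + 1) t * c (n + 1)) ^ p * c n := by
        rw [mul_pow, PreTilt.coeff_pow_p]; ring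
      _ = c n := by rw [hc, one_pow, one_mul]
  let s : PreTilt A p := (⟨c, hinv⟩ : Perfection (ModP A p) p)
  refine IsUnit.of_mul_eq_one s (Perfection.ext fun n => ?_)
  change PreTilt.coeff n (t * s) = PreTilt.coeff n 1
  rw [map_mul, map_one]
  exact hc n

variable [IsAdicComplete (Ideal.span {(p : A)}) A]

/-- The element `ε^{1/p}`. -/
noncomputable abbrev RootSystem.epsRoot : PreTilt A p := (frobeniusEquiv (PreTilt A p) p).symm Z.eps

theorem RootSystem.epsRoot_pow : Z.epsRoot ^ p = Z.eps :=
  frobeniusEquiv_symm_pow_p _ _ Z.eps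

theorem RootSystem.untilt_epsRoot : Z.epsRoot.untilt = Z.ζ 1 := by
  refine Perfection.teichmuller_spec fun n => ⟨Z.ζ (n + 1), ?_, ?_⟩
  · exact ((PreTilt.coeff_frobeniusEquiv_symm n Z.eps).trans (Z.coeff_eps _)).symm
  · rw [Z.zeta_pow]

/-- Untilting gives `ζ_p t^♯ = t^♯`. Summing over the powers of `ζ_p`, which add up to `0`, yields
`p t^♯ = 0`, so the zeroth coefficient of `t` vanishes. The equation passes to `p`-power roots of
`t`, whose zeroth coefficients are the other coefficients of `t`. -/
theorem RootSystem.eq_zero_of_epsRoot_mul (hpA : ∀ a : A, (p : A) * a = 0 → a = 0)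
    {t : PreTilt A p} (h : Z.epsRoot * t = t) : t = 0 := by
  have key : ∀ s : PreTilt A p, Z.epsRoot * s = s → PreTilt.coeff 0 s = 0 := by
    intro s hs
    have h1 : Z.ζ 1 * s.untilt = s.untilt := by
      rw [← Z.untilt_epsRoot, ← map_mul, hs]
    have h2 (i : ℕ) : Z.ζ 1 ^ i * s.untilt = s.untilt := by
      induction i with
      | zero => simp
      | succ i ih => rw [pow_succ, mul_assoc, h1, ih]
    have h3 : (p : A) * s.untilt = 0 := by
      have := congrArg (· * s.untilt) Z.sum_zeta_one
      simpa [Finset.sum_mul, h2] using this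
    rw [← PreTilt.mk_untilt_eq_coeff_zero, hpA _ h3, map_zero]
  have hroot : ∀ s : PreTilt A p, Z.epsRoot * s = s →
      Z.epsRoot * (frobeniusEquiv (PreTilt A p) p).symm s =
        (frobeniusEquiv (PreTilt A p) p).symm s := by
    intro s hs
    have h1 : (Z.epsRoot - 1) * s = 0 := by rw [sub_mul, hs, one_mul, sub_self]
    -- The `p`-th power is `(ε^{1/p} - 1)^p t`, a multiple of the left side of `h1`; injectivity of
    -- Frobenius then removes the power.
    have h2 : ((Z.epsRoot - 1) * (frobeniusEquiv (PreTilt A p) p).symm s) ^ p = 0 := by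
      rw [mul_pow, frobeniusEquiv_symm_pow_p,
        ← pow_sub_one_mul (Nat.Prime.ne_zero (Fact.out : p.Prime)), mul_assoc, h1, mul_zero]
    have h3 : (Z.epsRoot - 1) * (frobeniusEquiv (PreTilt A p) p).symm s = 0 :=
      (bijective_frobenius (PreTilt A p) p).injective (by
        rw [frobenius_def, h2, map_zero])
    rwa [sub_mul, one_mul, sub_eq_zero] at h3
  refine Perfection.ext fun n => ?_
  have hn : ∀ n, Z.epsRoot * ((frobeniusEquiv (PreTilt A p) p).symm^[n] t) =
      ((frobeniusEquiv (PreTilt A p) p).symm^[n] t) := by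
    intro n
    induction n with
    | zero => exact h
    | succ n ih => rw [Function.iterate_succ', Function.comp_apply]; exact hroot _ ih
  have := key _ (hn n)
  rw [PreTilt.coeff_iterate_frobeniusEquiv_symm] at this
  rw [zero_add] at this
  exact this.trans (map_zero (PreTilt.coeff n)).symm

/-! ### The elements `μ`, `ξ` and `ξ̃_r` -/

theorem RootSystem.teichmuller_epsRoot_pow :
    WittVector.teichmuller p Z.epsRoot ^ p = WittVector.teichmuller p Z.eps := by
  rw [← map_pow, Z.epsRoot_pow]

theorem RootSystem.phi_symm_mu :
    (phi p A).symm Z.mu = WittVector.teichmuller p Z.epsRoot - 1 := by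
  rw [RingEquiv.symm_apply_eq]
  change _ = WittVector.frobenius _
  rw [map_sub, map_one, WittVector.frobenius_eq_map_frobenius, WittVector.map_teichmuller,
    frobenius_def, Z.epsRoot_pow]
  rfl

/-- A geometric sum in `[ε^{1/p}]`. This relation is responsible for the twist `ξ^n` in `R` and for
the regularity of `ξ`. -/
theorem RootSystem.xi_mul_phi_symm_mu : Z.xi * (phi p A).symm Z.mu = Z.mu := by
  rw [Z.phi_symm_mu]
  refine (geom_sum_mul _ _).trans ?_
  rw [Z.teichmuller_epsRoot_pow]; rfl

theorem phi_iterate_apply (r : ℕ) (w : Ainf p A) :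
    (phi p A)^[r] w = ((phi p A : Ainf p A →+* Ainf p A) ^ r) w := by
  rw [RingHom.coe_pow]; rfl

/-- Iterates `φ(μ) = φ(ξ) μ`. It identifies `μ ξ̃_r`, the modulus that describes the image of `ι`,
with a Frobenius twist of `μ`. -/
theorem RootSystem.phi_iterate_mu (r : ℕ) : (phi p A)^[r] Z.mu = Z.mu * Z.xiTilde r := by
  have h : phi p A Z.mu = phi p A Z.xi * Z.mu := by
    conv_lhs => rw [← Z.xi_mul_phi_symm_mu, map_mul, RingEquiv.apply_symm_apply]
  induction r with
  | zero => simp [xiTilde]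
  | succ r ih =>
    rw [Function.iterate_succ, Function.comp_apply, h, phi_iterate_apply, map_mul,
      ← phi_iterate_apply, ← phi_iterate_apply, ih, Z.xiTilde_succ, phiXi, Function.iterate_succ,
      Function.comp_apply]
    ring

/-- `φ^{r+1}(ξ) ≡ p` modulo `μ ξ̃_r`. -/
theorem RootSystem.exists_phiXi_eq (r : ℕ) :
    ∃ w, Z.phiXi (r + 1) = p + w * (Z.mu * Z.xiTilde r) := by
  have h0 : phi p A Z.xi = ∑ i ∈ Finset.range p, (Z.mu + 1) ^ i := by
    rw [xi, map_sum]
    refine Finset.sum_congr rfl fun i _ => ?_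
    rw [map_pow, mu, sub_add_cancel]
    congr 1
    change WittVector.frobenius _ = _
    rw [WittVector.frobenius_eq_map_frobenius, WittVector.map_teichmuller, frobenius_def]
    exact congrArg _ Z.epsRoot_pow
  -- Here `φ(ξ)` is the sum of the `[ε]^i`, and `φ^r([ε]) = 1 + φ^r(μ) = 1 + μ ξ̃_r`. Each of the
  -- `p` summands is thus `1` modulo `μ ξ̃_r`.
  have h : Z.phiXi (r + 1) = ∑ i ∈ Finset.range p, (Z.mu * Z.xiTilde r + 1) ^ i := by
    rw [phiXi, Function.iterate_succ, Function.comp_apply, h0, ← Z.phi_iterate_mu,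
      phi_iterate_apply, phi_iterate_apply, map_sum]
    simp only [map_pow, map_add, map_one]
  have h2 : Z.mu * Z.xiTilde r ∣ ∑ i ∈ Finset.range p, ((Z.mu * Z.xiTilde r + 1) ^ i - 1) := by
    refine Finset.dvd_sum fun i _ => ?_
    have := sub_dvd_pow_sub_pow (Z.mu * Z.xiTilde r + 1) 1 i
    rwa [add_sub_cancel_right, one_pow] at this
  obtain ⟨w, hw⟩ := h2
  refine ⟨w, ?_⟩
  rw [Finset.sum_sub_distrib, ← h, sub_eq_iff_eq_add, Finset.sum_const, Finset.card_range,
    nsmul_one] at hw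
  rw [hw]; ring

/-- `ξ̃_r ≡ p ^ r` modulo `μ`. -/
theorem RootSystem.exists_xiTilde_eq (r : ℕ) : ∃ w, Z.xiTilde r = p ^ r + w * Z.mu := by
  induction r with
  | zero => exact ⟨0, by simp [xiTilde]⟩
  | succ r ih =>
    obtain ⟨w, hw⟩ := ih
    obtain ⟨w', hw'⟩ := Z.exists_phiXi_eq r
    -- In `ξ̃_{r+1} = ξ̃_r p + ξ̃_r w' μ ξ̃_r` only the first `ξ̃_r` is replaced by `p^r + wμ`.
    exact ⟨w * p + Z.xiTilde r * (w' * Z.xiTilde r), by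
      rw [Z.xiTilde_succ, hw', mul_add]; nth_rewrite 1 [hw]; ring⟩

/-! ### Compatibility of `θ_r` and `θ̃_r` with `F`, `R` and the zeroth component. -/

theorem RootSystem.fontaineTheta_xi : WittVector.fontaineTheta A p Z.xi = 0 := by
  rw [xi, map_sum, ← Z.sum_zeta_one]
  refine Finset.sum_congr rfl fun i _ => ?_
  rw [map_pow, WittVector.fontaineTheta_teichmuller, Z.untilt_epsRoot]

theorem frobenius_frobeniusSection {k : Type u} [CommRing k] [CharP k p] [PerfectRing k p]
    (x : WittVector p k) : WittVector.frobenius (frobeniusSection x) =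
      frobeniusSection (WittVector.frobenius x) :=
  ghost_ext fun n => by
    rw [WittVector.ghostComponent_frobenius, ghostComponent_frobeniusSection,
      ghostComponent_frobeniusSection, Function.iterate_succ, Function.comp_apply]

theorem F_theta (r : ℕ) (w : Ainf p A) :
    W.F r (theta p A (r + 1) w) = theta p A r (phi p A w) := by
  rw [theta, RingHom.comp_apply, W.F_truncate, theta, RingHom.comp_apply, RingHom.comp_apply,
    RingHom.comp_apply, ← (WittVector.frobenius_isPoly p).map]
  exact congrArg (fun x => WittVector.truncate r (WittVector.map _ x))
    (frobenius_frobeniusSection w)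

theorem R_theta (r : ℕ) (w : Ainf p A) : W.R r (theta p A (r + 1) w) = theta p A r w := by
  rw [theta, RingHom.comp_apply, W.R_truncate]; rfl

theorem thetaTilde_apply (r : ℕ) (w : Ainf p A) :
    thetaTilde p A r w = theta p A r ((phi p A).symm^[r] w) := by
  rw [thetaTilde, RingHom.comp_apply, RingHom.coe_pow]; rfl

theorem F_thetaTilde (r : ℕ) (w : Ainf p A) :
    W.F r (thetaTilde p A (r + 1) w) = thetaTilde p A r w := by
  rw [thetaTilde_apply, F_theta, Function.iterate_succ', Function.comp_apply,
    RingEquiv.apply_symm_apply, thetaTilde_apply]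

theorem R_thetaTilde (r : ℕ) (w : Ainf p A) :
    W.R r (thetaTilde p A (r + 1) w) = thetaTilde p A r ((phi p A).symm w) := by
  rw [thetaTilde_apply, R_theta, thetaTilde_apply, Function.iterate_succ, Function.comp_apply]

theorem coeff_zero_theta (r : ℕ) (w : Ainf p A) :
    (theta p A (r + 1) w).coeff 0 = WittVector.fontaineTheta A p w := by
  have hw : (frobeniusSection w).coeff 0 = w := by
    have := ghostComponent_frobeniusSection 0 w
    rwa [WittVector.ghostComponent_apply, aeval_wittPolynomial, Finset.sum_range_one, pow_zero,
      one_mul, Nat.sub_self, pow_zero, pow_one] at this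
  exact congrArg (WittVector.fontaineTheta A p) hw

/-- The hypothesis says that `x` and `θ̃_{r+1}(w)` have the same zeroth component, and a Witt vector
with vanishing zeroth component is a Verschiebung. This is the inductive step for the surjectivity
of `θ̃_r`. -/
theorem exists_V_of_fontaineTheta (r : ℕ) (x : W p (r + 1) A) (w : Ainf p A)
    (h : x.coeff 0 = WittVector.fontaineTheta A p ((phi p A).symm^[r + 1] w)) :
    ∃ y, x = thetaTilde p A (r + 1) w + W.V r y := by
  rw [← coeff_zero_theta r, ← thetaTilde_apply] at h
  generalize thetaTilde p A (r + 1) w = y at h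
  obtain ⟨X, rfl⟩ := WittVector.truncate_surjective p (r + 1) A x
  obtain ⟨Y, rfl⟩ := WittVector.truncate_surjective p (r + 1) A y
  have h0 : (X - Y).coeff 0 = 0 := by
    change WittVector.constantCoeff (X - Y) = 0
    rw [map_sub]
    exact sub_eq_zero.2 h
  have h1 := WittVector.eq_iterate_verschiebung (n := 1) (x := X - Y)
    (fun i hi => by
      obtain rfl : i = 0 := by omega
      exact h0)
  refine ⟨WittVector.truncate r (WittVector.shift (X - Y) 1), ?_⟩
  rw [W.V_truncate, ← sub_eq_iff_eq_add', ← map_sub]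
  exact congrArg (WittVector.truncate (r + 1)) h1

section

variable (hpA : ∀ a : A, (p : A) * a = 0 → a = 0)
include hpA

/-- Modulo `p` the equation reads `(ε - 1) w_0 = 0`, whence `((ε^{1/p} - 1) w_0)^p = 0` and `w_0 =
0` by the preceding analysis of `ε^{1/p}`. So `p` divides `w`, and since `W(A^♭)` is
`p`-torsion-free the quotient satisfies the same equation. -/
theorem RootSystem.mu_regular {w : Ainf p A} (h : Z.mu * w = 0) : w = 0 := by
  have key0 : ∀ w : Ainf p A, Z.mu * w = 0 → w.coeff 0 = 0 := by
      intro w hw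
      have h0 := congrArg (WittVector.constantCoeff (p := p)) hw
      rw [map_mul, map_zero, mu, map_sub, map_one] at h0
      change (Z.eps - 1) * w.coeff 0 = 0 at h0
      refine Z.eq_zero_of_epsRoot_mul hpA ?_
      have h3 : (Z.epsRoot - 1) * w.coeff 0 = 0 :=
        (bijective_frobenius (PreTilt A p) p).injective (by
          rw [map_mul, map_sub, map_one, frobenius_def, frobenius_def, Z.epsRoot_pow,
            ← pow_sub_one_mul (Nat.Prime.ne_zero (Fact.out : p.Prime)), mul_left_comm, h0,
            mul_zero, map_zero])
      rwa [sub_mul, one_mul, sub_eq_zero] at h3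
  have key : ∀ (n : ℕ) (w : Ainf p A), Z.mu * w = 0 → w.coeff n = 0 := by
    intro n
    induction n with
    | zero => exact key0
    | succ n ih =>
      intro w hw
      obtain ⟨w', rfl⟩ : (p : Ainf p A) ∣ w := by
        rw [← Ideal.mem_span_singleton, WittVector.mem_span_p_iff_coeff_zero_eq_zero]
        exact key0 w hw
      rw [mul_left_comm, mul_comm] at hw
      have h1 := ih w' (WittVector.eq_zero_of_p_mul_eq_zero _ hw)
      rw [mul_comm, WittVector.mul_charP_coeff_succ, h1,
        zero_pow (Nat.Prime.ne_zero (Fact.out : p.Prime))]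
  ext n
  simpa using key n w h

theorem RootSystem.xi_regular {w : Ainf p A} (h : Z.xi * w = 0) : w = 0 :=
  Z.mu_regular hpA (by rw [← Z.xi_mul_phi_symm_mu, mul_right_comm, h, zero_mul])

theorem RootSystem.xiTilde_regular (r : ℕ) {w : Ainf p A} (h : Z.xiTilde r * w = 0) : w = 0 := by
  induction r generalizing w with
  | zero => simpa [xiTilde] using h
  | succ r ih =>
    rw [Z.xiTilde_succ, mul_assoc] at h
    have h1 := ih h
    obtain ⟨v, rfl⟩ := ((phi p A).surjective.iterate (r + 1)) w
    rw [phiXi, phi_iterate_apply, phi_iterate_apply, ← map_mul, ← phi_iterate_apply] at h1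
    have h2 := (phi p A).injective.iterate (r + 1) (h1.trans (iterate_map_zero (phi p A) _).symm)
    rw [Z.xi_regular hpA h2, iterate_map_zero]

/-! ### The kernel of `θ` and the maps `θ̃_r` -/

/-- The image is `∑ [ζ_p]^i`. Consequently `φ^{r+1}(ξ)` corresponds to `V(1)` under `θ̃_{r+1}`,
which is why multiplication by it plays the role of `V`. -/
theorem RootSystem.theta_xi (r : ℕ) :
    theta p A (r + 1) Z.xi = W.V r 1 := by
  rw [xi, map_sum, ← map_one (WittVector.truncate r), W.V_truncate,
    ← sum_teichmuller_pow_eq_verschiebung hpA _ Z.sum_zeta_one Z.zeta_one_pow, map_sum]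
  refine Finset.sum_congr rfl fun i _ => ?_
  rw [map_pow, theta_teichmuller, map_pow, Z.untilt_epsRoot]
  rfl

/-- The same computation after reduction to `A/p`. It shows that the first Witt coordinate of `ξ` is
a unit there, which forces `ξ` to generate `ker θ`. -/
theorem RootSystem.map_coeff_zero_xi :
    WittVector.map (PreTilt.coeff (p := p) (O := A) 0) Z.xi = WittVector.verschiebung 1 := by
  rw [← map_one (WittVector.map (Ideal.Quotient.mk (Ideal.span {(p : A)}))),
    ← WittVector.map_verschiebung,
    ← sum_teichmuller_pow_eq_verschiebung hpA _ Z.sum_zeta_one Z.zeta_one_pow, xi, map_sum, map_sum]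
  refine Finset.sum_congr rfl fun i _ => ?_
  rw [map_pow, map_pow, WittVector.map_teichmuller, WittVector.map_teichmuller]
  exact congrArg (fun x => WittVector.teichmuller p x ^ i)
    (PreTilt.coeff_frobeniusEquiv_symm 0 Z.eps)

/-- `ξ` generates the kernel of `θ`. -/
theorem RootSystem.xi_dvd_of_fontaineTheta (hA : IsPerfectoid p A) {w : Ainf p A}
    (hw : WittVector.fontaineTheta A p w = 0) : Z.xi ∣ w := by
  obtain ⟨g, hg⟩ := hA.ker_theta_principal
  have hker (x : Ainf p A) : WittVector.fontaineTheta A p x = 0 ↔ g ∣ x := by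
    rw [← RingHom.mem_ker, hg, ← Ideal.mem_span_singleton]
  obtain ⟨h, hh⟩ := (hker _).1 Z.fontaineTheta_xi
  -- Let `ker θ = (g)` and `ξ = gh`. In `W(A/p)` the element `g` becomes `V(g')`, because `θ(g) =
  -- 0`, and `ξ` becomes `V(1)`. So `V(1) = V(g' F(h))`, and coordinate `1` gives an equation `g'_0
  -- u^p = 1` in `A/p`, where `u` is the zeroth coefficient of `h_0`. Being a unit then lifts from
  -- `A/p` to `A^♭` and to `W(A^♭)`.
  suffices hu : IsUnit h by
    rw [hh]
    exact hu.mul_right_dvd.2 ((hker w).1 hw)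
  have hh0 : IsUnit (h.coeff 0) := by
    apply isUnit_of_coeff_zero
    have h1 := Z.map_coeff_zero_xi hpA
    rw [hh, map_mul] at h1
    have hg0 : (WittVector.map (PreTilt.coeff (p := p) (O := A) 0) g).coeff 0 = 0 := by
      rw [WittVector.map_coeff, ← WittVector.mk_fontaineTheta, (hker g).2 dvd_rfl, map_zero]
    obtain ⟨g', hg'⟩ : ∃ g', WittVector.map (PreTilt.coeff (p := p) (O := A) 0) g =
        WittVector.verschiebung g' :=
      ⟨_, WittVector.eq_iterate_verschiebung (n := 1) (by
        intro i hi
        obtain rfl : i = 0 := by omega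
        exact hg0)⟩
    rw [hg', ← WittVector.verschiebung_mul_frobenius] at h1
    have h2 := congrArg (fun x => WittVector.coeff x 1) h1
    simp only [WittVector.verschiebung_coeff_succ, WittVector.mul_coeff_zero,
      WittVector.coeff_frobenius_charP, WittVector.map_coeff, WittVector.one_coeff_zero] at h2
    exact (isUnit_pow_iff (Nat.Prime.ne_zero Fact.out)).1 (IsUnit.of_mul_eq_one_right _ h2)
  exact (WittVector.mkUnit (a := hh0.unit) rfl).isUnit

/-- The projection formula `V(F(x)) = x V(1)` applied to `x = θ̃_{r+1}(w)`, with `V(1) =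
θ̃_{r+1}(φ^{r+1}(ξ))`. -/
theorem RootSystem.V_thetaTilde (r : ℕ) (w : Ainf p A) :
    W.V r (thetaTilde p A r w) = thetaTilde p A (r + 1) (w * Z.phiXi (r + 1)) := by
  have h : thetaTilde p A (r + 1) (Z.phiXi (r + 1)) = W.V r 1 := by
    rw [thetaTilde_apply, phiXi, Function.LeftInverse.iterate (phi p A).symm_apply_apply,
      Z.theta_xi hpA]
  rw [map_mul, h, ← W.V_F_mul, F_thetaTilde, mul_one]

/-- Surjectivity of `θ` adjusts the zeroth component. What remains is `V` of a vector of length `r`,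
which is reached by induction because the image is stable under `V`. -/
theorem RootSystem.thetaTilde_surjective (Z : RootSystem p A) (hA : IsPerfectoid p A) (r : ℕ) :
    Function.Surjective (thetaTilde p A r) := by
  induction r with
  | zero => exact fun x => ⟨0, TruncatedWittVector.ext fun i => i.elim0⟩
  | succ r ih =>
    intro x
    obtain ⟨w, hw⟩ := surjective_fontaineTheta hA.frobenius_surjective (x.coeff 0)
    obtain ⟨w, rfl⟩ := ((phi p A).symm.surjective.iterate (r + 1)) w
    obtain ⟨y, rfl⟩ := exists_V_of_fontaineTheta r x w hw.symm
    obtain ⟨v, rfl⟩ := ih y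
    exact ⟨_, by rw [Z.V_thetaTilde hpA, ← map_add]⟩

/-- The zeroth component gives `θ(φ^{-(r+1)}(w)) = 0`, so `φ^{r+1}(ξ)` divides `w`. The quotient is
killed by `V θ̃_r`, hence by `θ̃_r` because `V` is injective, and induction applies to it. -/
theorem RootSystem.xiTilde_dvd_of_thetaTilde (hA : IsPerfectoid p A) (r : ℕ) {w : Ainf p A}
    (h : thetaTilde p A r w = 0) : Z.xiTilde r ∣ w := by
  induction r generalizing w with
  | zero => simp [xiTilde]
  | succ r ih =>
    have h0 : WittVector.fontaineTheta A p ((phi p A).symm^[r + 1] w) = 0 := by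
      rw [← coeff_zero_theta r, ← thetaTilde_apply, h]
      exact TruncatedWittVector.coeff_zero p (r + 1) A 0
    obtain ⟨v, hv⟩ := Z.xi_dvd_of_fontaineTheta hpA hA h0
    have hw : w = (phi p A)^[r + 1] v * Z.phiXi (r + 1) := by
      rw [phiXi, phi_iterate_apply, phi_iterate_apply, ← map_mul, mul_comm v, ← hv,
        ← phi_iterate_apply, Function.RightInverse.iterate (phi p A).apply_symm_apply]
    rw [hw, ← Z.V_thetaTilde hpA] at h
    rw [hw, Z.xiTilde_succ]
    exact mul_dvd_mul_right (ih (W.V_eq_zero h)) _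

end

end Tilt
/-! ### Classes in the cohomology of `K/a` -/

section Classes

variable {R : Type u} [CommRing R] {K L M : Cx R} {σ : R →+* R} {a b f : R}

/-- The class in `H^n(K/a)` of an element `x ∈ K^n` with `dx ∈ aK^{n+1}`. -/
def cls (a : R) (K : Cx R) (n : ℤ) (x : K.X n) (hx : ∃ v, a • v = K.d n (n + 1) rfl x) :
    Hn (modBy a K) n :=
  Hn.mk ⟨modBy.mk a K n x, (Cx.mem_cocycles rfl).2 (modBy.mk_eq_zero.2 hx)⟩

theorem cls_surjective {n : ℤ} (c : Hn (modBy a K) n) : ∃ x hx, cls a K n x hx = c := by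
  obtain ⟨⟨c, hc⟩, rfl⟩ := Hn.mk_surjective c
  obtain ⟨x, rfl⟩ := modBy.mk_surjective a K n c
  exact ⟨x, modBy.mk_eq_zero.1 ((Cx.mem_cocycles rfl).1 hc), rfl⟩

/-- This reduces identities in `H^n(K/a)` to equations between elements of `K` itself. -/
theorem cls_eq_iff {n m : ℤ} (hm : m + 1 = n) {x y : K.X n} {hx hy} :
    cls a K n x hx = cls a K n y hy ↔ ∃ u w, x - y = K.d m n hm u + a • w := by
  rw [cls, cls, Hn.mk_eq_iff hm]
  constructor
  · rintro ⟨z, hz⟩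
    obtain ⟨u, rfl⟩ := modBy.mk_surjective a K m z
    rw [modBy.d_mk, ← map_sub, ← sub_eq_zero, ← map_sub, modBy.mk_eq_zero] at hz
    obtain ⟨w, hw⟩ := hz
    exact ⟨u, -w, by rw [smul_neg, hw]; abel⟩
  · rintro ⟨u, w, h⟩
    refine ⟨modBy.mk a K m u, ?_⟩
    rw [modBy.d_mk, ← map_sub, ← sub_eq_zero, ← map_sub, modBy.mk_eq_zero]
    exact ⟨-w, by rw [smul_neg, h]; abel⟩

theorem cls_congr {n : ℤ} {x y : K.X n} (h : x = y) {hx hy} :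
    cls a K n x hx = cls a K n y hy := by
  subst h; rfl

theorem cls_add {n : ℤ} {x y : K.X n} {hx hy} (hxy) :
    cls a K n (x + y) hxy = cls a K n x hx + cls a K n y hy := rfl

theorem cls_smul {n : ℤ} (c : R) {x : K.X n} {hx} (hcx) :
    cls a K n (c • x) hcx = c • cls a K n x hx := rfl

theorem exists_smul_eq_d_smul {n : ℤ} (c : R) {x : K.X n} (hx : ∃ v, a • v = K.d n (n + 1) rfl x) :
    ∃ v, a • v = K.d n (n + 1) rfl (c • x) := by
  obtain ⟨v, hv⟩ := hx
  exact ⟨c • v, by rw [smul_comm, hv, map_smul]⟩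

theorem smul_Hn_modBy {n : ℤ} (c : Hn (modBy a K) n) : a • c = 0 := by
  obtain ⟨x, hx, rfl⟩ := cls_surjective c
  rw [← cls_smul a (exists_smul_eq_d_smul a hx)]
  refine Eq.trans ((cls_eq_iff (sub_add_cancel n 1) (hy := ⟨0, ?_⟩)).2
    ⟨0, x, ?_⟩) (?_ : cls a K n 0 _ = 0)
  · simp
  · simp
  · rfl

theorem exists_smul_eq_d_map (g : SemiMap σ K L) (h : ∃ c, σ a = b * c) {n : ℤ} {x : K.X n}
    (hx : ∃ v, a • v = K.d n (n + 1) rfl x) :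
    ∃ v, b • v = L.d n (n + 1) rfl (g.toFun n x) := by
  obtain ⟨v, hv⟩ := hx
  obtain ⟨c, hc⟩ := h
  exact ⟨c • g.toFun (n + 1) v, by
    rw [g.comm, ← hv, LinearMap.map_smulₛₗ, hc, mul_smul]⟩

theorem SemiMap.H_modBy_cls (g : SemiMap σ K L) (h) {n : ℤ} (x : K.X n) (hx) (hx') :
    (g.modBy a b h).H n (cls a K n x hx) = cls b L n (g.toFun n x) hx' := rfl

/-- Homotopic maps agree on cohomology classes. -/
theorem cls_eq_of_homotopic {g g' : ∀ i, K.X i → L.X i} (hg : Homotopic σ g g')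
    (h : ∃ c, σ a = b * c) {n : ℤ} {x : K.X n} (hx : ∃ v, a • v = K.d n (n + 1) rfl x) {hy hy'} :
    cls b L n (g n x) hy = cls b L n (g' n x) hy' := by
  obtain ⟨s, hs⟩ := hg
  obtain ⟨v, hv⟩ := hx
  obtain ⟨c, hc⟩ := h
  -- The homotopy term `s(dx) = s(av) = σ(a) s(v)` lies in `bL`, so only the coboundary of `s(x)`
  -- remains.
  refine (cls_eq_iff (sub_add_cancel n 1)).2 ⟨s n (n - 1) (by omega) x, c • s (n + 1) n rfl v, ?_⟩
  rw [hs n (n - 1) (n + 1) (by omega) rfl, ← hv, LinearMap.map_smulₛₗ, hc, mul_smul]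

/-- Homotopic pairings agree on cohomology classes. -/
theorem cls_eq_of_biHomotopic {g g' : ∀ i j k, i + j + 0 = k → K.X i → L.X j → M.X k}
    (hg : BiHomotopic σ g g') (h : ∃ c, σ a = b * c) {i j k : ℤ} (hk : i + j + 0 = k)
    {x : K.X i} {y : L.X j} (hx : ∃ v, a • v = K.d i (i + 1) rfl x)
    (hy : ∃ v, a • v = L.d j (j + 1) rfl y) {hz hz'} :
    cls b M k (g i j k hk x y) hz = cls b M k (g' i j k hk x y) hz' := by
  obtain ⟨s, hs⟩ := hg
  obtain ⟨v, hv⟩ := hx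
  obtain ⟨w, hw⟩ := hy
  obtain ⟨c, hc⟩ := h
  refine (cls_eq_iff (sub_add_cancel k 1)).2 ⟨s i j (k - 1) (by omega) x y,
    c • (s (i + 1) j k (by omega) v y + sgn i • s i (j + 1) k (by omega) x w), ?_⟩
  rw [hs i j k (i + 1) (j + 1) (k - 1) hk (by omega) rfl rfl, ← hv, ← hw, LinearMap.map_smulₛₗ,
    LinearMap.map_smulₛₗ, hc, LinearMap.smul_apply]
  simp only [mul_smul, smul_add, smul_comm (sgn i) b, smul_comm (sgn i) c]
  abel

/-- Homotopic trilinear maps agree on cohomology classes. -/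
theorem cls_eq_of_triHomotopic {g g' : ∀ i j k l, i + j + k = l → K.X i → K.X j → K.X k → K.X l}
    (hg : TriHomotopic g g') {i j k l : ℤ} (hl : i + j + k = l)
    {x : K.X i} {y : K.X j} {z : K.X k} (hx : ∃ v, a • v = K.d i (i + 1) rfl x)
    (hy : ∃ v, a • v = K.d j (j + 1) rfl y) (hz : ∃ v, a • v = K.d k (k + 1) rfl z) {hw hw'} :
    cls a K l (g i j k l hl x y z) hw = cls a K l (g' i j k l hl x y z) hw' := by
  obtain ⟨s, hs⟩ := hg
  obtain ⟨v, hv⟩ := hx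
  obtain ⟨w, hw⟩ := hy
  obtain ⟨t, ht⟩ := hz
  refine (cls_eq_iff (sub_add_cancel l 1)).2 ⟨s i j k (l - 1) (by omega) x y z,
    s (i + 1) j k l (by omega) v y z + sgn i • s i (j + 1) k l (by omega) x w z +
      sgn (i + j) • s i j (k + 1) l (by omega) x y t, ?_⟩
  rw [hs i j k l (i + 1) (j + 1) (k + 1) (l - 1) hl (by omega) rfl rfl rfl, ← hv, ← hw, ← ht]
  simp only [map_smul, LinearMap.smul_apply, smul_add, smul_comm (sgn _) a]
  abel

/-! ### The Bockstein -/

section Bockstein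

variable (hK : ∀ i (x : K.X i), a • x = 0 → x = 0) (n m : ℤ) (h : n + 1 = m)
include hK

/-- If `dx = av`, then `v` is a cocycle since `a dv = 0`. Changing `x` by `du + aw` changes `av` by
`a dw`, and cancelling `a` changes `v` by a coboundary. -/
theorem exists_bockstein :
    ∃ δ : Hn (modBy a K) n →+ Hn (modBy a K) m, IsBockstein a K n m h δ := by
  subst h
  have hd : ∀ {x : K.X n} {v : K.X (n + 1)}, a • v = K.d n (n + 1) rfl x →
      K.d (n + 1) (n + 1 + 1) rfl v = 0 := by
    intro x v hv
    apply hK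
    rw [← map_smul, hv, K.d_d]
  have key : ∀ c : Hn (modBy a K) n, ∃ c' : Hn (modBy a K) (n + 1), ∀ x hx v
      (hv : a • v = K.d n (n + 1) rfl x), cls a K n x hx = c →
        ∀ h', c' = cls a K (n + 1) v h' := by
    intro c
    obtain ⟨x, hx, rfl⟩ := cls_surjective c
    obtain ⟨v, hv⟩ := id hx
    refine ⟨cls a K (n + 1) v ⟨0, by rw [smul_zero, hd hv]⟩, fun x' hx' v' hv' hxx' h' => ?_⟩
    obtain ⟨u, w, huw⟩ := (cls_eq_iff (sub_add_cancel n 1)).1 hxx'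
    refine (cls_eq_iff rfl).2 ⟨-w, 0, ?_⟩
    rw [← sub_eq_zero]
    apply hK
    have h1 := congrArg (K.d n (n + 1) rfl) huw
    rw [map_sub, map_add, K.d_d, zero_add, map_smul, ← hv, ← hv'] at h1
    rw [smul_zero, add_zero, map_neg, sub_neg_eq_add, smul_add, smul_sub, ← h1]
    abel
  choose δ hδ using key
  refine ⟨AddMonoidHom.mk' δ fun c c' => ?_, ?_⟩
  · obtain ⟨x, ⟨v, hv⟩, rfl⟩ := cls_surjective c
    obtain ⟨x', ⟨v', hv'⟩, rfl⟩ := cls_surjective c'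
    have e : a • (v + v') = K.d n (n + 1) rfl (x + x') := by rw [smul_add, hv, hv', map_add]
    rw [hδ _ x _ v hv rfl ⟨0, by rw [smul_zero, hd hv]⟩,
      hδ _ x' _ v' hv' rfl ⟨0, by rw [smul_zero, hd hv']⟩,
      hδ (cls a K n x ⟨v, hv⟩ + cls a K n x' ⟨v', hv'⟩) (x + x') ⟨_, e⟩ (v + v') e rfl ⟨0,
      by rw [smul_zero, hd e]⟩]
    rfl
  · rintro x z ⟨c, hc⟩ ⟨c', hc'⟩ rfl rfl hxz
    exact hδ _ x ⟨z, hxz.symm⟩ z hxz.symm rfl ⟨0, by rw [smul_zero, hd hxz.symm]⟩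

/-- The Bockstein `H^n(K/a) → H^{n+1}(K/a)`. -/
def bock : Hn (modBy a K) n →+ Hn (modBy a K) m := (exists_bockstein hK n m h).choose

theorem bock_isBockstein : IsBockstein a K n m h (bock hK n m h) :=
  (exists_bockstein hK n m h).choose_spec

theorem bock_cls {x : K.X n} {hx} {v : K.X m} (hv : K.d n m h x = a • v) (hv') :
    bock hK n m h (cls a K n x hx) = cls a K m v hv' :=
  bock_isBockstein hK n m h x v _ _ rfl rfl hv

/-- Every class lifts to some `x` with `dx = av`, and injectivity of `a` makes `v` a cocycle. The
defining property thus prescribes every value. -/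
theorem isBockstein_unique {δ δ' : Hn (modBy a K) n → Hn (modBy a K) m}
    (hδ : IsBockstein a K n m h δ) (hδ' : IsBockstein a K n m h δ') : δ = δ' := by
  subst h
  funext c
  obtain ⟨x, ⟨v, hv⟩, rfl⟩ := cls_surjective c
  have hd : K.d (n + 1) (n + 1 + 1) rfl v = 0 := by
    apply hK
    rw [← map_smul, hv, K.d_d]
  have hv' : (modBy a K).d _ _ rfl (modBy.mk a K (n + 1) v) = 0 := by
    rw [modBy.d_mk, hd, map_zero]
  exact (hδ x v _ ⟨_, (Cx.mem_cocycles rfl).2 hv'⟩ rfl rfl hv.symm).trans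
    (hδ' x v _ ⟨_, (Cx.mem_cocycles rfl).2 hv'⟩ rfl rfl hv.symm).symm

end Bockstein

/-! ### The map `H^n(η_f K/a) → H^n(K/a)` -/

/-- The map `η_f K → K[1/f]`, divided by `f ^ i` in degree `i`. -/
def etaFst (f : R) (K : Cx R) (i : ℤ) : (eta f K).X i →ₗ[R] K.X i :=
  (LinearMap.fst R _ _).comp (Submodule.subtype (etaTerm f K i))

theorem d_etaFst {i j : ℤ} (h : i + 1 = j) (w : (eta f K).X i) :
    K.d i j h (etaFst f K i w) = f • etaFst f K j ((eta f K).d i j h w) := by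
  subst h; exact (show etaTerm f K i from w).2.1

section Regular

variable (hf : ∀ i (x : K.X i), f • x = 0 → x = 0) (ha : ∀ i (x : K.X i), a • x = 0 → x = 0)

include hf in
-- The second component `z` is recovered from `fz = dy`.
theorem etaFst_injective (i : ℤ) {w w' : (eta f K).X i} (h : etaFst f K i w = etaFst f K i w') :
    w = w' := by
  obtain ⟨⟨y, z⟩, h1, h2⟩ := w
  obtain ⟨⟨y', z'⟩, h1', h2'⟩ := w'
  obtain rfl : y = y' := h
  refine Subtype.ext (Prod.ext rfl (sub_eq_zero.1 (hf _ (z - z') ?_)))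
  exact (smul_sub _ _ _).trans (sub_eq_zero.2 (h1.symm.trans h1'))

include hf in
theorem exists_etaFst_eq {i j : ℤ} (h : i + 1 = j) {y : K.X i} {z : K.X j}
    (hz : K.d i j h y = f • z) : ∃ w, etaFst f K i w = y := by
  subst h
  refine ⟨⟨(y, z), hz, hf _ _ ?_⟩, rfl⟩
  rw [← map_smul, ← hz, K.d_d]

include ha in
theorem eta_regular (i : ℤ) (w : (eta f K).X i) (h : a • w = 0) : w = 0 := by
  have h' : a • (show etaTerm f K i from w).1 = 0 := congrArg Subtype.val h
  exact Subtype.ext (Prod.ext (ha _ _ (congrArg Prod.fst h')) (ha _ _ (congrArg Prod.snd h')))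

end Regular

section CanMap

variable (hf : ∀ i (x : K.X i), f • x = 0 → x = 0) (ha : ∀ i (x : K.X i), a • x = 0 → x = 0)
  (hK : ∀ c : Hn K 0, f • c = 0 → c = 0) (n : ℕ)

theorem exists_smul_pow {n : ℕ} {y : K.X n} {v : K.X (n + 1)}
    (hv : K.d n (n + 1) rfl y = (f * a) • v) : ∃ v', a • v' = K.d n (n + 1) rfl (f ^ n • y) :=
  ⟨f ^ (n + 1) • v, by rw [map_smul, hv, smul_smul, smul_smul]; congr 1; ring⟩

theorem exists_smul_pow_etaFst {n : ℕ} {w : (eta f K).X n}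
    (hw : ∃ v, a • v = (eta f K).d n (n + 1) rfl w) :
    ∃ v, a • v = K.d n (n + 1) rfl (f ^ n • etaFst f K n w) := by
  obtain ⟨v, hv⟩ := hw
  exact exists_smul_pow (v := etaFst f K (n + 1) v) (by
    rw [mul_smul, ← map_smul, hv, d_etaFst])

theorem canMap_cls (w : (eta f K).X n) (hw hw') :
    canMap f a K hK n (cls a (eta f K) n w hw) = cls a K n (f ^ n • etaFst f K n w) hw' := rfl

/-- One half of the description of the image of `ι`; `canMap_mem` is the other. A cocycle `(y, z)`
of `η_f K` modulo `a` has `z = av`, and `dy = fz` then equals `fav`. -/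
theorem canMap_rep (x : Hn (modBy a (eta f K)) n) :
    ∃ (y : K.X n) (v : K.X (n + 1)) (h : K.d n (n + 1) rfl y = (f * a) • v),
      canMap f a K hK n x = cls a K n (f ^ n • y) (exists_smul_pow h) := by
  obtain ⟨w, ⟨v, hv⟩, rfl⟩ := cls_surjective x
  refine ⟨etaFst f K n w, etaFst f K (n + 1) v, ?_, rfl⟩
  rw [mul_smul, ← map_smul, hv, d_etaFst]

include hf ha

/-- Divisibility of `dy` by `f` lifts `y` to `η_f K`. For the lift to be a cocycle modulo `a`, also
`v` must lift, and it does because `fa dv = 0` forces `dv = 0`. -/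
theorem exists_cls_eta {n : ℤ} {y : K.X n} {v : K.X (n + 1)}
    (h : K.d n (n + 1) rfl y = (f * a) • v) :
    ∃ w, etaFst f K n w = y ∧ ∃ v, a • v = (eta f K).d n (n + 1) rfl w := by
  obtain ⟨w, rfl⟩ := exists_etaFst_eq hf rfl (h.trans (mul_smul _ _ _))
  have hv : K.d (n + 1) (n + 1 + 1) rfl v = f • (0 : K.X (n + 1 + 1)) := by
    rw [smul_zero]
    apply ha
    apply hf
    rw [smul_smul, ← map_smul, ← h, K.d_d]
  obtain ⟨v, rfl⟩ := exists_etaFst_eq hf rfl hv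
  refine ⟨w, rfl, v, etaFst_injective hf _ (sub_eq_zero.1 (hf _ _ ?_))⟩
  rw [smul_sub, ← d_etaFst, h, map_smul, mul_smul, sub_self]

theorem canMap_mem {y : K.X n} {v : K.X (n + 1)} (h : K.d n (n + 1) rfl y = (f * a) • v) :
    ∃ x, canMap f a K hK n x = cls a K n (f ^ n • y) (exists_smul_pow h) := by
  obtain ⟨w, rfl, hw⟩ := exists_cls_eta hf ha h
  exact ⟨cls a (eta f K) n w hw, rfl⟩

/-- On first components the differential of `η_f K` is `d` divided by `f`, while `ι` passes from the
factor `f^n` to `f^{n+1}`. The two effects cancel. -/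
theorem canMap_bock {m : ℕ} (h : (n : ℤ) + 1 = m) (x : Hn (modBy a (eta f K)) n) :
    canMap f a K hK m (bock (eta_regular ha) n m h x) =
      bock ha n m h (canMap f a K hK n x) := by
  obtain ⟨w, hw, rfl⟩ := cls_surjective x
  obtain ⟨V, hV⟩ : ∃ V, (eta f K).d n m h w = a • V := by
    obtain ⟨V, hV⟩ := hw
    clear * - hV
    generalize (m : ℤ) = m' at h ⊢
    subst h
    exact ⟨V, hV.symm⟩
  have hVd : ∀ k hk, (eta f K).d m k hk V = 0 := fun k hk => by
    apply eta_regular ha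
    rw [← map_smul, ← hV, (eta f K).d_d]
  have hm : f ^ m = f ^ n * f := by
    rw [← pow_succ]
    congr 1
    omega
  have h0 : ∃ v, a • v = K.d m (m + 1) rfl (f ^ m • etaFst f K m V) :=
    ⟨0, by rw [smul_zero, map_smul, d_etaFst, hVd, map_zero, smul_zero, smul_zero]⟩
  rw [bock_cls (eta_regular ha) n m h hV ⟨0, by rw [smul_zero, hVd]⟩]
  refine (canMap_cls hK m V _ h0).trans (bock_cls ha n m h
    (hx := exists_smul_pow_etaFst hw) ?_ h0).symm
  rw [map_smul, d_etaFst, hV, map_smul, hm, mul_smul, smul_comm a, smul_comm a]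

/-- It is enough that `f^n` kills the kernel. If `f^n y = du + at` in `K`, then `dt` is divisible by
`f`, as one sees after cancelling `a`, so `t` lifts to `η_f K`. The equation can then be read in
`η_f K`, where it says that `f^n` times the class is zero. -/
theorem canMap_injective (htf : ∀ c : Hn (modBy a (eta f K)) n, f • c = 0 → c = 0) :
    Function.Injective (canMap f a K hK n) := by
  have htf' : ∀ (k : ℕ) (c : Hn (modBy a (eta f K)) n), f ^ k • c = 0 → c = 0 := by
    intro k
    induction k with
    | zero => intro c hc; simpa using hc
    | succ k ih => intro c hc; rw [pow_succ', mul_smul] at hc; exact ih _ (htf _ hc)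
  rw [injective_iff_map_eq_zero]
  intro x hx
  apply htf' n
  obtain ⟨w, hw, rfl⟩ := cls_surjective x
  have hx' : cls a K n (f ^ n • etaFst f K n w) (exists_smul_pow_etaFst hw) = cls a K n 0 ⟨0, by simp⟩ := hx
  obtain ⟨u, t, hut⟩ := (cls_eq_iff (sub_add_cancel (n : ℤ) 1)).1 hx'
  rw [sub_zero] at hut
  obtain ⟨v, hv⟩ := id hw
  have ht : K.d n (n + 1) rfl t = f • f ^ n • etaFst f K (n + 1) v := by
    rw [← sub_eq_zero]
    apply ha
    rw [smul_sub, ← map_smul, eq_sub_of_add_eq' hut.symm, map_sub, K.d_d, sub_zero, map_smul,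
      d_etaFst, ← hv, map_smul, smul_comm a f, smul_comm a, smul_comm (f ^ n) f, sub_self]
  obtain ⟨t, rfl⟩ := exists_etaFst_eq hf rfl ht
  -- The lift is of `fu` and not of `u`: its differential in `η_f K` has first component `d(fu)/f =
  -- du`.
  obtain ⟨u', hu'⟩ := exists_etaFst_eq hf (sub_add_cancel (n : ℤ) 1)
    (y := f • u) (map_smul (K.d (n - 1) n (sub_add_cancel (n : ℤ) 1)) f u)
  refine Eq.trans ((cls_eq_iff (sub_add_cancel (n : ℤ) 1) (hx := exists_smul_eq_d_smul _ hw)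
    (hy := ⟨0, by simp⟩)).2 ⟨u', t, ?_⟩) (rfl : cls a (eta f K) n 0 _ = 0)
  apply etaFst_injective hf
  rw [sub_zero, map_smul, hut, map_add, map_smul]
  congr 1
  rw [← sub_eq_zero]
  apply hf
  rw [smul_sub, ← d_etaFst, hu', map_smul, sub_self]

end CanMap

/-- A degree `0` cocycle `x` of `K/a` yields the cocycle `(x, 0)` of `η_f(K/a)`, and surjectivity of
base change lifts its class to `η_f K/a`. The lift agrees with `x` up to a coboundary from degree
`-1` of `η_f(K/a)`, and such a coboundary is one of `K/a` only after multiplication by `f`. This is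
where the torsion ambiguity in the structure maps comes from. -/
theorem exists_canMap_sub (hK : ∀ c : Hn K 0, f • c = 0 → c = 0)
    (hs : Function.Surjective ((baseChange f a K).H 0)) (c : Hn (modBy a K) 0) :
    ∃ x, f • (canMap f a K hK 0 x - c) = 0 := by
  obtain ⟨x, hx, rfl⟩ := cls_surjective c
  have hx0 : (modBy a K).d 0 (0 + 1) rfl (modBy.mk a K 0 x) = 0 := modBy.mk_eq_zero.2 hx
  let e : (eta f (modBy a K)).X 0 :=
    ⟨(modBy.mk a K 0 x, 0), by rw [smul_zero]; exact hx0, map_zero _⟩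
  have he : e ∈ (eta f (modBy a K)).cocycles 0 := (Cx.mem_cocycles rfl).2 rfl
  obtain ⟨t, ht⟩ := hs (Hn.mk ⟨e, he⟩)
  obtain ⟨w, hw, rfl⟩ := cls_surjective t
  obtain ⟨z, hz⟩ := (Hn.mk_eq_iff (sub_add_cancel (0 : ℤ) 1) _ _).1 ht
  have h1 := d_etaFst (sub_add_cancel (0 : ℤ) 1) z
  rw [hz, map_sub] at h1
  obtain ⟨U, hU⟩ := modBy.mk_surjective a K (0 - 1) (etaFst f (modBy a K) (0 - 1) z)
  rw [← hU, modBy.d_mk] at h1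
  have h2 : modBy.mk a K 0 (K.d (0 - 1) 0 (sub_add_cancel (0 : ℤ) 1) U) =
      modBy.mk a K 0 (f • (etaFst f K 0 w - x)) := h1
  rw [← sub_eq_zero, ← map_sub, modBy.mk_eq_zero] at h2
  obtain ⟨y, hy⟩ := h2
  have hw' := exists_smul_pow_etaFst (n := 0) hw
  refine ⟨cls a (eta f K) 0 w hw, ?_⟩
  rw [smul_sub, sub_eq_zero]
  refine (cls_eq_iff (a := a) (K := K) (n := 0) (sub_add_cancel (0 : ℤ) 1)
    (x := f • f ^ 0 • etaFst f K 0 w) (y := f • x) (hx := exists_smul_eq_d_smul f hw')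
    (hy := exists_smul_eq_d_smul f hx)).2 ⟨U, -y, ?_⟩
  rw [smul_neg, hy, pow_zero, one_smul, smul_sub]
  abel

end Classes

/-! ### The graded algebra `H^*(D/a)` -/

section Algebra

variable {R : Type u} [CommRing R] {D D' : DAlg R} {σ : R →+* R} {a b : R}

theorem sgn_natCast (n : ℕ) : sgn (n : ℤ) = (-1) ^ n := by
  rw [sgn, Int.negOnePow_def, zpow_natCast]
  simp

theorem exists_smul_eq_d_mul (D : DAlg R) {i j k : ℤ} (h : i + j + 0 = k) {x : D.cx.X i}
    {y : D.cx.X j} (hx : ∃ v, a • v = D.cx.d i (i + 1) rfl x)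
    (hy : ∃ v, a • v = D.cx.d j (j + 1) rfl y) :
    ∃ v, a • v = D.cx.d k (k + 1) rfl (D.mul.toFun i j k h x y) := by
  obtain ⟨v, hv⟩ := hx
  obtain ⟨w, hw⟩ := hy
  refine ⟨D.mul.toFun (i + 1) j (k + 1) (by omega) v y +
    sgn i • D.mul.toFun i (j + 1) (k + 1) (by omega) x w, ?_⟩
  rw [D.mul.leibniz i j k (i + 1) (j + 1) (k + 1) h rfl rfl rfl, ← hv, ← hw, map_smul, map_smul,
    LinearMap.smul_apply, smul_add, smul_comm a]

theorem mulMod_cls (D : DAlg R) {i j k : ℤ} (h : i + j = k) {x : D.cx.X i} {y : D.cx.X j}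
    {hx hy} {hk : i + j + 0 = k} (hxy) :
    D.mulMod a i j k h (cls a D.cx i x hx) (cls a D.cx j y hy) =
      cls a D.cx k (D.mul.toFun i j k hk x y) hxy := rfl

theorem exists_smul_eq_d_one (D : DAlg R) : ∃ v, a • v = D.cx.d 0 (0 + 1) rfl D.one.1 :=
  ⟨0, by rw [smul_zero, (Cx.mem_cocycles rfl).1 D.one.2]⟩

theorem oneMod_eq_cls (D : DAlg R) :
    D.oneMod a = cls a D.cx 0 D.one.1 (exists_smul_eq_d_one D) := rfl

variable {i j k : ℤ} (h : i + j = k)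

theorem mulMod_add_left (c c' : Hn (modBy a D.cx) i) (e : Hn (modBy a D.cx) j) :
    D.mulMod a i j k h (c + c') e = D.mulMod a i j k h c e + D.mulMod a i j k h c' e := by
  obtain ⟨x, hx, rfl⟩ := cls_surjective c
  obtain ⟨x', hx', rfl⟩ := cls_surjective c'
  obtain ⟨y, hy, rfl⟩ := cls_surjective e
  have hxx : ∃ v, a • v = D.cx.d i (i + 1) rfl (x + x') := by
    obtain ⟨v, hv⟩ := hx
    obtain ⟨v', hv'⟩ := hx'
    exact ⟨v + v', by rw [smul_add, hv, hv', map_add]⟩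
  rw [← cls_add hxx, mulMod_cls D h (exists_smul_eq_d_mul D (by omega : i + j + 0 = k) hxx hy),
    mulMod_cls D h (exists_smul_eq_d_mul D (by omega : i + j + 0 = k) hx hy),
    mulMod_cls D h (exists_smul_eq_d_mul D (by omega : i + j + 0 = k) hx' hy)]
  refine (cls_congr ?_).trans (cls_add ?_)
  · rw [map_add, LinearMap.add_apply]
  · rw [← LinearMap.add_apply, ← map_add]
    exact exists_smul_eq_d_mul D (by omega : i + j + 0 = k) hxx hy

theorem mulMod_add_right (c : Hn (modBy a D.cx) i) (e e' : Hn (modBy a D.cx) j) :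
    D.mulMod a i j k h c (e + e') = D.mulMod a i j k h c e + D.mulMod a i j k h c e' := by
  obtain ⟨x, hx, rfl⟩ := cls_surjective c
  obtain ⟨y, hy, rfl⟩ := cls_surjective e
  obtain ⟨y', hy', rfl⟩ := cls_surjective e'
  have hyy : ∃ v, a • v = D.cx.d j (j + 1) rfl (y + y') := by
    obtain ⟨v, hv⟩ := hy
    obtain ⟨v', hv'⟩ := hy'
    exact ⟨v + v', by rw [smul_add, hv, hv', map_add]⟩
  rw [← cls_add hyy, mulMod_cls D h (exists_smul_eq_d_mul D (by omega : i + j + 0 = k) hx hyy),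
    mulMod_cls D h (exists_smul_eq_d_mul D (by omega : i + j + 0 = k) hx hy),
    mulMod_cls D h (exists_smul_eq_d_mul D (by omega : i + j + 0 = k) hx hy')]
  refine (cls_congr ?_).trans (cls_add ?_)
  · rw [map_add]
  · rw [← map_add]
    exact exists_smul_eq_d_mul D (by omega : i + j + 0 = k) hx hyy

theorem mulMod_smul_left (r : R) (c : Hn (modBy a D.cx) i) (e : Hn (modBy a D.cx) j) :
    D.mulMod a i j k h (r • c) e = r • D.mulMod a i j k h c e := by
  obtain ⟨x, hx, rfl⟩ := cls_surjective c
  obtain ⟨y, hy, rfl⟩ := cls_surjective e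
  rw [← cls_smul r (exists_smul_eq_d_smul r hx),
    mulMod_cls D h (exists_smul_eq_d_mul D (by omega : i + j + 0 = k) (exists_smul_eq_d_smul r hx) hy),
    mulMod_cls D h (exists_smul_eq_d_mul D (by omega : i + j + 0 = k) hx hy),
    ← cls_smul r (exists_smul_eq_d_smul r
      (exists_smul_eq_d_mul D (by omega : i + j + 0 = k) hx hy))]
  exact cls_congr (by rw [map_smul, LinearMap.smul_apply])

theorem mulMod_smul_right (r : R) (c : Hn (modBy a D.cx) i) (e : Hn (modBy a D.cx) j) :
    D.mulMod a i j k h c (r • e) = r • D.mulMod a i j k h c e := by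
  obtain ⟨x, hx, rfl⟩ := cls_surjective c
  obtain ⟨y, hy, rfl⟩ := cls_surjective e
  rw [← cls_smul r (exists_smul_eq_d_smul r hy),
    mulMod_cls D h (exists_smul_eq_d_mul D (by omega : i + j + 0 = k) hx (exists_smul_eq_d_smul r hy)),
    mulMod_cls D h (exists_smul_eq_d_mul D (by omega : i + j + 0 = k) hx hy),
    ← cls_smul r (exists_smul_eq_d_smul r
      (exists_smul_eq_d_mul D (by omega : i + j + 0 = k) hx hy))]
  exact cls_congr (by rw [map_smul])

theorem oneMod_mulMod {n : ℤ} (h : 0 + n = n) (c : Hn (modBy a D.cx) n) :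
    D.mulMod a 0 n n h (D.oneMod a) c = c := by
  obtain ⟨x, hx, rfl⟩ := cls_surjective c
  rw [oneMod_eq_cls,
    mulMod_cls D h (exists_smul_eq_d_mul D (by omega : 0 + n + 0 = n) (exists_smul_eq_d_one D) hx)]
  exact cls_eq_of_homotopic D.one_mul ⟨1, (mul_one a).symm⟩ hx

theorem cls_zsmul {K : Cx R} {n : ℤ} (m : ℤ) {x : K.X n} {hx} (hcx) :
    cls a K n (m • x) hcx = m • cls a K n x hx := by
  have h := Int.cast_smul_eq_zsmul R m x
  exact (cls_congr (hy := by rw [h]; exact hcx) h.symm).trans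
    ((cls_smul _ _).trans (Int.cast_smul_eq_zsmul R m _))

theorem exists_smul_eq_d_zsmul {K : Cx R} {n : ℤ} (m : ℤ) {x : K.X n}
    (hx : ∃ v, a • v = K.d n (n + 1) rfl x) : ∃ v, a • v = K.d n (n + 1) rfl (m • x) := by
  obtain ⟨v, hv⟩ := hx
  exact ⟨m • v, by rw [smul_comm, hv, map_zsmul]⟩

theorem mulMod_comm (h' : j + i = k) (c : Hn (modBy a D.cx) i) (e : Hn (modBy a D.cx) j) :
    D.mulMod a i j k h c e = sgn (i * j) • D.mulMod a j i k h' e c := by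
  obtain ⟨x, hx, rfl⟩ := cls_surjective c
  obtain ⟨y, hy, rfl⟩ := cls_surjective e
  have hyx := exists_smul_eq_d_mul D (by omega : j + i + 0 = k) hy hx
  rw [mulMod_cls D h (exists_smul_eq_d_mul D (by omega : i + j + 0 = k) hx hy), mulMod_cls D h' hyx,
    ← cls_zsmul _ (exists_smul_eq_d_zsmul _ hyx)]
  exact cls_eq_of_biHomotopic D.mul_comm ⟨1, (mul_one a).symm⟩ (by omega) hx hy

theorem mulMod_assoc {l m n : ℤ} (h : i + j = k) (h' : j + l = m) (hn : k + l = n)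
    (hn' : i + m = n) (c : Hn (modBy a D.cx) i) (e : Hn (modBy a D.cx) j)
    (t : Hn (modBy a D.cx) l) :
    D.mulMod a k l n hn (D.mulMod a i j k h c e) t =
      D.mulMod a i m n hn' c (D.mulMod a j l m h' e t) := by
  subst h h'
  obtain ⟨x, hx, rfl⟩ := cls_surjective c
  obtain ⟨y, hy, rfl⟩ := cls_surjective e
  obtain ⟨z, hz, rfl⟩ := cls_surjective t
  have hxy := exists_smul_eq_d_mul D (by omega : i + j + 0 = i + j) hx hy
  have hyz := exists_smul_eq_d_mul D (by omega : j + l + 0 = j + l) hy hz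
  rw [mulMod_cls D _ hxy, mulMod_cls D _ hyz,
    mulMod_cls D hn (exists_smul_eq_d_mul D (by omega : i + j + l + 0 = n) hxy hz),
    mulMod_cls D hn' (exists_smul_eq_d_mul D (by omega : i + (j + l) + 0 = n) hx hyz)]
  exact cls_eq_of_triHomotopic D.mul_assoc hn hx hy hz

/-- Algebra maps induce multiplicative maps on cohomology. -/
theorem mulMod_map (g : SemiMap σ D.cx D'.cx) (hg : g.IsAlgMap) (hσ : ∃ c, σ a = b * c) (hb)
    (c : Hn (modBy a D.cx) i) (e : Hn (modBy a D.cx) j) :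
    (g.modBy a b hb).H k (D.mulMod a i j k h c e) =
      D'.mulMod b i j k h ((g.modBy a b hb).H i c) ((g.modBy a b hb).H j e) := by
  obtain ⟨x, hx, rfl⟩ := cls_surjective c
  obtain ⟨y, hy, rfl⟩ := cls_surjective e
  have hxy := exists_smul_eq_d_mul D (by omega : i + j + 0 = k) hx hy
  have hx' := exists_smul_eq_d_map g hσ hx
  have hy' := exists_smul_eq_d_map g hσ hy
  rw [mulMod_cls D h hxy, g.H_modBy_cls hb _ hx hx', g.H_modBy_cls hb _ hy hy',
    g.H_modBy_cls hb _ hxy (exists_smul_eq_d_map g hσ hxy),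
    mulMod_cls D' h (exists_smul_eq_d_mul D' _ hx' hy')]
  exact cls_eq_of_biHomotopic hg.mul hσ (by omega) hx hy

theorem oneMod_map (g : SemiMap σ D.cx D'.cx) (hg : g.IsAlgMap) (hσ : ∃ c, σ a = b * c) (hb) :
    (g.modBy a b hb).H 0 (D.oneMod a) = D'.oneMod b := by
  have h1 := exists_smul_eq_d_one (a := a) D
  rw [oneMod_eq_cls, oneMod_eq_cls, g.H_modBy_cls hb _ h1 (exists_smul_eq_d_map g hσ h1),
    cls_eq_iff (sub_add_cancel (0 : ℤ) 1)]
  obtain ⟨u, hu⟩ := (Cx.mem_coboundaries (sub_add_cancel (0 : ℤ) 1)).1 hg.one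
  exact ⟨u, 0, by rw [smul_zero, add_zero, hu]⟩

/-- The Leibniz rule for the Bockstein. -/
theorem bock_mulMod (ha : ∀ i (x : D.cx.X i), a • x = 0 → x = 0) {i' j' k' : ℤ} (hi : i + 1 = i')
    (hj : j + 1 = j') (hk : k + 1 = k') (h₁ : i' + j = k') (h₂ : i + j' = k')
    (c : Hn (modBy a D.cx) i) (e : Hn (modBy a D.cx) j) :
    bock ha k k' hk (D.mulMod a i j k h c e) =
      D.mulMod a i' j k' h₁ (bock ha i i' hi c) e +
        sgn i • D.mulMod a i j' k' h₂ c (bock ha j j' hj e) := by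
  subst hi hj hk
  obtain ⟨x, hx, rfl⟩ := cls_surjective c
  obtain ⟨y, hy, rfl⟩ := cls_surjective e
  have hxy := exists_smul_eq_d_mul D (by omega : i + j + 0 = k) hx hy
  obtain ⟨v, hv⟩ := id hx
  obtain ⟨w, hw⟩ := id hy
  have hv0 : ∃ t, a • t = D.cx.d (i + 1) (i + 1 + 1) rfl v :=
    ⟨0, by rw [smul_zero]; exact (ha _ _ (by rw [← map_smul, hv, D.cx.d_d])).symm⟩
  have hw0 : ∃ t, a • t = D.cx.d (j + 1) (j + 1 + 1) rfl w :=
    ⟨0, by rw [smul_zero]; exact (ha _ _ (by rw [← map_smul, hw, D.cx.d_d])).symm⟩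
  have hvy := exists_smul_eq_d_mul D (by omega : i + 1 + j + 0 = k + 1) hv0 hy
  have hxw := exists_smul_eq_d_mul D (by omega : i + (j + 1) + 0 = k + 1) hx hw0
  have hxw' := exists_smul_eq_d_zsmul (sgn i) hxw
  have hs : ∃ t, a • t = D.cx.d (k + 1) (k + 1 + 1) rfl
      (D.mul.toFun (i + 1) j (k + 1) (by omega) v y +
        sgn i • D.mul.toFun i (j + 1) (k + 1) (by omega) x w) := by
    obtain ⟨t, ht⟩ := hvy
    obtain ⟨t', ht'⟩ := hxw'
    exact ⟨t + t', by rw [smul_add, ht, ht', map_add]⟩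
  rw [mulMod_cls D h hxy, bock_cls ha i _ rfl hv.symm hv0, bock_cls ha j _ rfl hw.symm hw0,
    mulMod_cls D h₁ hvy, mulMod_cls D h₂ hxw, ← cls_zsmul _ hxw', ← cls_add hs]
  apply bock_cls
  rw [D.mul.leibniz i j k (i + 1) (j + 1) (k + 1) (by omega) rfl rfl rfl, ← hv, ← hw, map_smul,
    map_smul, LinearMap.smul_apply, smul_add, smul_comm a (sgn i)]

end Algebra

/-! ### The operators on `H^n(D/ξ̃_r)` -/

/-- A projective module embeds into a free one, where the action of `a` is coordinatewise. -/
theorem smul_eq_zero_of_projective {R : Type u} [CommRing R] {M : Type v} [AddCommGroup M]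
    [Module R M] (hM : Module.Projective R M) {a : R} (ha : ∀ r : R, a * r = 0 → r = 0) {x : M}
    (hx : a • x = 0) : x = 0 := by
  obtain ⟨s, hs⟩ := hM.out
  have h : s x = 0 := by
    ext i
    apply ha
    have := congrArg (fun t => t i) (congrArg s hx)
    simpa using this
  rw [← hs x, h, map_zero]

section Pre

variable {p : ℕ} [Fact p.Prime] {A : Type u} [CommRing A] [Fact (¬ IsUnit (p : A))]
  (Z : RootSystem p A) {D D' : FrobAlg p A}

theorem FrobAlg.frobInv_scalar (r : ℕ) :
    ∃ c, ((phi p A).symm : Ainf p A →+* Ainf p A) (Z.xiTilde (r + 1)) = Z.xiTilde r * c :=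
  ⟨Z.xi, Z.phi_symm_xiTilde_succ r⟩

theorem FrobAlg.preR_cls {r : ℕ} {n : ℤ} {x : D.cx.X n} {hx} (hx') :
    D.preR Z r n (cls (Z.xiTilde (r + 1)) D.cx n x hx) =
      cls (Z.xiTilde r) D.cx n (D.frobInv.toFun n x) hx' := rfl

theorem FrobAlg.preF_cls {r : ℕ} {n : ℤ} {x : D.cx.X n} {hx} (hx') :
    D.preF Z r n (cls (Z.xiTilde (r + 1)) D.cx n x hx) = cls (Z.xiTilde r) D.cx n x hx' :=
  (rfl : _ = cls (Z.xiTilde r) D.cx n ((1 : Ainf p A) • x) (by rwa [one_smul])).trans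
    (cls_congr (one_smul _ _))

theorem FrobAlg.preV_cls {r : ℕ} {n : ℤ} {x : D.cx.X n} {hx} (hx') :
    D.preV Z r n (cls (Z.xiTilde r) D.cx n x hx) =
      cls (Z.xiTilde (r + 1)) D.cx n (Z.phiXi (r + 1) • x) hx' := rfl

variable {Z}

theorem exists_smul_preR {r : ℕ} {n : ℤ} {x : D.cx.X n}
    (hx : ∃ v, Z.xiTilde (r + 1) • v = D.cx.d n (n + 1) rfl x) :
    ∃ v, Z.xiTilde r • v = D.cx.d n (n + 1) rfl (D.frobInv.toFun n x) :=
  exists_smul_eq_d_map D.frobInv (FrobAlg.frobInv_scalar Z r) hx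

theorem exists_smul_preF {r : ℕ} {n : ℤ} {K : Cx (Ainf p A)} {x : K.X n}
    (hx : ∃ v, Z.xiTilde (r + 1) • v = K.d n (n + 1) rfl x) :
    ∃ v, Z.xiTilde r • v = K.d n (n + 1) rfl x := by
  obtain ⟨v, hv⟩ := hx
  exact ⟨Z.phiXi (r + 1) • v, by rw [smul_smul, ← Z.xiTilde_succ, hv]⟩

theorem exists_smul_preV {r : ℕ} {n : ℤ} {K : Cx (Ainf p A)} {x : K.X n}
    (hx : ∃ v, Z.xiTilde r • v = K.d n (n + 1) rfl x) :
    ∃ v, Z.xiTilde (r + 1) • v = K.d n (n + 1) rfl (Z.phiXi (r + 1) • x) := by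
  obtain ⟨v, hv⟩ := hx
  exact ⟨v, by rw [map_smul, ← hv, smul_smul, mul_comm, ← Z.xiTilde_succ]⟩

/-- The inverse of the Frobenius is multiplicative on cohomology. -/
theorem FrobAlg.preR_mul {r : ℕ} {i j k : ℤ} (h : i + j = k) (c : D.Pre Z (r + 1) i)
    (e : D.Pre Z (r + 1) j) :
    D.preR Z r k (D.mulMod (Z.xiTilde (r + 1)) i j k h c e) =
      D.mulMod (Z.xiTilde r) i j k h (D.preR Z r i c) (D.preR Z r j e) := by
  obtain ⟨x, hx, rfl⟩ := cls_surjective c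
  obtain ⟨y, hy, rfl⟩ := cls_surjective e
  -- Multiplicativity is given for `φ_D` and not for its inverse. Both classes are therefore written
  -- as `φ_D` of classes modulo `φ^{-1}(ξ̃_{r+1}) = ξ̃_r ξ`; their product there is moved through
  -- `φ_D`, and the homotopy `φ_D^{-1} φ_D ≃ id` concludes modulo `ξ̃_r`.
  have hσ : ∃ c, ((phi p A).symm : Ainf p A →+* Ainf p A) (Z.xiTilde (r + 1)) =
    (phi p A).symm (Z.xiTilde (r + 1)) * c := ⟨1, (mul_one _).symm⟩
  have hφ : ∃ c, (phi p A : Ainf p A →+* Ainf p A) ((phi p A).symm (Z.xiTilde (r + 1))) =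
    Z.xiTilde (r + 1) * c := ⟨1, by rw [mul_one]; exact (phi p A).apply_symm_apply _⟩
  have hk : i + j + 0 = k := by omega
  have hX := exists_smul_eq_d_map D.frobInv hσ hx
  have hY := exists_smul_eq_d_map D.frobInv hσ hy
  have hXY := exists_smul_eq_d_mul D.toDAlg hk hX hY
  have hfX := exists_smul_eq_d_map D.frob hφ hX
  have hfY := exists_smul_eq_d_map D.frob hφ hY
  have hxy := exists_smul_eq_d_mul D.toDAlg hk hx hy
  have hfXY := exists_smul_eq_d_mul D.toDAlg hk hfX hfY
  have hfXY' := exists_smul_eq_d_map D.frob hφ hXY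
  have h1 : cls (Z.xiTilde (r + 1)) D.cx i x hx = cls _ D.cx i _ hfX :=
    (cls_eq_of_homotopic D.frob_frobInv ⟨1, (mul_one _).symm⟩ hx).symm
  have h2 : cls (Z.xiTilde (r + 1)) D.cx j y hy = cls _ D.cx j _ hfY :=
    (cls_eq_of_homotopic D.frob_frobInv ⟨1, (mul_one _).symm⟩ hy).symm
  have h3 : cls (Z.xiTilde (r + 1)) D.cx k _ hfXY = cls _ D.cx k _ hfXY' :=
    (cls_eq_of_biHomotopic D.frob_isAlgMap.mul hφ hk hX hY).symm
  rw [preR_cls Z (exists_smul_preR hx), preR_cls Z (exists_smul_preR hy),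
    mulMod_cls _ _ (exists_smul_eq_d_mul D.toDAlg hk (exists_smul_preR hx) (exists_smul_preR hy)),
    h1, h2, mulMod_cls _ _ hfXY, h3, preR_cls Z (exists_smul_preR hfXY')]
  exact cls_eq_of_homotopic D.frobInv_frob (FrobAlg.frobInv_scalar Z r) hXY

theorem FrobAlg.preR_one {r : ℕ} :
    D.preR Z r 0 (D.oneMod (Z.xiTilde (r + 1))) = D.oneMod (Z.xiTilde r) := by
  have hφ : ∃ c, (phi p A : Ainf p A →+* Ainf p A) ((phi p A).symm (Z.xiTilde (r + 1))) =
    Z.xiTilde (r + 1) * c := ⟨1, by rw [mul_one]; exact (phi p A).apply_symm_apply _⟩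
  have h1 := exists_smul_eq_d_one (a := (phi p A).symm (Z.xiTilde (r + 1))) D.toDAlg
  have h2 := exists_smul_eq_d_map D.frob hφ h1
  have h3 : D.oneMod (Z.xiTilde (r + 1)) = cls _ D.cx 0 _ h2 :=
    (oneMod_map D.frob D.frob_isAlgMap hφ (fun i x => ⟨D.frob.toFun i x, by
      rw [LinearMap.map_smulₛₗ]
      exact congrArg (· • _) ((phi p A).apply_symm_apply _).symm⟩)).symm
  rw [h3, preR_cls Z (exists_smul_preR h2), oneMod_eq_cls]
  exact cls_eq_of_homotopic D.frobInv_frob (FrobAlg.frobInv_scalar Z r) h1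

theorem FrobAlg.preF_mul {r : ℕ} {i j k : ℤ} (h : i + j = k) (c : D.Pre Z (r + 1) i)
    (e : D.Pre Z (r + 1) j) :
    D.preF Z r k (D.mulMod (Z.xiTilde (r + 1)) i j k h c e) =
      D.mulMod (Z.xiTilde r) i j k h (D.preF Z r i c) (D.preF Z r j e) := by
  obtain ⟨x, hx, rfl⟩ := cls_surjective c
  obtain ⟨y, hy, rfl⟩ := cls_surjective e
  have hk : i + j + 0 = k := by omega
  have hxy := exists_smul_eq_d_mul D.toDAlg hk hx hy
  rw [preF_cls Z (exists_smul_preF hx), preF_cls Z (exists_smul_preF hy), mulMod_cls _ _ hxy,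
    preF_cls Z (exists_smul_preF hxy), mulMod_cls _ _ (exists_smul_preF hxy)]

theorem FrobAlg.preF_one {r : ℕ} :
    D.preF Z r 0 (D.oneMod (Z.xiTilde (r + 1))) = D.oneMod (Z.xiTilde r) :=
  preF_cls Z (hx := exists_smul_eq_d_one D.toDAlg) (exists_smul_eq_d_one D.toDAlg)

theorem FrobAlg.preV_mul {r : ℕ} {i j k : ℤ} (h : i + j = k) (c : D.Pre Z (r + 1) i)
    (e : D.Pre Z r j) :
    D.preV Z r k (D.mulMod (Z.xiTilde r) i j k h (D.preF Z r i c) e) =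
      D.mulMod (Z.xiTilde (r + 1)) i j k h c (D.preV Z r j e) := by
  obtain ⟨x, hx, rfl⟩ := cls_surjective c
  obtain ⟨y, hy, rfl⟩ := cls_surjective e
  have hk : i + j + 0 = k := by omega
  have hxy := exists_smul_eq_d_mul D.toDAlg hk (exists_smul_preF hx) hy
  have hxy' := exists_smul_eq_d_mul D.toDAlg hk hx (exists_smul_preV hy)
  rw [preF_cls Z (exists_smul_preF hx), mulMod_cls _ _ hxy, preV_cls Z (exists_smul_preV hxy),
    preV_cls Z (exists_smul_preV hy), mulMod_cls _ _ hxy']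
  exact cls_congr (map_smul _ _ _).symm

theorem FrobAlg.preR_preF {r : ℕ} {n : ℤ} (c : D.Pre Z (r + 1 + 1) n) :
    D.preR Z r n (D.preF Z (r + 1) n c) = D.preF Z r n (D.preR Z (r + 1) n c) := by
  obtain ⟨x, hx, rfl⟩ := cls_surjective c
  rw [preF_cls Z (exists_smul_preF hx), preR_cls Z (exists_smul_preR (exists_smul_preF hx)),
    preR_cls Z (exists_smul_preR hx), preF_cls]

theorem phi_symm_phiXi (i : ℕ) : (phi p A).symm (Z.phiXi (i + 1)) = Z.phiXi i := by
  rw [RootSystem.phiXi, Function.iterate_succ', Function.comp_apply, RingEquiv.symm_apply_apply]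
  rfl

theorem FrobAlg.preR_preV {r : ℕ} {n : ℤ} (c : D.Pre Z (r + 1) n) :
    D.preR Z (r + 1) n (D.preV Z (r + 1) n c) = D.preV Z r n (D.preR Z r n c) := by
  obtain ⟨x, hx, rfl⟩ := cls_surjective c
  rw [preV_cls Z (exists_smul_preV hx), preR_cls Z (exists_smul_preR (exists_smul_preV hx)),
    preR_cls Z (exists_smul_preR hx), preV_cls Z (exists_smul_preV (exists_smul_preR hx))]
  refine cls_congr ((LinearMap.map_smulₛₗ _ _ _).trans ?_)
  exact congrArg (· • _) (phi_symm_phiXi (r + 1))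

theorem FrobAlg.Hom.pre_cls (f : FrobAlg.Hom D D') {r : ℕ} {n : ℤ} {x : D.cx.X n} {hx} (hx') :
    f.pre Z r n (cls (Z.xiTilde r) D.cx n x hx) =
      cls (Z.xiTilde r) D'.cx n (f.map.toFun n x) hx' := rfl

theorem exists_smul_pre (f : FrobAlg.Hom D D') {a : Ainf p A} {n : ℤ} {x : D.cx.X n}
    (hx : ∃ v, a • v = D.cx.d n (n + 1) rfl x) :
    ∃ v, a • v = D'.cx.d n (n + 1) rfl (f.map.toFun n x) :=
  exists_smul_eq_d_map f.map ⟨1, (mul_one _).symm⟩ hx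

theorem FrobAlg.Hom.pre_mul (f : FrobAlg.Hom D D') {r : ℕ} {i j k : ℤ} (h : i + j = k)
    (c : D.Pre Z r i) (e : D.Pre Z r j) :
    f.pre Z r k (D.mulMod (Z.xiTilde r) i j k h c e) =
      D'.mulMod (Z.xiTilde r) i j k h (f.pre Z r i c) (f.pre Z r j e) :=
  mulMod_map h f.map f.isAlgMap ⟨1, (mul_one _).symm⟩ _ c e

theorem FrobAlg.Hom.pre_one (f : FrobAlg.Hom D D') {r : ℕ} :
    f.pre Z r 0 (D.oneMod (Z.xiTilde r)) = D'.oneMod (Z.xiTilde r) :=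
  oneMod_map f.map f.isAlgMap ⟨1, (mul_one _).symm⟩ _

theorem FrobAlg.Hom.pre_preF (f : FrobAlg.Hom D D') {r : ℕ} {n : ℤ} (c : D.Pre Z (r + 1) n) :
    f.pre Z r n (D.preF Z r n c) = D'.preF Z r n (f.pre Z (r + 1) n c) := by
  obtain ⟨x, hx, rfl⟩ := cls_surjective c
  rw [preF_cls Z (exists_smul_preF hx), f.pre_cls (exists_smul_pre f (exists_smul_preF hx)),
    f.pre_cls (exists_smul_pre f hx), preF_cls]

theorem FrobAlg.Hom.pre_preV (f : FrobAlg.Hom D D') {r : ℕ} {n : ℤ} (c : D.Pre Z r n) :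
    f.pre Z (r + 1) n (D.preV Z r n c) = D'.preV Z r n (f.pre Z r n c) := by
  obtain ⟨x, hx, rfl⟩ := cls_surjective c
  rw [preV_cls Z (exists_smul_preV hx), f.pre_cls (exists_smul_pre f (exists_smul_preV hx)),
    f.pre_cls (exists_smul_pre f hx), preV_cls Z (exists_smul_preV (exists_smul_pre f hx))]
  exact cls_congr (map_smul _ _ _)

/-- Compatibility is given for `φ_D` only. Replacing `x` by `φ_D(φ_D^{-1}(x))` allows it to be used
before `φ_{D'}^{-1}` is applied. -/
theorem FrobAlg.Hom.pre_preR (f : FrobAlg.Hom D D') {r : ℕ} {n : ℤ} (c : D.Pre Z (r + 1) n) :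
    f.pre Z r n (D.preR Z r n c) = D'.preR Z r n (f.pre Z (r + 1) n c) := by
  obtain ⟨x, hx, rfl⟩ := cls_surjective c
  have hσ : ∃ c, ((phi p A).symm : Ainf p A →+* Ainf p A) (Z.xiTilde (r + 1)) =
    (phi p A).symm (Z.xiTilde (r + 1)) * c := ⟨1, (mul_one _).symm⟩
  have hφ : ∃ c, (phi p A : Ainf p A →+* Ainf p A) ((phi p A).symm (Z.xiTilde (r + 1))) =
    Z.xiTilde (r + 1) * c := ⟨1, by rw [mul_one]; exact (phi p A).apply_symm_apply _⟩
  have hX := exists_smul_eq_d_map D.frobInv hσ hx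
  have hfX := exists_smul_eq_d_map D.frob hφ hX
  have hg := exists_smul_eq_d_map D'.frob hφ (exists_smul_pre f hX)
  have h1 : cls (Z.xiTilde (r + 1)) D.cx n x hx = cls _ D.cx n _ hfX :=
    (cls_eq_of_homotopic D.frob_frobInv ⟨1, (mul_one _).symm⟩ hx).symm
  have h2 : cls (Z.xiTilde (r + 1)) D'.cx n _ (exists_smul_pre f hfX) = cls _ D'.cx n _ hg :=
    cls_eq_of_homotopic f.frob_comm hφ hX
  rw [preR_cls Z (exists_smul_preR hx), f.pre_cls (exists_smul_pre f (exists_smul_preR hx)), h1,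
    f.pre_cls (exists_smul_pre f hfX), h2, preR_cls Z (exists_smul_preR hg)]
  exact (cls_eq_of_homotopic D'.frobInv_frob (FrobAlg.frobInv_scalar Z r)
    (exists_smul_pre f hX)).symm

variable [IsAdicComplete (Ideal.span {(p : A)}) A]

/-- The composite is multiplication by `φ^{r+1}(ξ)`, which is `p` modulo `ξ̃_r`, and `ξ̃_r` acts as
zero on the cohomology of `D/ξ̃_r`. -/
theorem FrobAlg.preF_preV {r : ℕ} {n : ℤ} (c : D.Pre Z r n) :
    D.preF Z r n (D.preV Z r n c) = p • c := by
  obtain ⟨x, hx, rfl⟩ := cls_surjective c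
  obtain ⟨w, hw⟩ := Z.exists_phiXi_eq r
  have h : D.preF Z r n (D.preV Z r n (cls (Z.xiTilde r) D.cx n x hx)) =
      Z.phiXi (r + 1) • cls (Z.xiTilde r) D.cx n x hx := by
    rw [preV_cls Z (exists_smul_preV hx), preF_cls Z (exists_smul_preF (exists_smul_preV hx)),
      cls_smul]
  rw [h, hw, add_smul, ← mul_assoc, mul_smul, smul_Hn_modBy, smul_zero, add_zero,
    Nat.cast_smul_eq_nsmul]

/-! ### The Bockstein on `H^*(D/ξ̃_r)` and its relations with `R'`, `F` and `V`. -/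

section Regular

variable (hpA : ∀ a : A, (p : A) * a = 0 → a = 0)
include hpA

theorem FrobAlg.xiTilde_regular (D : FrobAlg p A) (Z : RootSystem p A) (r : ℕ) (i : ℤ)
    (x : D.cx.X i) (h : Z.xiTilde r • x = 0) : x = 0 :=
  smul_eq_zero_of_projective (D.projective i) (fun _ => Z.xiTilde_regular hpA r) h

theorem FrobAlg.mu_regular (D : FrobAlg p A) (Z : RootSystem p A) (i : ℤ)
    (x : D.cx.X i) (h : Z.mu • x = 0) : x = 0 :=
  smul_eq_zero_of_projective (D.projective i) (fun _ => Z.mu_regular hpA) h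

/-- The Bockstein of `D/ξ̃_r`. -/
def FrobAlg.preD (D : FrobAlg p A) (Z : RootSystem p A) (r : ℕ) (n m : ℤ) (h : n + 1 = m) :
    D.Pre Z r n →+ D.Pre Z r m := bock (D.xiTilde_regular hpA Z r) n m h

theorem FrobAlg.preD_cls {r : ℕ} {n m : ℤ} (h : n + 1 = m) {x : D.cx.X n} {hx} {v : D.cx.X m}
    (hv : D.cx.d n m h x = Z.xiTilde r • v) (hv') :
    D.preD hpA Z r n m h (cls (Z.xiTilde r) D.cx n x hx) = cls (Z.xiTilde r) D.cx m v hv' :=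
  bock_cls _ n m h hv hv'

theorem exists_smul_preD {r : ℕ} {n m : ℤ} (h : n + 1 = m) {x : D.cx.X n} {v : D.cx.X m}
    (hv : D.cx.d n m h x = Z.xiTilde r • v) : ∃ t, Z.xiTilde r • t = D.cx.d m (m + 1) rfl v :=
  ⟨0, by
    rw [smul_zero]
    exact (D.xiTilde_regular hpA Z r _ _ (by rw [← map_smul, ← hv, D.cx.d_d])).symm⟩

theorem FrobAlg.preD_preD {r : ℕ} {n m k : ℤ} (h : n + 1 = m) (h' : m + 1 = k)
    (c : D.Pre Z r n) : D.preD hpA Z r m k h' (D.preD hpA Z r n m h c) = 0 := by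
  subst h h'
  obtain ⟨x, ⟨v, hv⟩, rfl⟩ := cls_surjective c
  obtain ⟨t, ht⟩ := exists_smul_preD hpA rfl hv.symm
  have hv0 : D.cx.d (n + 1) (n + 1 + 1) rfl v = Z.xiTilde r • (0 : D.cx.X (n + 1 + 1)) := by
    rw [smul_zero]
    exact D.xiTilde_regular hpA Z r _ _ (by rw [← map_smul, hv, D.cx.d_d])
  rw [preD_cls hpA rfl hv.symm ⟨t, ht⟩, preD_cls hpA rfl hv0 ⟨0, by simp⟩]
  rfl

/-- If `dx = ξ̃_{r+1} v`, applying `φ_D^{-1}` gives the factor `φ^{-1}(ξ̃_{r+1}) = ξ̃_r ξ`. The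
surplus `ξ` in each degree is what the normalisation `R = ξ^n R'` absorbs. -/
theorem FrobAlg.preD_preR {r : ℕ} {n m : ℤ} (h : n + 1 = m) (c : D.Pre Z (r + 1) n) :
    D.preD hpA Z r n m h (D.preR Z r n c) =
      Z.xi • D.preR Z r m (D.preD hpA Z (r + 1) n m h c) := by
  subst h
  obtain ⟨x, ⟨v, hv⟩, rfl⟩ := cls_surjective c
  have hv' := exists_smul_preD hpA rfl hv.symm
  have h1 := exists_smul_preR hv'
  rw [preD_cls hpA rfl hv.symm hv', preR_cls Z h1, preR_cls Z (exists_smul_preR ⟨v, hv⟩),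
    ← cls_smul _ (exists_smul_eq_d_smul _ h1)]
  apply preD_cls
  rw [D.frobInv.comm, ← hv, LinearMap.map_smulₛₗ, smul_smul]
  exact congrArg (· • _) (Z.phi_symm_xiTilde_succ r)

/-- Multiplying `dx = ξ̃_r v` by `φ^{r+1}(ξ)` turns `ξ̃_r` into `ξ̃_{r+1}` and leaves `v` unchanged,
so both Bocksteins are represented by `v`. -/
theorem FrobAlg.preF_preD_preV {r : ℕ} {n m : ℤ} (h : n + 1 = m) (c : D.Pre Z r n) :
    D.preF Z r m (D.preD hpA Z (r + 1) n m h (D.preV Z r n c)) = D.preD hpA Z r n m h c := by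
  subst h
  obtain ⟨x, ⟨v, hv⟩, rfl⟩ := cls_surjective c
  have hv1 : D.cx.d n (n + 1) rfl (Z.phiXi (r + 1) • x) = Z.xiTilde (r + 1) • v := by
    rw [map_smul, ← hv, smul_smul, mul_comm, ← Z.xiTilde_succ]
  have hv' := exists_smul_preD hpA rfl hv1
  rw [preV_cls Z ⟨v, hv1.symm⟩, preD_cls hpA rfl hv1 hv', preF_cls Z (exists_smul_preF hv'),
    preD_cls hpA rfl hv.symm]

/-- If `dx = ξ̃_{r+1} v`, then relative to `ξ̃_r` the Bockstein is represented by `φ^{r+1}(ξ) v`,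
and this factor acts as `FV = p`. The Teichmüller identity rests on this formula. -/
theorem FrobAlg.preD_preF {r : ℕ} {n m : ℤ} (h : n + 1 = m) (c : D.Pre Z (r + 1) n) :
    D.preD hpA Z r n m h (D.preF Z r n c) = p • D.preF Z r m (D.preD hpA Z (r + 1) n m h c) := by
  subst h
  obtain ⟨x, ⟨v, hv⟩, rfl⟩ := cls_surjective c
  have hv' := exists_smul_preD hpA rfl hv.symm
  have hv1 : D.cx.d n (n + 1) rfl x = Z.xiTilde r • Z.phiXi (r + 1) • v := by
    rw [← hv, smul_smul, ← Z.xiTilde_succ]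
  rw [← preF_preV, preF_cls Z ⟨_, hv1.symm⟩, preD_cls hpA rfl hv.symm hv',
    preD_cls hpA rfl hv1 (exists_smul_eq_d_smul _ (exists_smul_preF hv')),
    preF_cls Z (exists_smul_preF hv'), preV_cls Z (exists_smul_preV (exists_smul_preF hv')),
    preF_cls]

theorem FrobAlg.preD_smul {r : ℕ} {n m : ℤ} (h : n + 1 = m) (w : Ainf p A) (c : D.Pre Z r n) :
    D.preD hpA Z r n m h (w • c) = w • D.preD hpA Z r n m h c := by
  subst h
  obtain ⟨x, ⟨v, hv⟩, rfl⟩ := cls_surjective c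
  have hv' := exists_smul_preD hpA rfl hv.symm
  rw [← cls_smul w (exists_smul_eq_d_smul w ⟨v, hv⟩), preD_cls hpA rfl hv.symm hv',
    ← cls_smul w (exists_smul_eq_d_smul w hv')]
  apply preD_cls
  rw [map_smul, ← hv, smul_comm]

theorem FrobAlg.preD_mul {r : ℕ} {i j k i' j' k' : ℤ} (h : i + j = k) (hi : i + 1 = i')
    (hj : j + 1 = j') (hk : k + 1 = k') (h₁ : i' + j = k') (h₂ : i + j' = k')
    (c : D.Pre Z r i) (e : D.Pre Z r j) :
    D.preD hpA Z r k k' hk (D.mulMod (Z.xiTilde r) i j k h c e) =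
      D.mulMod (Z.xiTilde r) i' j k' h₁ (D.preD hpA Z r i i' hi c) e +
        sgn i • D.mulMod (Z.xiTilde r) i j' k' h₂ c (D.preD hpA Z r j j' hj e) :=
  bock_mulMod h _ hi hj hk h₁ h₂ c e

theorem FrobAlg.Hom.pre_preD (f : FrobAlg.Hom D D') {r : ℕ} {n m : ℤ} (h : n + 1 = m)
    (c : D.Pre Z r n) :
    f.pre Z r m (D.preD hpA Z r n m h c) = D'.preD hpA Z r n m h (f.pre Z r n c) := by
  subst h
  obtain ⟨x, ⟨v, hv⟩, rfl⟩ := cls_surjective c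
  have hv' := exists_smul_preD hpA rfl hv.symm
  rw [preD_cls hpA rfl hv.symm hv', f.pre_cls (exists_smul_pre f hv'),
    f.pre_cls (exists_smul_pre f ⟨v, hv⟩)]
  refine (preD_cls hpA rfl ?_ _).symm
  rw [f.map.comm, ← hv, map_smul]

end Regular

end Pre

/-- The identity is universal: it holds by ghost components over the torsion-free ring of integral
polynomials with one variable for each element of `B`, and is then specialised to `B`. -/
theorem W.F_teich {p : ℕ} [Fact p.Prime] {B : Type u} [CommRing B] (r : ℕ) (b : B) :
    W.F r (W.teich (r + 1) b) = (W.teich r b : W p r B) ^ p := by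
  rw [W.teich, W.F_truncate, W.teich, ← map_pow]
  congr 1
  have h : WittVector.frobenius (WittVector.teichmuller p (MvPolynomial.X b : MvPolynomial B ℤ)) =
      WittVector.teichmuller p (MvPolynomial.X b) ^ p := by
    refine ghost_ext_of_torsionFree (fun a ha => ?_) fun n => ?_
    · have hp : (p : MvPolynomial B ℤ) ≠ 0 :=
        Nat.cast_ne_zero.2 (Nat.Prime.ne_zero (Fact.out : p.Prime))
      exact (mul_eq_zero.1 ha).resolve_left hp
    · rw [WittVector.ghostComponent_frobenius, map_pow, WittVector.ghostComponent_teichmuller,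
        WittVector.ghostComponent_teichmuller, ← pow_mul, pow_succ]
  have h' := congrArg (WittVector.map (MvPolynomial.aeval (id : B → B) : _ →ₐ[ℤ] B).toRingHom) h
  rw [(WittVector.frobenius_isPoly p).map, map_pow, WittVector.map_teichmuller] at h'
  simpa using h'

/-- The lift of an additive map along an injective one whose range contains its values. -/
def liftOfInjective {X P W : Type*} [AddCommGroup X] [AddCommGroup P] [AddCommGroup W]
    {ι : W → P} (hι : Function.Injective ι) (hadd : ∀ x y, ι (x + y) = ι x + ι y) (g : X → P)
    (hg : ∀ x y, g (x + y) = g x + g y) (h : ∀ x, ∃ w, ι w = g x) : X →+ W :=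
  AddMonoidHom.mk' (fun x => (h x).choose) fun x y => hι
    ((h (x + y)).choose_spec.trans ((hg x y).trans ((congrArg₂ _ (h x).choose_spec
      (h y).choose_spec).symm.trans (hadd _ _).symm)))

/-! ### The operators on `W_r^n(D)` -/

section WittOperators

variable {p : ℕ} [Fact p.Prime] {A : Type u} [CommRing A] [Fact (¬ IsUnit (p : A))]
  [IsAdicComplete (Ideal.span {(p : A)}) A] {Z : RootSystem p A} {D D' : FrobAlg p A}
  (hpA : ∀ a : A, (p : A) * a = 0 → a = 0) (hD : D.Admissible Z)

include hD in
theorem witt_torsionFree {r n : ℕ} (c : D.Witt Z r n) (hc : p • c = 0) : c = 0 := hD.w2 r n c hc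

include hD in
-- Write `p^r = ξ̃_r - wμ`. Since `ξ̃_r` acts as zero, a class killed by `μ` is killed by `p^r`, and
-- (𝒲2) applies.
theorem witt_mu_torsionFree {r n : ℕ} (c : D.Witt Z r n) (hc : Z.mu • c = 0) : c = 0 := by
  have hp : ∀ (k : ℕ) (c : D.Witt Z r n), (p : Ainf p A) ^ k • c = 0 → c = 0 := by
    intro k
    induction k with
    | zero => intro c hc; simpa using hc
    | succ k ih =>
      intro c hc
      rw [pow_succ', mul_smul, Nat.cast_smul_eq_nsmul] at hc
      exact ih _ (witt_torsionFree hD _ hc)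
  obtain ⟨w, hw⟩ := Z.exists_xiTilde_eq r
  apply hp r
  have h : (p : Ainf p A) ^ r = Z.xiTilde r - w * Z.mu := by rw [hw, add_sub_cancel_right]
  rw [h, sub_smul, smul_Hn_modBy, mul_smul, hc, smul_zero, sub_zero]

/-- `ι` in degree `0`. -/
def incl₀ (r : ℕ) : D.Witt Z r 0 →ₗ[Ainf p A] D.Pre Z r 0 := FrobAlg.incl Z hD r 0

include hpA

theorem incl_injective (r n : ℕ) : Function.Injective (FrobAlg.incl Z hD r n) :=
  canMap_injective (D.mu_regular hpA Z) (D.xiTilde_regular hpA Z r) hD.w1 n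
    (witt_mu_torsionFree hD)

theorem incl_rep {r n : ℕ} (x : D.Witt Z r n) :
    ∃ (y : D.cx.X n) (v : D.cx.X (n + 1))
      (h : D.cx.d n (n + 1) rfl y = (Z.mu * Z.xiTilde r) • v),
      FrobAlg.incl Z hD r n x = cls (Z.xiTilde r) D.cx n (Z.mu ^ n • y) (exists_smul_pow h) :=
  canMap_rep hD.w1 n x

theorem incl_mem {r n : ℕ} {y : D.cx.X n} {v : D.cx.X (n + 1)}
    (h : D.cx.d n (n + 1) rfl y = (Z.mu * Z.xiTilde r) • v) :
    ∃ x, FrobAlg.incl Z hD r n x =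
      cls (Z.xiTilde r) D.cx n (Z.mu ^ n • y) (exists_smul_pow h) :=
  canMap_mem (D.mu_regular hpA Z) (D.xiTilde_regular hpA Z r) hD.w1 n h

theorem exists_incl_one (r : ℕ) : ∃ x, incl₀ hD r x = D.oneMod (Z.xiTilde r) := by
  obtain ⟨x, hx⟩ := incl_mem hpA hD (r := r) (n := 0) (y := D.one.1) (v := 0)
    (by rw [smul_zero]; exact (Cx.mem_cocycles rfl).1 D.one.2)
  refine ⟨x, hx.trans ?_⟩
  exact cls_congr (hy := exists_smul_eq_d_one D.toDAlg) (by rw [pow_zero, one_smul])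

/-- The powers of `μ` multiply to `μ^{i+j}`, and by the Leibniz rule the differential of the product
stays divisible by `μ ξ̃_r`. -/
theorem exists_incl_mul (r i j k : ℕ) (h : i + j = k) (x : D.Witt Z r i) (y : D.Witt Z r j) :
    ∃ z, FrobAlg.incl Z hD r k z = D.mulMod (Z.xiTilde r) i j k (by omega)
      (FrobAlg.incl Z hD r i x) (FrobAlg.incl Z hD r j y) := by
  obtain ⟨x, v, hv, hx⟩ := incl_rep hpA hD x
  obtain ⟨y, w, hw, hy⟩ := incl_rep hpA hD y
  have hk : (i : ℤ) + j + 0 = k := by omega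
  obtain ⟨z, hz⟩ := incl_mem hpA hD (r := r) (n := k) (y := D.mul.toFun i j k hk x y)
    (v := D.mul.toFun (i + 1) j (k + 1) (by omega) v y +
      sgn i • D.mul.toFun i (j + 1) (k + 1) (by omega) x w) (by
    rw [D.mul.leibniz i j k (i + 1) (j + 1) (k + 1) hk rfl rfl rfl, hv, hw, map_smul, map_smul,
      LinearMap.smul_apply, smul_add, smul_comm (sgn i)])
  refine ⟨z, hz.trans ?_⟩
  rw [hx, hy, mulMod_cls _ _ (exists_smul_eq_d_mul D.toDAlg hk (exists_smul_pow hv)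
    (exists_smul_pow hw))]
  exact cls_congr (by
    rw [map_smul, map_smul, LinearMap.smul_apply, smul_smul, ← pow_add, add_comm j, h])

/-- From `ξ φ^{-1}(μ) = μ` one gets `φ^{-1}(μ ξ̃_{r+1}) = μ ξ̃_r`, so `φ_D^{-1}(y)` satisfies the
required divisibility. The factor `ξ^n` restores `μ^n` from `φ^{-1}(μ)^n`. -/
theorem exists_incl_R (r n : ℕ) (x : D.Witt Z (r + 1) n) :
    ∃ z, FrobAlg.incl Z hD r n z = Z.xi ^ n • D.preR Z r n (FrobAlg.incl Z hD (r + 1) n x) := by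
  obtain ⟨x, v, hv, hx⟩ := incl_rep hpA hD x
  obtain ⟨z, hz⟩ := incl_mem hpA hD (r := r) (n := n) (y := D.frobInv.toFun n x)
    (v := D.frobInv.toFun (n + 1) v) (by
      rw [D.frobInv.comm, hv, LinearMap.map_smulₛₗ]
      refine congrArg (· • _) ?_
      change (phi p A).symm _ = _
      rw [map_mul, Z.phi_symm_xiTilde_succ]
      conv_rhs => rw [← Z.xi_mul_phi_symm_mu]
      ring)
  have h1 := exists_smul_preR (exists_smul_pow hv)
  refine ⟨z, hz.trans ?_⟩
  rw [hx, FrobAlg.preR_cls Z h1, ← cls_smul _ (exists_smul_eq_d_smul _ h1)]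
  refine cls_congr ?_
  rw [LinearMap.map_smulₛₗ, smul_smul]
  refine congrArg (· • _) ?_
  change _ = _ * (phi p A).symm _
  rw [map_pow, ← mul_pow, Z.xi_mul_phi_symm_mu]

theorem exists_incl_F (r n : ℕ) (x : D.Witt Z (r + 1) n) :
    ∃ z, FrobAlg.incl Z hD r n z = D.preF Z r n (FrobAlg.incl Z hD (r + 1) n x) := by
  obtain ⟨x, v, hv, hx⟩ := incl_rep hpA hD x
  obtain ⟨z, hz⟩ := incl_mem hpA hD (r := r) (n := n) (y := x) (v := Z.phiXi (r + 1) • v) (by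
    rw [hv, Z.xiTilde_succ, smul_smul, mul_assoc])
  exact ⟨z, hz.trans (by rw [hx, FrobAlg.preF_cls])⟩

theorem exists_incl_V (r n : ℕ) (x : D.Witt Z r n) :
    ∃ z, FrobAlg.incl Z hD (r + 1) n z = D.preV Z r n (FrobAlg.incl Z hD r n x) := by
  obtain ⟨x, v, hv, hx⟩ := incl_rep hpA hD x
  obtain ⟨z, hz⟩ := incl_mem hpA hD (r := r + 1) (n := n) (y := Z.phiXi (r + 1) • x) (v := v) (by
    rw [map_smul, hv, Z.xiTilde_succ, smul_smul]
    congr 1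
    ring)
  refine ⟨z, hz.trans ?_⟩
  rw [hx, FrobAlg.preV_cls Z (exists_smul_preV (exists_smul_pow hv))]
  exact cls_congr (smul_comm _ _ _)

/-- The unit of `W_r^*(D)`. -/
def wittOne (r : ℕ) : D.Witt Z r 0 := (exists_incl_one hpA hD r).choose

theorem incl_wittOne (r : ℕ) : incl₀ hD r (wittOne hpA hD r) = D.oneMod (Z.xiTilde r) :=
  (exists_incl_one hpA hD r).choose_spec

/-- The product of `W_r^*(D)`. -/
def wittMul (r i j k : ℕ) (h : i + j = k) : D.Witt Z r i →+ D.Witt Z r j →+ D.Witt Z r k :=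
  AddMonoidHom.mk' (fun x => liftOfInjective (incl_injective hpA hD r k) (map_add _) _
      (fun y y' => by rw [map_add, mulMod_add_right]) (exists_incl_mul hpA hD r i j k h x))
    (fun x x' => AddMonoidHom.ext fun y => incl_injective hpA hD r k (by
      have e := (exists_incl_mul hpA hD r i j k h x y).choose_spec
      have e' := (exists_incl_mul hpA hD r i j k h x' y).choose_spec
      refine (exists_incl_mul hpA hD r i j k h (x + x') y).choose_spec.trans ?_
      rw [map_add, mulMod_add_left, ← e, ← e', ← map_add]
      rfl))

theorem incl_wittMul (r i j k : ℕ) (h : i + j = k) (x : D.Witt Z r i) (y : D.Witt Z r j) :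
    FrobAlg.incl Z hD r k (wittMul hpA hD r i j k h x y) =
      D.mulMod (Z.xiTilde r) i j k (by omega) (FrobAlg.incl Z hD r i x)
        (FrobAlg.incl Z hD r j y) :=
  (exists_incl_mul hpA hD r i j k h x y).choose_spec

/-- The operator `R`. -/
def wittR (r n : ℕ) : D.Witt Z (r + 1) n →+ D.Witt Z r n :=
  liftOfInjective (incl_injective hpA hD r n) (map_add _) _
    (fun x y => by rw [map_add, map_add, smul_add]) (exists_incl_R hpA hD r n)

theorem incl_wittR (r n : ℕ) (x : D.Witt Z (r + 1) n) :
    FrobAlg.incl Z hD r n (wittR hpA hD r n x) =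
      Z.xi ^ n • D.preR Z r n (FrobAlg.incl Z hD (r + 1) n x) :=
  (exists_incl_R hpA hD r n x).choose_spec

/-- The operator `F`. -/
def wittF (r n : ℕ) : D.Witt Z (r + 1) n →+ D.Witt Z r n :=
  liftOfInjective (incl_injective hpA hD r n) (map_add _) _
    (fun x y => by rw [map_add, map_add]) (exists_incl_F hpA hD r n)

theorem incl_wittF (r n : ℕ) (x : D.Witt Z (r + 1) n) :
    FrobAlg.incl Z hD r n (wittF hpA hD r n x) = D.preF Z r n (FrobAlg.incl Z hD (r + 1) n x) :=
  (exists_incl_F hpA hD r n x).choose_spec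

/-- The operator `V`. -/
def wittV (r n : ℕ) : D.Witt Z r n →+ D.Witt Z (r + 1) n :=
  liftOfInjective (incl_injective hpA hD (r + 1) n) (map_add _) _
    (fun x y => by rw [map_add, map_add]) (exists_incl_V hpA hD r n)

theorem incl_wittV (r n : ℕ) (x : D.Witt Z r n) :
    FrobAlg.incl Z hD (r + 1) n (wittV hpA hD r n x) = D.preV Z r n (FrobAlg.incl Z hD r n x) :=
  (exists_incl_V hpA hD r n x).choose_spec

/-- The Bockstein differential of `W_r^*(D)`. -/
def wittD (D : FrobAlg p A) (Z : RootSystem p A) (r n : ℕ) :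
    D.Witt Z r n →+ D.Witt Z r (n + 1) :=
  bock (eta_regular (D.xiTilde_regular hpA Z r)) n ((n + 1 : ℕ) : ℤ) (Nat.cast_succ n).symm

theorem incl_wittD (r n : ℕ) (x : D.Witt Z r n) :
    FrobAlg.incl Z hD r (n + 1) (wittD hpA D Z r n x) =
      D.preD hpA Z r n ((n + 1 : ℕ) : ℤ) (Nat.cast_succ n).symm (FrobAlg.incl Z hD r n x) :=
  canMap_bock (D.mu_regular hpA Z) (D.xiTilde_regular hpA Z r) hD.w1 n (Nat.cast_succ n).symm x

/-! ### Lifting the maps `λ_r` along `ι` up to `μ`-torsion. -/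

section StructureMaps

variable {B : Type u} [CommRing B] [Algebra A B] (L : StructureMaps Z D B)

/-- `μ (x - y)` is sent to zero by the injective map `ι`, and `W_r^0(D)` has no `μ`-torsion. Hence
the structure maps are determined by their values up to `μ`-torsion. -/
theorem incl₀_unique {r : ℕ} {x y : D.Witt Z r 0} {c : D.Pre Z r 0}
    (hx : Z.mu • (incl₀ hD r x - c) = 0) (hy : Z.mu • (incl₀ hD r y - c) = 0) : x = y := by
  rw [← sub_eq_zero]
  apply witt_mu_torsionFree hD
  apply incl_injective hpA hD r 0
  change incl₀ hD r _ = incl₀ hD r _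
  rw [map_smul, map_sub, map_zero, ← sub_sub_sub_cancel_right _ _ c, smul_sub, hx, hy, sub_zero]

theorem exists_incl_lam (r : ℕ) (b : W p r B) :
    ∃ x, Z.mu • (incl₀ hD r x - L.lam r b) = 0 := by
  cases r with
  | zero =>
    refine ⟨0, ?_⟩
    -- (𝒲3) starts at `r = 1`. For `r = 0` the modulus is the empty product `1`, so the target group
    -- vanishes.
    have h1 : Z.xiTilde 0 = 1 := Finset.prod_range_zero _
    have h : ∀ c : D.Pre Z 0 0, c = 0 := fun c =>
      (one_smul (Ainf p A) c).symm.trans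
        ((congrArg (· • c) h1.symm).trans (smul_Hn_modBy (a := Z.xiTilde 0) c))
    exact h _
  | succ r => exact exists_canMap_sub hD.w1 (hD.w3 (r + 1) (by omega) 0).2 (L.lam (r + 1) b)

/-- The structure map `W_r(B) → W_r^0(D)`. -/
def wittLam (r : ℕ) : W p r B →+ D.Witt Z r 0 :=
  AddMonoidHom.mk' (fun b => (exists_incl_lam hpA hD L r b).choose) fun b b' =>
    incl₀_unique hpA hD (exists_incl_lam hpA hD L r (b + b')).choose_spec (by
      have h := (exists_incl_lam hpA hD L r b).choose_spec
      have h' := (exists_incl_lam hpA hD L r b').choose_spec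
      rw [map_add, map_add, add_sub_add_comm, smul_add, h, h', add_zero])

theorem incl_wittLam (r : ℕ) (b : W p r B) :
    Z.mu • (incl₀ hD r (wittLam hpA hD L r b) - L.lam r b) = 0 :=
  (exists_incl_lam hpA hD L r b).choose_spec

end StructureMaps

variable (hA : IsPerfectoid p A)

/-- The action of `W_r(A)` on `W_r^n(D)`. -/
def wittSmul (D : FrobAlg p A) (Z : RootSystem p A) (r n : ℕ) :
    W p r A →+* AddMonoid.End (D.Witt Z r n) :=
  RingHom.liftOfSurjective (thetaTilde p A r) (Z.thetaTilde_surjective hpA hA r)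
    ⟨Module.toAddMonoidEnd (Ainf p A) (D.Witt Z r n), fun w hw => by
      obtain ⟨v, rfl⟩ := Z.xiTilde_dvd_of_thetaTilde hpA hA r hw
      ext c
      exact (mul_smul (Z.xiTilde r) v c).trans (smul_Hn_modBy _)⟩

theorem wittSmul_thetaTilde (r n : ℕ) (w : Ainf p A) (x : D.Witt Z r n) :
    wittSmul hpA hA D Z r n (thetaTilde p A r w) x = w • x :=
  congrArg (fun f : AddMonoid.End (D.Witt Z r n) => f x)
    (RingHom.liftOfSurjective_comp_apply _ _ _ w)

end WittOperators

/-- If `p = 2m + 1`, then `-m` inverts `2` in `A^♭`, and a Witt vector over `A^♭` with invertible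
zeroth component is a unit. -/
theorem isUnit_two_Ainf {p : ℕ} [Fact p.Prime] {A : Type u} [CommRing A]
    [Fact (¬ IsUnit (p : A))] (hp : p ≠ 2) : IsUnit (2 : Ainf p A) := by
  obtain ⟨m, hm⟩ := (Fact.out : p.Prime).odd_of_ne_two hp
  have h : (2 : PreTilt A p) * (-m) = 1 := by
    have h0 : ((2 * m + 1 : ℕ) : PreTilt A p) = 0 := by
      rw [← hm]
      exact CharP.cast_eq_zero _ p
    push_cast at h0
    linear_combination -h0
  have h2 : (2 : Ainf p A).coeff 0 = (Units.mkOfMulEqOne _ _ h : PreTilt A p) :=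
    map_ofNat (WittVector.constantCoeff (p := p) (R := PreTilt A p)) 2
  exact (WittVector.mkUnit h2).isUnit

/-! ### The axioms of a Witt complex. -/

section WittComplex

variable {p : ℕ} [Fact p.Prime] {A : Type u} [CommRing A] [Fact (¬ IsUnit (p : A))]
  [IsAdicComplete (Ideal.span {(p : A)}) A] {Z : RootSystem p A} {D D' : FrobAlg p A}
  (hpA : ∀ a : A, (p : A) * a = 0 → a = 0) (hD : D.Admissible Z)

include hpA

theorem wittOne_mul (r n : ℕ) (x : D.Witt Z r n) :
    wittMul hpA hD r 0 n n (zero_add n) (wittOne hpA hD r) x = x :=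
  incl_injective hpA hD r n ((incl_wittMul hpA hD r 0 n n (zero_add n) _ x).trans
    ((congrArg (fun t => D.mulMod (Z.xiTilde r) 0 n n (zero_add (n : ℤ)) t _)
      (incl_wittOne hpA hD r)).trans (oneMod_mulMod _ _)))

theorem wittMul_comm (r i j k : ℕ) (h : i + j = k) (h' : j + i = k) (x : D.Witt Z r i)
    (y : D.Witt Z r j) :
    wittMul hpA hD r i j k h x y = (-1 : ℤ) ^ (i * j) • wittMul hpA hD r j i k h' y x := by
  apply incl_injective hpA hD r k
  rw [incl_wittMul, map_zsmul, incl_wittMul, mulMod_comm _ (by omega), ← Nat.cast_mul,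
    sgn_natCast]

/-- Graded commutativity only yields `2x² = 0`. For `p = 2` the factor is removed by (𝒲2), and for
odd `p` it is a unit of `W(A^♭)`. -/
theorem wittMul_self (r i k : ℕ) (h : i + i = k) (x : D.Witt Z r i) (hi : Odd i) :
    wittMul hpA hD r i i k h x x = 0 := by
  have h1 := wittMul_comm hpA hD r i i k h h x x
  rw [(hi.mul hi).neg_one_pow, neg_smul, one_smul, eq_neg_iff_add_eq_zero, ← two_smul (Ainf p A)]
    at h1
  by_cases hp : p = 2
  · subst hp
    exact witt_torsionFree hD _ ((Nat.cast_smul_eq_nsmul (Ainf 2 A) 2 _).symm.trans h1)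
  · exact (isUnit_two_Ainf (A := A) hp).smul_eq_zero.1 h1

theorem wittMul_assoc (r i j k ij jk l : ℕ) (h : i + j = ij) (h' : j + k = jk) (hl : ij + k = l)
    (hl' : i + jk = l) (x : D.Witt Z r i) (y : D.Witt Z r j) (z : D.Witt Z r k) :
    wittMul hpA hD r ij k l hl (wittMul hpA hD r i j ij h x y) z =
      wittMul hpA hD r i jk l hl' x (wittMul hpA hD r j k jk h' y z) := by
  apply incl_injective hpA hD r l
  rw [incl_wittMul, incl_wittMul, incl_wittMul, incl_wittMul, mulMod_assoc]

theorem smul_wittMul (r i j k : ℕ) (h : i + j = k) (w : Ainf p A) (x : D.Witt Z r i)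
    (y : D.Witt Z r j) :
    wittMul hpA hD r i j k h (w • x) y = w • wittMul hpA hD r i j k h x y := by
  apply incl_injective hpA hD r k
  rw [incl_wittMul, map_smul, map_smul, incl_wittMul, mulMod_smul_left]

include hD in
theorem wittD_wittD (r n : ℕ) (x : D.Witt Z r n) :
    wittD hpA D Z r (n + 1) (wittD hpA D Z r n x) = 0 := by
  apply incl_injective hpA hD r (n + 1 + 1)
  rw [incl_wittD, incl_wittD, FrobAlg.preD_preD, map_zero]

theorem wittD_mul (r i j k : ℕ) (h : i + j = k) (h₁ : i + 1 + j = k + 1)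
    (h₂ : i + (j + 1) = k + 1) (x : D.Witt Z r i) (y : D.Witt Z r j) :
    wittD hpA D Z r k (wittMul hpA hD r i j k h x y) =
      wittMul hpA hD r (i + 1) j (k + 1) h₁ (wittD hpA D Z r i x) y +
        (-1 : ℤ) ^ i • wittMul hpA hD r i (j + 1) (k + 1) h₂ x (wittD hpA D Z r j y) := by
  apply incl_injective hpA hD r (k + 1)
  rw [incl_wittD, incl_wittMul, map_add, map_zsmul, incl_wittMul, incl_wittMul, incl_wittD,
    incl_wittD, FrobAlg.preD_mul hpA _ (Nat.cast_succ i).symm (Nat.cast_succ j).symm _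
      (by omega) (by omega), sgn_natCast]

include hD in
theorem wittD_smul (r n : ℕ) (w : Ainf p A) (x : D.Witt Z r n) :
    wittD hpA D Z r n (w • x) = w • wittD hpA D Z r n x := by
  apply incl_injective hpA hD r (n + 1)
  rw [incl_wittD hpA hD, LinearMap.map_smul, FrobAlg.preD_smul, LinearMap.map_smul,
    incl_wittD hpA hD]

theorem wittR_one (r : ℕ) : wittR hpA hD r 0 (wittOne hpA hD (r + 1)) = wittOne hpA hD r :=
  incl_injective hpA hD r 0 ((incl_wittR hpA hD r 0 _).trans (((congrArg (· • _) (pow_zero Z.xi)).trans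
    (one_smul (Ainf p A) _)).trans ((congrArg (D.preR Z r 0) (incl_wittOne hpA hD (r + 1))).trans
      (FrobAlg.preR_one.trans (incl_wittOne hpA hD r).symm))))

theorem wittR_mul (r i j k : ℕ) (h : i + j = k) (x : D.Witt Z (r + 1) i)
    (y : D.Witt Z (r + 1) j) :
    wittR hpA hD r k (wittMul hpA hD (r + 1) i j k h x y) =
      wittMul hpA hD r i j k h (wittR hpA hD r i x) (wittR hpA hD r j y) := by
  apply incl_injective hpA hD r k
  rw [incl_wittR, incl_wittMul, incl_wittMul, incl_wittR, incl_wittR, FrobAlg.preR_mul,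
    mulMod_smul_left, mulMod_smul_right, smul_smul, ← pow_add, h]

theorem wittR_smul (r n : ℕ) (w : Ainf p A) (x : D.Witt Z (r + 1) n) :
    wittR hpA hD r n (w • x) = (phi p A).symm w • wittR hpA hD r n x := by
  apply incl_injective hpA hD r n
  rw [incl_wittR, LinearMap.map_smul, LinearMap.map_smulₛₗ, LinearMap.map_smul, incl_wittR,
    smul_comm]
  rfl

/-- The factor `ξ` in `d R' = ξ R' d` raises `ξ^n` to `ξ^{n+1}`, the twist of `R` in the next
degree. -/
theorem wittR_wittD (r n : ℕ) (x : D.Witt Z (r + 1) n) :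
    wittR hpA hD r (n + 1) (wittD hpA D Z (r + 1) n x) =
      wittD hpA D Z r n (wittR hpA hD r n x) := by
  apply incl_injective hpA hD r (n + 1)
  rw [incl_wittR, incl_wittD, incl_wittD hpA hD, incl_wittR, FrobAlg.preD_smul, FrobAlg.preD_preR,
    smul_smul, pow_succ]

theorem wittF_one (r : ℕ) : wittF hpA hD r 0 (wittOne hpA hD (r + 1)) = wittOne hpA hD r :=
  incl_injective hpA hD r 0 ((incl_wittF hpA hD r 0 _).trans
    ((congrArg (D.preF Z r 0) (incl_wittOne hpA hD (r + 1))).trans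
      (FrobAlg.preF_one.trans (incl_wittOne hpA hD r).symm)))

theorem wittF_mul (r i j k : ℕ) (h : i + j = k) (x : D.Witt Z (r + 1) i)
    (y : D.Witt Z (r + 1) j) :
    wittF hpA hD r k (wittMul hpA hD (r + 1) i j k h x y) =
      wittMul hpA hD r i j k h (wittF hpA hD r i x) (wittF hpA hD r j y) := by
  apply incl_injective hpA hD r k
  rw [incl_wittF, incl_wittMul, incl_wittMul, incl_wittF, incl_wittF, FrobAlg.preF_mul]

theorem wittF_smul (r n : ℕ) (w : Ainf p A) (x : D.Witt Z (r + 1) n) :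
    wittF hpA hD r n (w • x) = w • wittF hpA hD r n x := by
  apply incl_injective hpA hD r n
  rw [incl_wittF, map_smul, map_smul, map_smul, incl_wittF]

theorem wittV_smul (r n : ℕ) (w : Ainf p A) (x : D.Witt Z r n) :
    wittV hpA hD r n (w • x) = w • wittV hpA hD r n x := by
  apply incl_injective hpA hD (r + 1) n
  rw [incl_wittV, map_smul, map_smul, map_smul, incl_wittV]

theorem wittV_mul (r i j k : ℕ) (h : i + j = k) (x : D.Witt Z (r + 1) i) (y : D.Witt Z r j) :
    wittV hpA hD r k (wittMul hpA hD r i j k h (wittF hpA hD r i x) y) =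
      wittMul hpA hD (r + 1) i j k h x (wittV hpA hD r j y) := by
  apply incl_injective hpA hD (r + 1) k
  rw [incl_wittV, incl_wittMul, incl_wittMul, incl_wittF, incl_wittV, FrobAlg.preV_mul]

theorem wittR_wittF (r n : ℕ) (x : D.Witt Z (r + 1 + 1) n) :
    wittR hpA hD r n (wittF hpA hD (r + 1) n x) = wittF hpA hD r n (wittR hpA hD (r + 1) n x) := by
  apply incl_injective hpA hD r n
  rw [incl_wittR, incl_wittF, incl_wittF, incl_wittR, map_smul, FrobAlg.preR_preF]

theorem wittR_wittV (r n : ℕ) (x : D.Witt Z (r + 1) n) :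
    wittR hpA hD (r + 1) n (wittV hpA hD (r + 1) n x) =
      wittV hpA hD r n (wittR hpA hD r n x) := by
  apply incl_injective hpA hD (r + 1) n
  rw [incl_wittR, incl_wittV, incl_wittV, incl_wittR, map_smul, FrobAlg.preR_preV]

theorem wittF_wittV (r n : ℕ) (x : D.Witt Z r n) :
    wittF hpA hD r n (wittV hpA hD r n x) = p • x := by
  apply incl_injective hpA hD r n
  rw [incl_wittF, incl_wittV, FrobAlg.preF_preV, map_nsmul]

theorem wittF_wittD_wittV (r n : ℕ) (x : D.Witt Z r n) :
    wittF hpA hD r (n + 1) (wittD hpA D Z (r + 1) n (wittV hpA hD r n x)) =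
      wittD hpA D Z r n x := by
  apply incl_injective hpA hD r (n + 1)
  rw [incl_wittF, incl_wittD hpA hD, incl_wittV, incl_wittD hpA hD, FrobAlg.preF_preD_preV]

theorem wittD_wittF (r n : ℕ) (x : D.Witt Z (r + 1) n) :
    wittD hpA D Z r n (wittF hpA hD r n x) =
      p • wittF hpA hD r (n + 1) (wittD hpA D Z (r + 1) n x) := by
  apply incl_injective hpA hD r (n + 1)
  rw [map_nsmul, incl_wittF, incl_wittD hpA hD, incl_wittF, incl_wittD hpA hD, FrobAlg.preD_preF]

/-! ### The axioms for the structure maps and the Teichmüller identity. -/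

section StructureMaps

variable {B : Type u} [CommRing B] [Algebra A B] (L : StructureMaps Z D B)

theorem mu_smul_incl_wittLam (r : ℕ) (b : W p r B) :
    Z.mu • incl₀ hD r (wittLam hpA hD L r b) = Z.mu • L.lam r b := by
  rw [← sub_eq_zero, ← smul_sub, incl_wittLam]

theorem eq_wittLam {r : ℕ} {b : W p r B} {x : D.Witt Z r 0}
    (h : Z.mu • incl₀ hD r x = Z.mu • L.lam r b) : wittLam hpA hD L r b = x :=
  incl₀_unique hpA hD (incl_wittLam hpA hD L r b) (by rw [smul_sub, h, sub_self])

theorem wittLam_mul (r : ℕ) (b b' : W p r B) :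
    wittLam hpA hD L r (b * b') =
      wittMul hpA hD r 0 0 0 rfl (wittLam hpA hD L r b) (wittLam hpA hD L r b') := by
  apply eq_wittLam
  have h : incl₀ hD r (wittMul hpA hD r 0 0 0 rfl (wittLam hpA hD L r b) (wittLam hpA hD L r b')) =
    D.mulMod (Z.xiTilde r) 0 0 0 rfl (incl₀ hD r (wittLam hpA hD L r b))
      (incl₀ hD r (wittLam hpA hD L r b')) := incl_wittMul hpA hD r 0 0 0 rfl _ _
  rw [h, ← mulMod_smul_left, mu_smul_incl_wittLam, mulMod_smul_left, ← mulMod_smul_right,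
    mu_smul_incl_wittLam, mulMod_smul_right, L.lam_mul]

theorem wittLam_algebraMap (r : ℕ) (w : Ainf p A) :
    wittLam hpA hD L r (W.map r (algebraMap A B) (thetaTilde p A r w)) =
      w • wittOne hpA hD r := by
  apply eq_wittLam
  rw [map_smul, incl_wittOne, L.lam_algebraMap]

theorem wittLam_R (r : ℕ) (b : W p (r + 1) B) :
    wittLam hpA hD L r (W.R r b) = wittR hpA hD r 0 (wittLam hpA hD L (r + 1) b) := by
  apply eq_wittLam
  have h : incl₀ hD r (wittR hpA hD r 0 (wittLam hpA hD L (r + 1) b)) =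
      D.preR Z r 0 (incl₀ hD (r + 1) (wittLam hpA hD L (r + 1) b)) :=
    (incl_wittR hpA hD r 0 _).trans ((congrArg (· • _) (pow_zero Z.xi)).trans
      (one_smul (Ainf p A) _))
  -- Semilinearity turns `μ` into `φ^{-1}(μ)` when it leaves `R'`, and the factor `ξ` completes this
  -- to `μ`. Thus a factor `μ` outside can be moved inside `R'`.
  have h' (c : D.Pre Z (r + 1) 0) : Z.mu • D.preR Z r 0 c = Z.xi • D.preR Z r 0 (Z.mu • c) := by
    rw [LinearMap.map_smulₛₗ, smul_smul]
    exact congrArg (· • _) Z.xi_mul_phi_symm_mu.symm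
  rw [h, L.lam_R, h', h', mu_smul_incl_wittLam]

theorem wittLam_F (r : ℕ) (b : W p (r + 1) B) :
    wittLam hpA hD L r (W.F r b) = wittF hpA hD r 0 (wittLam hpA hD L (r + 1) b) := by
  apply eq_wittLam
  have h : incl₀ hD r (wittF hpA hD r 0 (wittLam hpA hD L (r + 1) b)) =
    D.preF Z r 0 (incl₀ hD (r + 1) (wittLam hpA hD L (r + 1) b)) := incl_wittF hpA hD r 0 _
  rw [h, L.lam_F, ← map_smul, mu_smul_incl_wittLam, map_smul]

theorem wittLam_V (r : ℕ) (b : W p r B) :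
    wittLam hpA hD L (r + 1) (W.V r b) = wittV hpA hD r 0 (wittLam hpA hD L r b) := by
  apply eq_wittLam
  have h : incl₀ hD (r + 1) (wittV hpA hD r 0 (wittLam hpA hD L r b)) =
    D.preV Z r 0 (incl₀ hD r (wittLam hpA hD L r b)) := incl_wittV hpA hD r 0 _
  rw [h, L.lam_V, ← map_smul, mu_smul_incl_wittLam, map_smul]

theorem wittLam_one (r : ℕ) : wittLam hpA hD L r 1 = wittOne hpA hD r := by
  have h := wittLam_algebraMap hpA hD L r 1
  rwa [map_one, map_one, one_smul] at h

/-- The power rule in a commutative differential graded algebra. With `m + 1 = p` its right side is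
`p` times that of the Teichmüller identity. -/
theorem wittD_wittLam_pow (r m : ℕ) (t : W p r B) :
    wittD hpA D Z r 0 (wittLam hpA hD L r (t ^ (m + 1))) =
      (m + 1) • wittMul hpA hD r 0 1 1 rfl (wittLam hpA hD L r (t ^ m))
        (wittD hpA D Z r 0 (wittLam hpA hD L r t)) := by
  induction m with
  | zero =>
    rw [pow_zero, wittLam_one, pow_succ, pow_zero, one_mul]
    exact ((one_smul ℕ _).trans (wittOne_mul hpA hD r 1 _)).symm
  | succ m ih =>
    rw [pow_succ', wittLam_mul, wittD_mul hpA hD r 0 0 0 rfl rfl rfl, ih, pow_zero, one_smul,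
      wittMul_comm hpA hD r 1 0 1 rfl rfl, mul_zero, pow_zero, one_smul, map_nsmul,
      ← wittMul_assoc hpA hD r 0 0 1 0 1 1 rfl rfl rfl rfl, ← wittLam_mul, ← pow_succ',
      succ_nsmul' _ (m + 1)]

/-- Suppressing `λ`, one has `p F d[b] = d F[b] = d([b]^p) = p [b]^{p-1} d[b]`, and (𝒲2) permits the
cancellation of `p`. -/
theorem wittF_wittD_teich (r : ℕ) (b : B) :
    wittF hpA hD r 1 (wittD hpA D Z (r + 1) 0 (wittLam hpA hD L (r + 1) (W.teich (r + 1) b))) =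
      wittMul hpA hD r 0 1 1 rfl (wittLam hpA hD L r (W.teich r b ^ (p - 1)))
        (wittD hpA D Z r 0 (wittLam hpA hD L r (W.teich r b))) := by
  rw [← sub_eq_zero]
  apply witt_torsionFree hD
  have hp : p - 1 + 1 = p := Nat.sub_add_cancel (Fact.out : p.Prime).one_le
  have h := wittD_wittLam_pow hpA hD L r (p - 1) (W.teich r b)
  rw [hp, ← W.F_teich, wittLam_F, wittD_wittF] at h
  rw [smul_sub, sub_eq_zero]
  exact h

variable (hA : IsPerfectoid p A)

/-- The Witt complex attached to `D` and `λ`. -/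
def wittStr : WittStr p A B (D.Witt Z) where
  smul := wittSmul hpA hA D Z
  one := wittOne hpA hD
  mul := wittMul hpA hD
  d := wittD hpA D Z
  R := wittR hpA hD
  F := wittF hpA hD
  V := wittV hpA hD
  lam := wittLam hpA hD L
  one_mul := wittOne_mul hpA hD
  mul_comm r i j k h x y := wittMul_comm hpA hD r i j k h _ x y
  mul_self := wittMul_self hpA hD
  mul_assoc r i j k ij jk l h h' hl x y z := wittMul_assoc hpA hD r i j k ij jk l h h' hl _ x y z
  smul_mul r i j k h a x y := by
    obtain ⟨w, rfl⟩ := Z.thetaTilde_surjective hpA hA r a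
    rw [wittSmul_thetaTilde, wittSmul_thetaTilde, smul_wittMul]
  d_d := wittD_wittD hpA hD
  leibniz r i j k h x y := wittD_mul hpA hD r i j k h _ _ x y
  d_smul r n a x := by
    obtain ⟨w, rfl⟩ := Z.thetaTilde_surjective hpA hA r a
    rw [wittSmul_thetaTilde, wittSmul_thetaTilde, wittD_smul hpA hD]
  R_one := wittR_one hpA hD
  R_mul := wittR_mul hpA hD
  R_smul r n a x := by
    obtain ⟨w, rfl⟩ := Z.thetaTilde_surjective hpA hA (r + 1) a
    rw [wittSmul_thetaTilde, R_thetaTilde, wittSmul_thetaTilde, wittR_smul]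
  R_d := wittR_wittD hpA hD
  F_one := wittF_one hpA hD
  F_mul := wittF_mul hpA hD
  F_smul r n a x := by
    obtain ⟨w, rfl⟩ := Z.thetaTilde_surjective hpA hA (r + 1) a
    rw [wittSmul_thetaTilde, F_thetaTilde, wittSmul_thetaTilde, wittF_smul]
  V_smul r n a x := by
    obtain ⟨w, rfl⟩ := Z.thetaTilde_surjective hpA hA (r + 1) a
    rw [wittSmul_thetaTilde, F_thetaTilde, wittSmul_thetaTilde, wittV_smul]
  V_mul := wittV_mul hpA hD
  R_F := wittR_wittF hpA hD
  R_V := wittR_wittV hpA hD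
  F_V := wittF_wittV hpA hD
  F_d_V := wittF_wittD_wittV hpA hD
  lam_mul := wittLam_mul hpA hD L
  lam_algebraMap r a := by
    obtain ⟨w, rfl⟩ := Z.thetaTilde_surjective hpA hA r a
    rw [wittSmul_thetaTilde, wittLam_algebraMap]
  lam_R := wittLam_R hpA hD L
  lam_F := wittLam_F hpA hD L
  lam_V := wittLam_V hpA hD L
  teich := wittF_wittD_teich hpA hD L

theorem wittStr_isCanonical : IsCanonical Z hD L (wittStr hpA hD L hA) where
  smul := wittSmul_thetaTilde hpA hA
  one := incl_wittOne hpA hD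
  mul := incl_wittMul hpA hD
  d r _ := bock_isBockstein (eta_regular (D.xiTilde_regular hpA Z r)) _ _ _
  R := incl_wittR hpA hD
  F := incl_wittF hpA hD
  V := incl_wittV hpA hD
  lam := incl_wittLam hpA hD L

end StructureMaps

end WittComplex

/-- The composite of two morphisms of Witt complexes. -/
def WittStr.Hom.comp {p : ℕ} [Fact p.Prime] {A B B' B'' : Type u} [CommRing A] [CommRing B]
    [Algebra A B] [CommRing B'] [Algebra A B'] [CommRing B''] [Algebra A B'']
    {X Y V : ℕ → ℕ → Type u} [∀ r n, AddCommGroup (X r n)] [∀ r n, AddCommGroup (Y r n)]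
    [∀ r n, AddCommGroup (V r n)] {S : WittStr p A B X} {T : WittStr p A B' Y}
    {U : WittStr p A B'' V} {g' : B' →ₐ[A] B''} {g : B →ₐ[A] B'} (h : WittStr.Hom g' T U)
    (u : WittStr.Hom g S T) : WittStr.Hom (g'.comp g) S U where
  toFun r n := (h.toFun r n).comp (u.toFun r n)
  map_smul r n a x := (congrArg _ (u.map_smul r n a x)).trans (h.map_smul r n a _)
  map_one r := (congrArg _ (u.map_one r)).trans (h.map_one r)
  map_mul r i j k e x y := (congrArg _ (u.map_mul r i j k e x y)).trans (h.map_mul r i j k e _ _)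
  map_d r n x := (congrArg _ (u.map_d r n x)).trans (h.map_d r n _)
  map_R r n x := (congrArg _ (u.map_R r n x)).trans (h.map_R r n _)
  map_F r n x := (congrArg _ (u.map_F r n x)).trans (h.map_F r n _)
  map_V r n x := (congrArg _ (u.map_V r n x)).trans (h.map_V r n _)
  map_lam r b := ((congrArg _ (u.map_lam r b)).trans (h.map_lam r _)).trans
    (congrArg _ (W.map_map r _ _ b))

/-! ### Uniqueness of the structure and functoriality in `D` and `B`. -/

section Canonical

variable {p : ℕ} [Fact p.Prime] {A : Type u} [CommRing A] [Fact (¬ IsUnit (p : A))]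
  [IsAdicComplete (Ideal.span {(p : A)}) A] {Z : RootSystem p A} {D D' : FrobAlg p A}
  (hpA : ∀ a : A, (p : A) * a = 0 → a = 0) (hA : IsPerfectoid p A) {hD : D.Admissible Z}
  {hD' : D'.Admissible Z} {B B' : Type u} [CommRing B] [Algebra A B] [CommRing B'] [Algebra A B']
  {L : StructureMaps Z D B} {L' : StructureMaps Z D' B'} {S T : WittStr p A B (D.Witt Z)}
  {S' : WittStr p A B' (D'.Witt Z)}

include hpA

theorem IsCanonical.d_eq (hS : IsCanonical Z hD L S) (r n : ℕ) (x : D.Witt Z r n) :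
    S.d r n x = wittD hpA D Z r n x :=
  congrFun (isBockstein_unique (eta_regular (D.xiTilde_regular hpA Z r)) n _ _ (hS.d r n)
    (bock_isBockstein (eta_regular (D.xiTilde_regular hpA Z r)) n _ _)) x

theorem IsCanonical.incl_d (hS : IsCanonical Z hD L S) (r n : ℕ) (x : D.Witt Z r n) :
    FrobAlg.incl Z hD r (n + 1) (S.d r n x) =
      D.preD hpA Z r n ((n + 1 : ℕ) : ℤ) (Nat.cast_succ n).symm (FrobAlg.incl Z hD r n x) := by
  rw [hS.d_eq hpA, incl_wittD hpA hD]

include hA in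
/-- The Witt complex structure attached to `D` and `λ` is unique. -/
theorem IsCanonical.unique (hS : IsCanonical Z hD L S) (hT : IsCanonical Z hD L T) : S = T := by
  have h_smul : S.smul = T.smul := by
    funext r n
    ext a x
    obtain ⟨w, rfl⟩ := Z.thetaTilde_surjective hpA hA r a
    exact (hS.smul r n w x).trans (hT.smul r n w x).symm
  have h_one : S.one = T.one := funext fun r =>
    incl_injective hpA hD r 0 ((hS.one r).trans (hT.one r).symm)
  have h_mul : S.mul = T.mul := by
    funext r i j k h
    ext x y
    exact incl_injective hpA hD r k ((hS.mul r i j k h x y).trans (hT.mul r i j k h x y).symm)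
  have h_d : S.d = T.d := by
    funext r n
    ext x
    exact (hS.d_eq hpA r n x).trans (hT.d_eq hpA r n x).symm
  have h_R : S.R = T.R := by
    funext r n
    ext x
    exact incl_injective hpA hD r n ((hS.R r n x).trans (hT.R r n x).symm)
  have h_F : S.F = T.F := by
    funext r n
    ext x
    exact incl_injective hpA hD r n ((hS.F r n x).trans (hT.F r n x).symm)
  have h_V : S.V = T.V := by
    funext r n
    ext x
    exact incl_injective hpA hD (r + 1) n ((hS.V r n x).trans (hT.V r n x).symm)
  have h_lam : S.lam = T.lam := by
    funext r
    ext b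
    exact incl₀_unique hpA hD (hS.lam r b) (hT.lam r b)
  -- The remaining fields are propositions, so equality of the data suffices.
  clear hS hT
  cases S
  cases T
  cases h_smul
  cases h_one
  cases h_mul
  cases h_d
  cases h_R
  cases h_F
  cases h_V
  cases h_lam
  rfl

omit hpA in
-- The map `f` is linear and so commutes with multiplication by `μ^n`. Together with the injectivity
-- of `ι` for `D'`, this deduces compatibility with the operators from the same compatibility on
-- `H^*(D/ξ̃_r)`.
theorem FrobAlg.Hom.pre_incl (f : FrobAlg.Hom D D') (hD : D.Admissible Z) (hD' : D'.Admissible Z)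
    (r n : ℕ) (x : D.Witt Z r n) :
    f.pre Z r n (FrobAlg.incl Z hD r n x) = FrobAlg.incl Z hD' r n (f.witt Z r n x) := by
  obtain ⟨w, hw, rfl⟩ := cls_surjective x
  have hx := exists_smul_pre f (exists_smul_pow_etaFst hw)
  have h : cls (Z.xiTilde r) D'.cx n (f.map.toFun n (Z.mu ^ n • etaFst Z.mu D.cx n w)) hx =
      cls (Z.xiTilde r) D'.cx n (Z.mu ^ n • f.map.toFun n (etaFst Z.mu D.cx n w))
        (by rwa [map_smul] at hx) := cls_congr (map_smul (f.map.toFun n) _ _)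
  exact h

/-- The morphism of Witt complexes induced by a morphism of algebras with Frobenius. -/
def wittHom (f : FrobAlg.Hom D D') (g : B →ₐ[A] B')
    (hfg : ∀ r b, f.pre Z r 0 (L.lam r b) = L'.lam r (W.map r (g : B →+* B') b))
    (hS : IsCanonical Z hD L S) (hS' : IsCanonical Z hD' L' S') : WittStr.Hom g S S' where
  toFun r n := (f.witt Z r n).toAddMonoidHom
  map_smul r n a x := by
    obtain ⟨w, rfl⟩ := Z.thetaTilde_surjective hpA hA r a
    rw [hS.smul, hS'.smul]
    exact map_smul (f.witt Z r n) _ _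
  map_one r := incl_injective hpA hD' r 0 ((f.pre_incl hD hD' r 0 _).symm.trans
    ((congrArg (f.pre Z r 0) (hS.one r)).trans (f.pre_one.trans (hS'.one r).symm)))
  map_mul r i j k h x y := incl_injective hpA hD' r k (by
    change FrobAlg.incl Z hD' r k (f.witt Z r k _) = FrobAlg.incl Z hD' r k
      (S'.mul r i j k h (f.witt Z r i x) (f.witt Z r j y))
    rw [hS'.mul, ← f.pre_incl hD hD', ← f.pre_incl hD hD', ← f.pre_incl hD hD', hS.mul, f.pre_mul])
  map_d r n x := incl_injective hpA hD' r (n + 1) (by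
    change FrobAlg.incl Z hD' r (n + 1) (f.witt Z r (n + 1) _) =
      FrobAlg.incl Z hD' r (n + 1) (S'.d r n (f.witt Z r n x))
    rw [hS'.incl_d hpA, ← f.pre_incl hD hD', ← f.pre_incl hD hD', hS.incl_d hpA, f.pre_preD])
  map_R r n x := incl_injective hpA hD' r n (by
    change FrobAlg.incl Z hD' r n (f.witt Z r n _) =
      FrobAlg.incl Z hD' r n (S'.R r n (f.witt Z (r + 1) n x))
    rw [hS'.R, ← f.pre_incl hD hD', ← f.pre_incl hD hD', hS.R, map_smul, f.pre_preR])
  map_F r n x := incl_injective hpA hD' r n (by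
    change FrobAlg.incl Z hD' r n (f.witt Z r n _) =
      FrobAlg.incl Z hD' r n (S'.F r n (f.witt Z (r + 1) n x))
    rw [hS'.F, ← f.pre_incl hD hD', ← f.pre_incl hD hD', hS.F, f.pre_preF])
  map_V r n x := incl_injective hpA hD' (r + 1) n (by
    change FrobAlg.incl Z hD' (r + 1) n (f.witt Z (r + 1) n _) =
      FrobAlg.incl Z hD' (r + 1) n (S'.V r n (f.witt Z r n x))
    rw [hS'.V, ← f.pre_incl hD hD', ← f.pre_incl hD hD', hS.V, f.pre_preV])
  -- The image under `f` of the torsion relation for `D` is the relation that characterises the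
  -- structure map of `D'`.
  map_lam r b := incl₀_unique hpA hD' (by
    have h := congrArg (f.pre Z r 0) (hS.lam r b)
    rw [map_zero] at h
    refine Eq.trans ?_ h
    rw [← hfg]
    refine Eq.trans ?_ (map_smul (f.pre Z r 0) _ _).symm
    refine congrArg (Z.mu • ·) (Eq.trans ?_ (map_sub (f.pre Z r 0) _ _).symm)
    exact congrArg (· - _) (f.pre_incl hD hD' r 0 _).symm) (hS'.lam r _)

end Canonical

end AInf

end

theorem mainTheorem7 {p : ℕ} [Fact p.Prime] {A : Type u} [CommRing A] [Fact (¬ IsUnit (p : A))]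
    [IsAdicComplete (Ideal.span {(p : A)}) A] (hA : AInf.IsPerfectoid p A)
    (hpA : ∀ a : A, (p : A) * a = 0 → a = 0) (Z : AInf.RootSystem p A) :
    -- the Witt complex and its universal map
    (∀ (D : AInf.FrobAlg p A) (hD : D.Admissible Z) (B : Type u) [CommRing B] [Algebra A B]
      (L : AInf.StructureMaps Z D B),
      (∃! S : AInf.WittStr p A B (D.Witt Z), AInf.IsCanonical Z hD L S) ∧
      (∀ S : AInf.WittStr p A B (D.Witt Z), AInf.IsCanonical Z hD L S →
        ∃ u : AInf.WittStr.Hom (AlgHom.id A B) (AInf.deRhamWitt.str p A B) S, ∀ u', u' = u)) ∧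
    -- functoriality
    (∀ (D D' : AInf.FrobAlg p A) (hD : D.Admissible Z) (hD' : D'.Admissible Z)
      (B B' : Type u) [CommRing B] [Algebra A B] [CommRing B'] [Algebra A B']
      (L : AInf.StructureMaps Z D B) (L' : AInf.StructureMaps Z D' B')
      (f : AInf.FrobAlg.Hom D D') (g : B →ₐ[A] B'),
      (∀ r b, f.pre Z r 0 (L.lam r b) = L'.lam r (AInf.W.map r (g : B →+* B') b)) →
      ∀ (S : AInf.WittStr p A B (D.Witt Z)) (S' : AInf.WittStr p A B' (D'.Witt Z)),
        AInf.IsCanonical Z hD L S → AInf.IsCanonical Z hD' L' S' →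
        (∃ h : AInf.WittStr.Hom g S S', ∀ r n x, h.toFun r n x = f.witt Z r n x) ∧
        ∀ (u : AInf.WittStr.Hom (AlgHom.id A B) (AInf.deRhamWitt.str p A B) S)
          (u' : AInf.WittStr.Hom (AlgHom.id A B') (AInf.deRhamWitt.str p A B') S')
          (r n : ℕ) (x : AInf.deRhamWitt.Omega p A B r n),
          f.witt Z r n (u.toFun r n x) = u'.toFun r n ((AInf.deRhamWitt.map g).toFun r n x)) := by
  refine ⟨fun D hD B _ _ L => ⟨?_, fun S _ => ⟨AInf.deRhamWitt.lift _ S,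
    AInf.deRhamWitt.hom_unique _ S⟩⟩, fun D D' hD hD' B B' _ _ _ _ L L' f g hfg S S' hS hS' =>
    ⟨⟨AInf.wittHom hpA hA f g hfg hS hS', fun _ _ _ => rfl⟩, fun u u' r n x => ?_⟩⟩
  · exact ⟨AInf.wittStr hpA hD L hA, AInf.wittStr_isCanonical hpA hD L hA,
      fun S hS => hS.unique hpA hA (AInf.wittStr_isCanonical hpA hD L hA)⟩
  -- Both sides of the square are morphisms over `g` out of the de Rham–Witt complex of `B`, which
  -- admits only one.
  · have h : ∀ v v' : AInf.WittStr.Hom g (AInf.deRhamWitt.str p A B) S', v = v' := fun v v' =>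
      (AInf.deRhamWitt.hom_unique g S' v).trans (AInf.deRhamWitt.hom_unique g S' v').symm
    exact congrArg (fun v : AInf.WittStr.Hom g (AInf.deRhamWitt.str p A B) S' => v.toFun r n x)
      (h ((AInf.wittHom hpA hA f g hfg hS hS').comp u) (u'.comp (AInf.deRhamWitt.map g)))
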